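/- Let $0<b_2<b_1<1$, $\tau=b_2/b_1\in(0,1)$, and $\kappa=\frac{1-b_1}{1-b_2}$. **The Markov chain.** Let $\mathbb W_\infty$ be the set of strictly increasing integer sequences $\mathbf X=(x_1<x_2<\dots)$ with $x_{i+1}=x_i+1$ for all large $i$. A one-row configuration $\ell$ assigns to each site of $\mathbb Z$ one of six vertex types, given by its bold edges: $a_1$ (none), $a_2$ (all four), $b_1$ (south and north), $b_2$ (west and east), $c_1$ (south and east), $c_2$ (west and north). It sends $\mathbf X$ to $\mathbf Y$ if the east edge of each site is bold exactly when the west edge of the next site is, all west edges sufficiently far to the left are not bold, the sites with bold south edge are the elements of $\mathbf X$, and the sites with bold north edge are the elements of $\mathbf Y$. There is at most one such $\ell$. Let $\mathcal T(\mathbf X\to\mathbf Y)$ be the (infinite) product over all sites of the vertex weights $(a_1,a_2,b_1,b_2,c_1,c_2)=(1,1,b_1,b_2,1-b_1,1-b_2)$ of this row, and $0$ if there is no such row. Let $\mathcal T_t$ be the $t$-th power of the matrix $\mathcal T$, let $step=(1,2,3,\dots)$, and put $\mathbb E_{step}(f;t)=\sum_{\mathbf X\in\mathbb W_\infty}\mathcal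 T_t(step\to\mathbf X)f(\mathbf X)$ and $N_x(\mathbf X)=\#\{i: x_i\le x\}$. **Theorem.** For every positive integer $t$, every $L=0,1,2,\dots$ and every integer $x$, the series defining $\mathbb E_{step}(\tau^{LN_x};t)$ converges absolutely and $$ \mathbb E_{step}\left(\tau^{L N_x};t\right)=\frac{\tau^{L(L-1)/2}}{(2\pi\mathbf i)^L}\oint\dots\oint \prod_{1\le A<B\le L}\frac{u_A-u_B}{u_A-\tau u_B}\ \prod_{i=1}^L\left(\frac{1+u_i\tau^{-1}\kappa}{1+u_i\kappa}\right)^t\left(\frac{1+u_i}{1+u_i\tau^{-1}}\right)^x\frac{du_i}{u_i}. $$ Here the contour for $u_A$, $1\le A\le L$, is any finite family of closed piecewise $C^1$ curves (it may be disconnected) that includes $0$ and $-\tau$ but does not include $-\frac{1-b_2}{1-b_1}$, nor any point $\tau u_B$ with $B>A$ and $u_B$ on its contour, nor, in the case $x<0$, the point $-1$. A contour includes (does not include) a point if the point is not on the contour and the total winding number of the contour around it is $1$ (respectively $0$). -/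

import Mathlib

open scoped BigOperators

namespace SixVertex

/-! ### Rows of the six-vertex model and the transfer matrix on infinite configurations -/

/-- The six types of vertices. In terms of the bold lines: `a1` has no line; in `a2` all four edges
are bold; `b1` has a vertical line (south to north); `b2` has a horizontal line (west to east);
`c1` has a line from south to east; `c2` has a line from west to north. -/
inductive Vertex where
  | a1 | a2 | b1 | b2 | c1 | c2

namespace Vertex

/-- The south edge is bold. -/
def south : Vertex → Bool
  | a2 => true
  | b1 => true
  | c1 => true
  | _ => false

/-- The west edge is bold. -/
def west : Vertex → Bool
  | a2 => true
  | b2 => true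
  | c2 => true
  | _ => false

/-- The north edge is bold. -/
def north : Vertex → Bool
  | a2 => true
  | b1 => true
  | c2 => true
  | _ => false

/-- The east edge is bold. -/
def east : Vertex → Bool
  | a2 => true
  | b2 => true
  | c1 => true
  | _ => false

/-- The stochastic weights `(a₁, a₂, b₁, b₂, c₁, c₂) = (1, 1, β₁, β₂, 1 - β₁, 1 - β₂)`. -/
def weight (β₁ β₂ : ℝ) : Vertex → ℝ
  | a1 => 1
  | a2 => 1
  | b1 => β₁
  | b2 => β₂
  | c1 => 1 - β₁
  | c2 => 1 - β₂

theorem eq_of_west_south_north {v w : Vertex} (h₁ : v.west = w.west) (h₂ : v.south = w.south)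
    (h₃ : v.north = w.north) : v = w := by
  cases v <;> cases w <;> simp_all [west, south, north]

end Vertex

/-- `𝕎_∞`: the strictly increasing sequences of integers `x₀ < x₁ < …` that are stabilizing, i.e.
`x_{i+1} = x_i + 1` for all large enough `i` (the particles are indexed from `0`). -/
def WInf : Type :=
  {X : ℕ → ℤ // StrictMono X ∧ ∀ᶠ i in Filter.atTop, X (i + 1) = X i + 1}

/-- The one-row configuration `ℓ` sends `X` to `Y`: lines of horizontally adjacent vertices agree,
no line comes in from the far left, the bold south edges are at the positions of `X`, and the bold
north edges are at the positions of `Y`. -/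
structure Sends (X Y : WInf) (ℓ : ℤ → Vertex) : Prop where
  flow : ∀ x : ℤ, (ℓ x).east = (ℓ (x + 1)).west
  left : ∀ᶠ x in Filter.atBot, (ℓ x).west = false
  south : ∀ x : ℤ, (ℓ x).south = true ↔ x ∈ Set.range X.1
  north : ∀ x : ℤ, (ℓ x).north = true ↔ x ∈ Set.range Y.1

/-- There is at most one row that sends `X` to `Y`. -/
theorem Sends.unique {X Y : WInf} {ℓ ℓ' : ℤ → Vertex} (h : Sends X Y ℓ) (h' : Sends X Y ℓ') :
    ℓ = ℓ' := by
  have key : ∀ x : ℤ, (ℓ x).west = (ℓ' x).west → ℓ x = ℓ' x := fun x hx =>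
    Vertex.eq_of_west_south_north hx
      (Bool.eq_iff_iff.2 ((h.south x).trans (h'.south x).symm))
      (Bool.eq_iff_iff.2 ((h.north x).trans (h'.north x).symm))
  obtain ⟨M, hM⟩ := Filter.eventually_atBot.1 (h.left.and h'.left)
  funext x
  apply key
  rcases le_total x M with hx | hx
  · rw [(hM x hx).1, (hM x hx).2]
  · induction x, hx using Int.leInduction with
    | base => rw [(hM M le_rfl).1, (hM M le_rfl).2]
    | succ n _ ih => rw [← h.flow, ← h'.flow, key n ih]

open Classical in
/-- The transfer matrix `𝒯^{(∞)}(X → Y; 1, 1, b₁, b₂, 1 - b₁, 1 - b₂)`: the product of the weights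
of all vertices of the row that sends `X` to `Y`, and `0` if there is no such row. -/
noncomputable def transfer (b₁ b₂ : ℝ) (X Y : WInf) : ℝ :=
  if h : ∃ ℓ, Sends X Y ℓ then ∏' x : ℤ, (h.choose x).weight b₁ b₂ else 0

theorem transfer_eq {X Y : WInf} {ℓ : ℤ → Vertex} (h : Sends X Y ℓ) (b₁ b₂ : ℝ) :
    transfer b₁ b₂ X Y = ∏' x : ℤ, (ℓ x).weight b₁ b₂ := by
  have hex : ∃ ℓ, Sends X Y ℓ := ⟨ℓ, h⟩
  rw [transfer, dif_pos hex, hex.choose_spec.unique h]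

open Classical in
/-- The `t`-th power `𝒯^{(∞)}_t` of the transfer matrix. -/
noncomputable def transferPow (b₁ b₂ : ℝ) : ℕ → WInf → WInf → ℝ
  | 0, Y, X => if Y = X then 1 else 0
  | t + 1, Y, X => ∑' Z : WInf, transferPow b₁ b₂ t Y Z * transfer b₁ b₂ Z X

/-- The time `t` expectation `𝔼_Y(f; t)`. -/
noncomputable def expectation (b₁ b₂ : ℝ) (Y : WInf) (f : WInf → ℝ) (t : ℕ) : ℝ :=
  ∑' X : WInf, transferPow b₁ b₂ t Y X * f X

/-- The step initial condition `(1, 2, 3, …)`. -/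
def step : WInf :=
  ⟨fun i => (i : ℤ) + 1, fun i j h => by simpa using h, Filter.Eventually.of_forall fun i => by
    push_cast; ring⟩

/-- `N_x(X) = #{i : x_i ≤ x}`. -/
noncomputable def count (x : ℤ) (X : WInf) : ℕ :=
  Set.ncard {i : ℕ | X.1 i ≤ x}

/-! ### Contour integrals -/

/-- A closed, piecewise continuously differentiable curve in `ℂ`, parametrized by `[0, 1]`. -/
structure Loop where
  toFun : ℝ → ℂ
  continuousOn : ContinuousOn toFun (Set.Icc 0 1)
  closed : toFun 0 = toFun 1
  piecewise : ∃ s : Finset ℝ, ∀ t ∈ Set.Icc (0 : ℝ) 1, t ∉ s →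
    DifferentiableAt ℝ toFun t ∧ ContinuousAt (deriv toFun) t
  bounded : ∃ C : ℝ, ∀ t ∈ Set.Icc (0 : ℝ) 1, ‖deriv toFun t‖ ≤ C

/-- An integration contour: a finite family of closed curves. -/
structure Contour where
  card : ℕ
  loop : Fin card → Loop

/-- The set of points on the contour. -/
def Contour.support (Γ : Contour) : Set ℂ :=
  ⋃ k : Fin Γ.card, (Γ.loop k).toFun '' Set.Icc 0 1

/-- The total winding number of the contour around `a`. -/
noncomputable def Contour.winding (Γ : Contour) (a : ℂ) : ℂ :=
  (2 * Real.pi * Complex.I)⁻¹ *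
    ∑ k : Fin Γ.card, ∫ s in (0 : ℝ)..1, deriv (Γ.loop k).toFun s / ((Γ.loop k).toFun s - a)

/-- The point `a` is inside the (positively oriented) contour. -/
def Contour.Includes (Γ : Contour) (a : ℂ) : Prop :=
  a ∉ Γ.support ∧ Γ.winding a = 1

/-- The point `a` is outside the contour. -/
def Contour.Excludes (Γ : Contour) (a : ℂ) : Prop :=
  a ∉ Γ.support ∧ Γ.winding a = 0

/-- The `L`-fold contour integral `∮ ⋯ ∮ F(u₁, …, u_L) du₁ ⋯ du_L`, where `u_i` runs over `Γ i`. -/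
noncomputable def multiIntegral {L : ℕ} (Γ : Fin L → Contour) (F : (Fin L → ℂ) → ℂ) : ℂ :=
  ∑ k : ((i : Fin L) → Fin (Γ i).card),
    ∫ s in Set.Icc (0 : Fin L → ℝ) 1,
      F (fun i => ((Γ i).loop (k i)).toFun (s i)) * ∏ i, deriv ((Γ i).loop (k i)).toFun (s i)

/-- The integrand
`∏_{A<B} (u_A - u_B) / (u_A - τ u_B) ·
  ∏_i ((1 + u_i τ⁻¹ κ) / (1 + u_i κ))^t ((1 + u_i) / (1 + u_i τ⁻¹))^x / u_i`
with `τ = b₂ / b₁` and `κ = (1 - b₁) / (1 - b₂)`. -/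
noncomputable def integrand (b₁ b₂ : ℝ) (t : ℕ) (x : ℤ) {L : ℕ} (u : Fin L → ℂ) : ℂ :=
  let τ : ℂ := b₂ / b₁
  let κ : ℂ := (1 - b₁) / (1 - b₂)
  (∏ A : Fin L, ∏ B ∈ Finset.Ioi A, (u A - u B) / (u A - τ * u B)) *
    ∏ i : Fin L, ((1 + u i * τ⁻¹ * κ) / (1 + u i * κ)) ^ t *
      ((1 + u i) / (1 + u i * τ⁻¹)) ^ x / u i

end SixVertex

/-!
For `0 ≤ y₁ ≤ ⋯ ≤ y_L` consider the joint moments `𝔼 ∏ τ^{N_{y_i}}` of the height function at time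
`t` (`moment`) and the nested contour integrals in which the variable `u_i` carries the exponent
`y_i` (`dumbbellIntegral`). Up to the constant `τ^{L(L-1)/2} / (2πi)^L` the two satisfy the same
relations, and these relations have a unique solution (`eq_zero_of_relations`, by induction on `t`
and on `∑ y_i`):

* An evolution equation for strictly increasing `y`. Given `X`, the next configuration is obtained
  by moving a path with two states (line or no line on the horizontal edge) along the row. If
  `Q_y` denotes `τ^{N_y}`, the conditional expectation of `∏ (Q_y - b₂ Q_{y-1})` over distinct `y`
  is `∏ ((1 - b₁ - b₂) Q_{y-1} + b₁ Q_y)`, because the corresponding identity holds for each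
  vertex whatever the state of the path is (`hasSum_transfer_mul_prod`, `sum_moment_succ`). On the
  side of the integrals it is an identity between the eigenvalue of a time step and the multiplier
  of a space step in a single variable (`sum_dumbbellIntegral_succ`).
* A boundary relation for `y_i = y_{i+1}`. As `N_y - N_{y-1}` is `0` or `1`, one has `(Q_y -
  Q_{y-1}) (Q_y - τ Q_{y-1}) = 0` (`moment_boundary`). In the integrals the same combination
  cancels the denominator `u_i - τ u_{i+1}`, after which the two contours can be taken equal and
  the integrand is antisymmetric (`multiIntegral_boundary`).
* A first exponent `0` can be dropped: no particle reaches a nonpositive site (`moment_of_zero`),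
  and the first variable has `0` as its only pole inside the contour (`dumbbellIntegral_of_zero`).
* At time `0`, increasing the largest exponent by one multiplies by `τ` (`moment_zero_time`); the
  multiplier of a space step tends to `τ` at infinity, where the contour of the last variable can
  be moved (`dumbbellIntegral_zero_time`).

These integrals are taken over `dumbbell`s, unions of small circles around `0` and `-τ`, the
former with radii growing fast enough for the contours to be nested. For positive `x` the contours
of the theorem are replaced by dumbbells one variable after the other
(`multiIntegral_mixed_succ`). A contour satisfying the assumptions is homologous in the complement
of the poles to a dumbbell plus a multiple of a small circle around `-1`: poles near `-1` occur as
`τ⁻¹ u_B` with `u_B` near `-τ`. The circle around `-1` does not contribute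
(`multiIntegral_eq_zero_of_circle_neg_one`), because the residues at `u_A = τ u_j` that arise when
the small circles of the earlier variables are enlarged are regular near `u_j = -1`, and once all
circles are enlarged the poles `τ⁻¹ u_B` are outside the circle. For `x ≤ 0` the expectation is
`1`, and the integral is computed for the given contours by residues at `0`
(`multiIntegral_oneBody_of_nonpos`).

The contours are arbitrary cycles, so the residue theorem is needed with winding numbers, but only
for rational functions of one variable at a time (`RatOn`); there it follows from partial
fractions, as a polynomial and the powers `(u - a)⁻ⁿ`, `n ≥ 2`, have primitives. Iterated
integrals are reduced to one variable by Fubini's theorem (`multiIntegral_eq_insertNth`).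
-/

namespace SixVertex

open Polynomial MeasureTheory

/-! ### Integration along contours -/

/-- The contour integral `∮ f(u) du` of a function of one variable. -/
noncomputable def Contour.integral (Γ : Contour) (f : ℂ → ℂ) : ℂ :=
  ∑ k, ∫ s in Set.Icc (0 : ℝ) 1, f ((Γ.loop k).toFun s) * deriv (Γ.loop k).toFun s

theorem Contour.mem_support (Γ : Contour) (k : Fin Γ.card) {s : ℝ} (hs : s ∈ Set.Icc (0 : ℝ) 1) :
    (Γ.loop k).toFun s ∈ Γ.support :=
  Set.mem_iUnion.2 ⟨k, s, hs, rfl⟩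

theorem Contour.isCompact_support (Γ : Contour) : IsCompact Γ.support :=
  isCompact_iUnion fun k => isCompact_Icc.image_of_continuousOn (Γ.loop k).continuousOn

theorem Loop.integrableOn_deriv_mul (γ : Loop) {g : ℝ → ℂ} (hg : ContinuousOn g (Set.Icc 0 1)) :
    IntegrableOn (fun s => g s * deriv γ.toFun s) (Set.Icc (0 : ℝ) 1) := by
  obtain ⟨C, hC⟩ := γ.bounded
  refine Integrable.mul_bdd (c := C) hg.integrableOn_Icc
    (measurable_deriv _).aestronglyMeasurable ?_
  exact (ae_restrict_iff' measurableSet_Icc).2 (Filter.Eventually.of_forall hC)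

theorem Contour.continuousOn_comp (Γ : Contour) {f : ℂ → ℂ} (hf : ContinuousOn f Γ.support)
    (k : Fin Γ.card) : ContinuousOn (fun s => f ((Γ.loop k).toFun s)) (Set.Icc (0 : ℝ) 1) :=
  hf.comp (Γ.loop k).continuousOn fun _ hs => Γ.mem_support k hs

theorem Contour.integral_congr (Γ : Contour) {f g : ℂ → ℂ} (h : ∀ u ∈ Γ.support, f u = g u) :
    Γ.integral f = Γ.integral g := by
  refine Finset.sum_congr rfl fun k _ => setIntegral_congr_fun measurableSet_Icc fun s hs => ?_
  simp only [h _ (Γ.mem_support k hs)]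

theorem Contour.integral_add (Γ : Contour) {f g : ℂ → ℂ} (hf : ContinuousOn f Γ.support)
    (hg : ContinuousOn g Γ.support) :
    Γ.integral (fun u => f u + g u) = Γ.integral f + Γ.integral g := by
  simp only [Contour.integral, ← Finset.sum_add_distrib, add_mul]
  exact Finset.sum_congr rfl fun k _ => MeasureTheory.integral_add
    ((Γ.loop k).integrableOn_deriv_mul (Γ.continuousOn_comp hf k))
    ((Γ.loop k).integrableOn_deriv_mul (Γ.continuousOn_comp hg k))

theorem Contour.integral_const_mul (Γ : Contour) (c : ℂ) (f : ℂ → ℂ) :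
    Γ.integral (fun u => c * f u) = c * Γ.integral f := by
  simp only [Contour.integral, Finset.mul_sum, mul_assoc, MeasureTheory.integral_const_mul]

theorem Contour.integral_zero (Γ : Contour) : Γ.integral (fun _ => 0) = 0 := by
  simp [Contour.integral]

theorem Contour.winding_eq (Γ : Contour) (a : ℂ) :
    Γ.winding a = (2 * Real.pi * Complex.I)⁻¹ * Γ.integral (fun u => 1 / (u - a)) := by
  simp only [Contour.winding, Contour.integral]
  congr 1
  refine Finset.sum_congr rfl fun k _ => ?_
  rw [intervalIntegral.integral_of_le zero_le_one, integral_Icc_eq_integral_Ioc]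
  simp only [div_mul_eq_mul_div, one_mul]

theorem Contour.integral_inv_sub (Γ : Contour) (a : ℂ) :
    Γ.integral (fun u => 1 / (u - a)) = 2 * Real.pi * Complex.I * Γ.winding a := by
  rw [Γ.winding_eq, mul_inv_cancel_left₀ Complex.two_pi_I_ne_zero]

/-- A function with a primitive along the contour integrates to `0`: all loops are closed. -/
theorem Contour.integral_eq_zero_of_hasDerivAt (Γ : Contour) {G g : ℂ → ℂ}
    (hG : ∀ u ∈ Γ.support, HasDerivAt G (g u) u) (hg : ContinuousOn g Γ.support) :
    Γ.integral g = 0 := by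
  refine Finset.sum_eq_zero fun k _ => ?_
  obtain ⟨s, hs⟩ := (Γ.loop k).piecewise
  have hcont : ContinuousOn (fun x => G ((Γ.loop k).toFun x)) (Set.Icc 0 1) :=
    ContinuousOn.comp (t := Γ.support)
      (fun u hu => (hG u hu).continuousAt.continuousWithinAt)
      (Γ.loop k).continuousOn fun _ hx => Γ.mem_support k hx
  have key := integral_eq_of_hasDerivAt_off_countable_of_le
    (fun x => G ((Γ.loop k).toFun x))
    (fun x => g ((Γ.loop k).toFun x) * deriv (Γ.loop k).toFun x) zero_le_one
    s.countable_toSet hcont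
    (fun x hx => by
      have hx' : x ∈ Set.Icc (0 : ℝ) 1 := Set.Ioo_subset_Icc_self hx.1
      exact (hG _ (Γ.mem_support k hx')).comp x (hs x hx' (by simpa using hx.2)).1.hasDerivAt)
    (by
      rw [intervalIntegrable_iff_integrableOn_Icc_of_le zero_le_one]
      exact (Γ.loop k).integrableOn_deriv_mul (Γ.continuousOn_comp hg k))
  rw [intervalIntegral.integral_of_le zero_le_one, ← integral_Icc_eq_integral_Ioc] at key
  rw [key, (Γ.loop k).closed, sub_self]

/-! ### The residue theorem for rational functions -/

theorem exists_derivative_eq (p : ℂ[X]) : ∃ P : ℂ[X], derivative P = p := by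
  induction p using Polynomial.induction_on' with
  | add p q hp hq =>
    obtain ⟨P, rfl⟩ := hp
    obtain ⟨Q, rfl⟩ := hq
    exact ⟨P + Q, by simp⟩
  | monomial n a =>
    refine ⟨monomial (n + 1) (a / (n + 1)), ?_⟩
    have : (n : ℂ) + 1 ≠ 0 := by exact_mod_cast Nat.succ_ne_zero n
    rw [derivative_monomial]
    push_cast
    rw [div_mul_cancel₀ _ this]

/-- The integral of `f` over any contour avoiding `s` is `2πi` times a combination, with
coefficients not depending on the contour, of the winding numbers around the points of `s`. -/
def HasResidues (s : Finset ℂ) (f : ℂ → ℂ) : Prop :=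
  ∃ r : ℂ → ℂ, ∀ Γ : Contour, (∀ a ∈ s, a ∉ Γ.support) →
    Γ.integral f = 2 * Real.pi * Complex.I * ∑ a ∈ s, r a * Γ.winding a

theorem HasResidues.mono {s t : Finset ℂ} {f : ℂ → ℂ} (h : HasResidues s f) (hst : s ⊆ t) :
    HasResidues t f := by
  classical
  obtain ⟨r, hr⟩ := h
  refine ⟨fun a => if a ∈ s then r a else 0, fun Γ hΓ => ?_⟩
  rw [hr Γ fun a ha => hΓ a (hst ha)]
  congr 1
  simp only [ite_mul, zero_mul]
  rw [← Finset.sum_filter, Finset.filter_mem_eq_inter, Finset.inter_eq_right.2 hst]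

theorem HasResidues.const_mul {s : Finset ℂ} {f : ℂ → ℂ} (h : HasResidues s f) (c : ℂ) :
    HasResidues s (fun u => c * f u) := by
  obtain ⟨r, hr⟩ := h
  refine ⟨fun a => c * r a, fun Γ hΓ => ?_⟩
  rw [Γ.integral_const_mul, hr Γ hΓ]
  simp only [mul_assoc, ← Finset.mul_sum]
  ring

theorem HasResidues.add {s : Finset ℂ} {f g : ℂ → ℂ} (h : HasResidues s f) (h' : HasResidues s g)
    (hf : ContinuousOn f (s : Set ℂ)ᶜ) (hg : ContinuousOn g (s : Set ℂ)ᶜ) :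
    HasResidues s (fun u => f u + g u) := by
  obtain ⟨r, hr⟩ := h
  obtain ⟨r', hr'⟩ := h'
  refine ⟨fun a => r a + r' a, fun Γ hΓ => ?_⟩
  have hsub : Γ.support ⊆ (s : Set ℂ)ᶜ := fun u hu hus => hΓ u hus hu
  rw [Γ.integral_add (hf.mono hsub) (hg.mono hsub), hr Γ hΓ, hr' Γ hΓ]
  simp only [add_mul, Finset.sum_add_distrib, mul_add]

theorem HasResidues.congr {s : Finset ℂ} {f g : ℂ → ℂ} (h : HasResidues s f)
    (hfg : ∀ u ∉ s, g u = f u) : HasResidues s g := by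
  obtain ⟨r, hr⟩ := h
  refine ⟨r, fun Γ hΓ => ?_⟩
  rw [← hr Γ hΓ]
  exact Γ.integral_congr fun u hu => hfg u fun hus => hΓ u hus hu

theorem hasResidues_polynomial (p : ℂ[X]) : HasResidues ∅ (fun u => p.eval u) := by
  obtain ⟨P, rfl⟩ := exists_derivative_eq p
  refine ⟨0, fun Γ _ => ?_⟩
  rw [Γ.integral_eq_zero_of_hasDerivAt (G := fun u => P.eval u) (fun u _ => P.hasDerivAt u)
    (Polynomial.continuous _).continuousOn]
  simp

theorem hasResidues_inv_pow (a : ℂ) (n : ℕ) :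
    HasResidues {a} (fun u => 1 / (u - a) ^ (n + 1)) := by
  rcases Nat.eq_zero_or_pos n with rfl | hn
  · refine ⟨1, fun Γ _ => ?_⟩
    simp [← Γ.integral_inv_sub]
  · refine ⟨0, fun Γ hΓ => ?_⟩
    have hne : ∀ u ∈ Γ.support, u - a ≠ 0 := fun u hu h =>
      hΓ a (Finset.mem_singleton_self a) (by rwa [← sub_eq_zero.1 h])
    have hn' : (n : ℂ) ≠ 0 := by exact_mod_cast hn.ne'
    rw [Γ.integral_eq_zero_of_hasDerivAt (G := fun u => -(n : ℂ)⁻¹ * ((u - a) ^ n)⁻¹)]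
    · simp
    · intro u hu
      have h1 : HasDerivAt (fun u => (u - a) ^ n) (n * (u - a) ^ (n - 1)) u := by
        simpa using ((hasDerivAt_id u).sub_const a).fun_pow n
      refine ((h1.fun_inv (pow_ne_zero n (hne u hu))).const_mul (-(n : ℂ)⁻¹)).congr_deriv ?_
      obtain ⟨m, rfl⟩ : ∃ m, n = m + 1 := ⟨n - 1, by omega⟩
      have := hne u hu
      rw [Nat.add_sub_cancel]
      field_simp
      ring
    · exact ContinuousOn.div continuousOn_const (by fun_prop) fun u hu => pow_ne_zero _ (hne u hu)

theorem continuousOn_div_multiset_prod (p : ℂ[X]) (s : Multiset ℂ) :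
    ContinuousOn (fun u => p.eval u / (s.map fun a => u - a).prod) (s.toFinset : Set ℂ)ᶜ := by
  classical
  refine ContinuousOn.div p.continuous.continuousOn
    (continuous_multiset_prod _ fun a _ => by fun_prop).continuousOn fun u hu h0 => hu ?_
  rw [Multiset.prod_eq_zero_iff, Multiset.mem_map] at h0
  obtain ⟨a, ha, hua⟩ := h0
  rw [sub_eq_zero.1 hua]
  simpa using ha

/-- Partial fractions, by induction on the number of poles. -/
theorem hasResidues_div_multiset_prod (n : ℕ) : ∀ s : Multiset ℂ, Multiset.card s = n →
    ∀ p : ℂ[X], HasResidues s.toFinset (fun u => p.eval u / (s.map fun a => u - a).prod) := by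
  classical
  induction n using Nat.strong_induction_on with
  | _ n ih =>
  intro s hs p
  rcases s.empty_or_exists_mem with rfl | ⟨a, ha⟩
  · simpa using hasResidues_polynomial p
  obtain ⟨s, rfl⟩ := Multiset.exists_cons_of_mem ha
  rw [Multiset.card_cons] at hs
  have hsub : s.toFinset ⊆ (a ::ₘ s).toFinset := by
    rw [Multiset.toFinset_cons]; exact Finset.subset_insert _ _
  have hne : ∀ u ∉ (a ::ₘ s).toFinset, u - a ≠ 0 ∧ (s.map fun a => u - a).prod ≠ 0 := by
    intro u hu
    constructor
    · intro h
      rw [sub_eq_zero.1 h] at hu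
      exact hu (by simp)
    · intro h
      rw [Multiset.prod_eq_zero_iff, Multiset.mem_map] at h
      obtain ⟨b, hb, hub⟩ := h
      rw [sub_eq_zero.1 hub] at hu
      exact hu (by simp [hb])
  have hone : HasResidues (a ::ₘ s).toFinset
      (fun u => (1 : ℂ[X]).eval u / ((a ::ₘ s).map fun a => u - a).prod) := by
    by_cases hex : ∃ b ∈ s, b ≠ a
    · obtain ⟨b, hb, hba⟩ := hex
      obtain ⟨s, rfl⟩ := Multiset.exists_cons_of_mem hb
      rw [Multiset.card_cons] at hs
      have hab : a - b ≠ 0 := sub_ne_zero.2 hba.symm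
      have hsub2 : (a ::ₘ s).toFinset ⊆ (a ::ₘ b ::ₘ s).toFinset :=
        Multiset.toFinset_subset.2 fun x hx => by
          simp only [Multiset.mem_cons] at hx ⊢; tauto
      have h1 := ((ih _ (by simp; omega) (a ::ₘ s) rfl 1).mono hsub2).const_mul (a - b)⁻¹
      have h2 := ((ih _ (by simp; omega) (b ::ₘ s) rfl 1).mono hsub).const_mul (-(a - b)⁻¹)
      refine (h1.add h2 ?_ ?_).congr ?_
      · exact continuousOn_const.mul ((continuousOn_div_multiset_prod 1 (a ::ₘ s)).mono
          (Set.compl_subset_compl.2 (Finset.coe_subset.2 hsub2)))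
      · exact continuousOn_const.mul ((continuousOn_div_multiset_prod 1 (b ::ₘ s)).mono
          (Set.compl_subset_compl.2 (Finset.coe_subset.2 hsub)))
      · intro u hu
        obtain ⟨h1, h2⟩ := hne u hu
        simp only [Multiset.map_cons, Multiset.prod_cons] at h2 ⊢
        have h3 := left_ne_zero_of_mul h2
        have h4 := right_ne_zero_of_mul h2
        field_simp
        ring
    · push Not at hex
      rw [Multiset.eq_replicate_card.2 hex, ← Multiset.replicate_succ]
      refine ((hasResidues_inv_pow a (Multiset.card s)).mono ?_).congr ?_
      · intro x hx
        rw [Finset.mem_singleton.1 hx]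
        simp
      · intro u _
        rw [Multiset.map_replicate, Multiset.prod_replicate, eval_one]
  have h1 := (ih (Multiset.card s) (by omega) s rfl (p /ₘ (X - C a))).mono hsub
  refine (h1.add (hone.const_mul (p.eval a)) ?_ ?_).congr ?_
  · exact (continuousOn_div_multiset_prod _ s).mono
      (Set.compl_subset_compl.2 (Finset.coe_subset.2 hsub))
  · exact continuousOn_const.mul (continuousOn_div_multiset_prod 1 _)
  · intro u hu
    obtain ⟨h1, h2⟩ := hne u hu
    have hp : p.eval u = (u - a) * (p /ₘ (X - C a)).eval u + p.eval a := by
      conv_lhs => rw [← modByMonic_add_div p (X - C a), modByMonic_X_sub_C_eq_C_eval]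
      simp [add_comm]
    simp only [Multiset.map_cons, Multiset.prod_cons, eval_one]
    rw [hp]
    field_simp

/-- `f` agrees outside `S` with a rational function all of whose poles lie in `S`. -/
def RatOn (S : Set ℂ) (f : ℂ → ℂ) : Prop :=
  ∃ p q : ℂ[X], q ≠ 0 ∧ (∀ u, q.eval u = 0 → u ∈ S) ∧ ∀ u ∉ S, f u = p.eval u / q.eval u

namespace RatOn

variable {S : Set ℂ} {f g : ℂ → ℂ}

theorem mono {T : Set ℂ} (h : RatOn S f) (hST : S ⊆ T) : RatOn T f := by
  obtain ⟨p, q, h0, h1, h2⟩ := h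
  exact ⟨p, q, h0, fun u hu => hST (h1 u hu), fun u hu => h2 u fun h => hu (hST h)⟩

theorem of_polynomial (S : Set ℂ) (p : ℂ[X]) : RatOn S (fun u => p.eval u) :=
  ⟨p, 1, one_ne_zero, by simp, by simp⟩

theorem const (S : Set ℂ) (c : ℂ) : RatOn S (fun _ => c) := by
  simpa using of_polynomial S (C c)

theorem id (S : Set ℂ) : RatOn S (fun u => u) := by
  simpa using of_polynomial S X

theorem mul (hf : RatOn S f) (hg : RatOn S g) : RatOn S (fun u => f u * g u) := by
  obtain ⟨p, q, h0, h1, h2⟩ := hf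
  obtain ⟨p', q', h0', h1', h2'⟩ := hg
  refine ⟨p * p', q * q', mul_ne_zero h0 h0', fun u hu => ?_, fun u hu => ?_⟩
  · rw [eval_mul, mul_eq_zero] at hu
    exact hu.elim (h1 u) (h1' u)
  · simp only [h2 u hu, h2' u hu]
    rw [eval_mul, eval_mul, div_mul_div_comm]

theorem add (hf : RatOn S f) (hg : RatOn S g) : RatOn S (fun u => f u + g u) := by
  obtain ⟨p, q, h0, h1, h2⟩ := hf
  obtain ⟨p', q', h0', h1', h2'⟩ := hg
  refine ⟨p * q' + q * p', q * q', mul_ne_zero h0 h0', fun u hu => ?_, fun u hu => ?_⟩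
  · rw [eval_mul, mul_eq_zero] at hu
    exact hu.elim (h1 u) (h1' u)
  · simp only [h2 u hu, h2' u hu]
    rw [div_add_div _ _ (fun h => hu (h1 u h)) (fun h => hu (h1' u h))]
    simp

theorem neg (hf : RatOn S f) : RatOn S (fun u => -f u) := by
  simpa using (const S (-1)).mul hf

theorem sub (hf : RatOn S f) (hg : RatOn S g) : RatOn S (fun u => f u - g u) := by
  simpa [sub_eq_add_neg] using hf.add hg.neg

theorem pow (hf : RatOn S f) (n : ℕ) : RatOn S (fun u => f u ^ n) := by
  induction n with
  | zero => simpa using const S 1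
  | succ n ih => simpa [pow_succ] using ih.mul hf

theorem prod {ι : Type*} (s : Finset ι) {F : ι → ℂ → ℂ} (h : ∀ i ∈ s, RatOn S (F i)) :
    RatOn S (fun u => ∏ i ∈ s, F i u) := by
  classical
  induction s using Finset.induction_on with
  | empty => simpa using const S 1
  | insert i s hi ih =>
    simp only [Finset.prod_insert hi]
    exact (h i (Finset.mem_insert_self i s)).mul
      (ih fun j hj => h j (Finset.mem_insert_of_mem hj))

/-- Division by a linear function whose root is in `S`. -/
theorem div_linear (hf : RatOn S f) {a b : ℂ} (hab : ∀ u, a * u + b = 0 → u ∈ S)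
    (h0 : a ≠ 0 ∨ b ≠ 0) : RatOn S (fun u => f u / (a * u + b)) := by
  have : RatOn S (fun u => (a * u + b)⁻¹) := by
    refine ⟨1, C a * X + C b, fun h => ?_, fun u hu => hab u (by simpa using hu), fun u _ => ?_⟩
    · have h1 := congrArg (fun p => coeff p 0) h
      have h2 := congrArg (fun p => coeff p 1) h
      simp at h1 h2
      tauto
    · simp
  simpa [div_eq_mul_inv] using hf.mul this

theorem continuousOn (hf : RatOn S f) : ContinuousOn f Sᶜ := by
  obtain ⟨p, q, _, h1, h2⟩ := hf
  refine ContinuousOn.congr (f := fun u => p.eval u / q.eval u) ?_ fun u hu => h2 u hu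
  exact p.continuous.continuousOn.div q.continuous.continuousOn fun u hu h => hu (h1 u h)

/-- The residue theorem for rational functions, without identifying the residues. -/
theorem exists_hasResidues (hf : RatOn S f) :
    ∃ (s : Finset ℂ) (r : ℂ → ℂ), (s : Set ℂ) ⊆ S ∧ ∀ Γ : Contour,
      (∀ a ∈ S, a ∉ Γ.support) →
      Γ.integral f = 2 * Real.pi * Complex.I * ∑ a ∈ s, r a * Γ.winding a := by
  classical
  obtain ⟨p, q, h0, h1, h2⟩ := hf
  have hq : ∀ u, q.eval u = q.leadingCoeff * (q.roots.map fun a => u - a).prod := by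
    intro u
    conv_lhs => rw [(IsAlgClosed.splits q).eq_prod_roots]
    simp [eval_multiset_prod, Multiset.map_map]
  obtain ⟨r, hr⟩ := (hasResidues_div_multiset_prod _ q.roots rfl p).const_mul q.leadingCoeff⁻¹
  have hsub : (q.roots.toFinset : Set ℂ) ⊆ S := fun a ha =>
    h1 a (by simpa [h0] using ha)
  refine ⟨q.roots.toFinset, r, hsub, fun Γ hΓ => ?_⟩
  rw [← hr Γ fun a ha => hΓ a (hsub ha)]
  refine Γ.integral_congr fun u hu => ?_
  rw [h2 u fun h => hΓ u h hu, hq u, mul_comm q.leadingCoeff, ← div_div]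
  ring

/-- A combination of contours that does not wind around any pole annihilates the function. -/
theorem sum_integral_eq_zero (hf : RatOn S f) {ι : Type*} (I : Finset ι) (c : ι → ℂ)
    (Γ : ι → Contour) (hΓ : ∀ i ∈ I, ∀ a ∈ S, a ∉ (Γ i).support)
    (hw : ∀ a ∈ S, ∑ i ∈ I, c i * (Γ i).winding a = 0) :
    ∑ i ∈ I, c i * (Γ i).integral f = 0 := by
  obtain ⟨s, r, hs, hr⟩ := hf.exists_hasResidues
  rw [Finset.sum_congr rfl fun i hi => by rw [hr (Γ i) (hΓ i hi)]]
  have : ∀ i, c i * (2 * Real.pi * Complex.I * ∑ a ∈ s, r a * (Γ i).winding a) =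
      2 * Real.pi * Complex.I * ∑ a ∈ s, r a * (c i * (Γ i).winding a) := fun i => by
    rw [mul_left_comm, Finset.mul_sum]
    congr 1
    exact Finset.sum_congr rfl fun a _ => by ring
  simp only [this]
  rw [← Finset.mul_sum, Finset.sum_comm]
  simp only [← Finset.mul_sum]
  rw [Finset.sum_eq_zero fun a ha => by rw [hw a (hs ha), mul_zero], mul_zero]

/-- The difference quotient of a rational function at a regular point. -/
theorem exists_sub_eq (hf : RatOn S f) {b : ℂ} (hb : b ∉ S) :
    ∃ g, RatOn S g ∧ ∀ u ∉ S, f u = f b + (u - b) * g u := by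
  obtain ⟨p, q, h0, h1, h2⟩ := hf
  have hroot : (p * C (q.eval b) - C (p.eval b) * q).IsRoot b := by simp [mul_comm]
  obtain ⟨k, hk⟩ := dvd_iff_isRoot.2 hroot
  have hqb : q.eval b ≠ 0 := fun h => hb (h1 b h)
  refine ⟨fun u => k.eval u / (C (q.eval b) * q).eval u, ⟨k, C (q.eval b) * q,
    mul_ne_zero (by simpa using hqb) h0, fun u hu => h1 u ?_, fun u _ => rfl⟩, fun u hu => ?_⟩
  · simpa [hqb] using hu
  · have hqu : q.eval u ≠ 0 := fun h => hu (h1 u h)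
    have := congrArg (eval u) hk
    simp only [eval_sub, eval_mul, eval_C, eval_X] at this
    simp only [h2 u hu, h2 b hb, eval_mul, eval_C]
    field_simp
    linear_combination this

/-- The residue of `f(u)/(u-b)` at `b` is `f(b)`. -/
theorem sum_integral_div_sub (hf : RatOn S f) {b : ℂ} (hb : b ∉ S) {ι : Type*} (I : Finset ι)
    (c : ι → ℂ) (Γ : ι → Contour) (hΓ : ∀ i ∈ I, ∀ a ∈ S, a ∉ (Γ i).support)
    (hΓb : ∀ i ∈ I, b ∉ (Γ i).support) (hw : ∀ a ∈ S, ∑ i ∈ I, c i * (Γ i).winding a = 0) :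
    ∑ i ∈ I, c i * (Γ i).integral (fun u => f u / (u - b)) =
      2 * Real.pi * Complex.I * f b * ∑ i ∈ I, c i * (Γ i).winding b := by
  obtain ⟨g, hg, hfg⟩ := hf.exists_sub_eq hb
  have key : ∀ i ∈ I, (Γ i).integral (fun u => f u / (u - b)) =
      f b * (2 * Real.pi * Complex.I * (Γ i).winding b) + (Γ i).integral g := by
    intro i hi
    have hne : ∀ u ∈ (Γ i).support, u - b ≠ 0 := fun u hu h =>
      hΓb i hi (by rwa [← sub_eq_zero.1 h])
    rw [← (Γ i).integral_inv_sub, ← (Γ i).integral_const_mul, ← (Γ i).integral_add]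
    · refine (Γ i).integral_congr fun u hu => ?_
      rw [hfg u fun h => hΓ i hi u h hu]
      have := hne u hu
      field_simp
    · exact continuousOn_const.mul (continuousOn_const.div (by fun_prop) hne)
    · exact hg.continuousOn.mono fun u hu h => hΓ i hi u h hu
  rw [Finset.sum_congr rfl fun i hi => by rw [key i hi]]
  simp only [mul_add, Finset.sum_add_distrib]
  rw [hg.sum_integral_eq_zero I c Γ hΓ hw, add_zero, Finset.mul_sum]
  exact Finset.sum_congr rfl fun i _ => by ring

end RatOn

end SixVertex

namespace SixVertex

open MeasureTheory

/-! ### Circles, unions and winding numbers -/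

/-- The positively oriented circle. -/
noncomputable def Loop.circle (c : ℂ) (R : ℝ) : Loop where
  toFun t := circleMap c R (2 * Real.pi * t)
  continuousOn := by fun_prop
  closed := by simp [circleMap]
  piecewise := ⟨∅, fun t _ _ => by
    have h2 : ContDiff ℝ 1 fun t : ℝ => circleMap c R (2 * Real.pi * t) :=
      (contDiff_circleMap c R).comp (contDiff_const.mul contDiff_id)
    exact ⟨h2.differentiable one_ne_zero t, (h2.continuous_deriv le_rfl).continuousAt⟩⟩
  bounded := by
    have h2 : ContDiff ℝ 1 fun t : ℝ => circleMap c R (2 * Real.pi * t) :=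
      (contDiff_circleMap c R).comp (contDiff_const.mul contDiff_id)
    exact isCompact_Icc.exists_bound_of_continuousOn (h2.continuous_deriv le_rfl).continuousOn

/-- The positively oriented circle, as a contour. -/
noncomputable def Contour.circle (c : ℂ) (R : ℝ) : Contour := ⟨1, fun _ => Loop.circle c R⟩

theorem Contour.integral_circle (c : ℂ) (R : ℝ) (f : ℂ → ℂ) :
    (Contour.circle c R).integral f = ∮ u in C(c, R), f u := by
  have hd : ∀ s : ℝ, deriv (Loop.circle c R).toFun s =
      (2 * Real.pi : ℝ) * deriv (circleMap c R) (2 * Real.pi * s) := by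
    intro s
    have := (hasDerivAt_circleMap c R (2 * Real.pi * s)).scomp s
      ((hasDerivAt_id s).const_mul (2 * Real.pi))
    refine (HasDerivAt.deriv (f := (Loop.circle c R).toFun) this).trans ?_
    simp
  have h1 : (Contour.circle c R).integral f = ∫ s in Set.Icc (0 : ℝ) 1,
      f ((Loop.circle c R).toFun s) * deriv (Loop.circle c R).toFun s :=
    Fin.sum_univ_one _
  rw [h1, integral_Icc_eq_integral_Ioc, ← intervalIntegral.integral_of_le zero_le_one]
  simp only [hd]
  have := intervalIntegral.smul_integral_comp_mul_left
    (fun θ => f (circleMap c R θ) * deriv (circleMap c R) θ) (2 * Real.pi) (a := 0) (b := 1)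
  rw [mul_zero, mul_one] at this
  simp only [circleIntegral, smul_eq_mul]
  simp only [mul_comm (deriv _ _)]
  rw [← this, ← intervalIntegral.integral_smul (2 * Real.pi)]
  refine intervalIntegral.integral_congr fun s _ => ?_
  simp only [Loop.circle, Complex.real_smul]
  ring

theorem Contour.support_circle (c : ℂ) {R : ℝ} (hR : 0 < R) :
    (Contour.circle c R).support = Metric.sphere c R := by
  ext u
  simp only [Contour.support, Contour.circle, Set.iUnion_const, Set.mem_image]
  constructor
  · rintro ⟨s, _, rfl⟩
    exact circleMap_mem_sphere c hR.le _
  · intro hu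
    rw [← abs_of_pos hR, ← image_circleMap_Ioc] at hu
    obtain ⟨θ, hθ, rfl⟩ := hu
    refine ⟨θ / (2 * Real.pi), ⟨by have := hθ.1; positivity, ?_⟩, ?_⟩
    · rw [div_le_one Real.two_pi_pos]; exact hθ.2
    · simp only [Loop.circle]
      rw [mul_div_cancel₀ _ Real.two_pi_pos.ne']

theorem Contour.winding_circle_of_mem {c a : ℂ} {R : ℝ} (h : ‖a - c‖ < R) :
    (Contour.circle c R).winding a = 1 := by
  rw [Contour.winding_eq, Contour.integral_circle]
  simp only [one_div]
  rw [circleIntegral.integral_sub_inv_of_mem_ball (by simpa [dist_eq_norm] using h),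
    inv_mul_cancel₀ Complex.two_pi_I_ne_zero]

theorem Contour.winding_circle_of_notMem {c a : ℂ} {R : ℝ} (hR : 0 < R) (h : R < ‖a - c‖) :
    (Contour.circle c R).winding a = 0 := by
  rw [Contour.winding_eq, Contour.integral_circle, DiffContOnCl.circleIntegral_eq_zero hR.le,
    mul_zero]
  refine DifferentiableOn.diffContOnCl fun u hu => ?_
  rw [closure_ball _ hR.ne', Metric.mem_closedBall, dist_eq_norm] at hu
  refine DifferentiableAt.differentiableWithinAt ?_
  have : u - a ≠ 0 := fun h0 => by
    rw [sub_eq_zero.1 h0] at hu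
    exact absurd hu (not_le.2 h)
  exact (differentiableAt_const _).div (by fun_prop) this

theorem Contour.mem_support_circle {c a : ℂ} {R : ℝ} (hR : 0 < R) :
    a ∈ (Contour.circle c R).support ↔ ‖a - c‖ = R := by
  rw [Contour.support_circle c hR, mem_sphere_iff_norm]

/-- The disjoint union of two contours. -/
def Contour.union (Γ Γ' : Contour) : Contour := ⟨Γ.card + Γ'.card, Fin.append Γ.loop Γ'.loop⟩

theorem Contour.integral_union (Γ Γ' : Contour) (f : ℂ → ℂ) :
    (Γ.union Γ').integral f = Γ.integral f + Γ'.integral f := by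
  refine (Fin.sum_univ_add _).trans ?_
  simp only [Contour.union, Fin.append_left, Fin.append_right]
  rfl

theorem Contour.winding_union (Γ Γ' : Contour) (a : ℂ) :
    (Γ.union Γ').winding a = Γ.winding a + Γ'.winding a := by
  simp only [Contour.winding_eq, Contour.integral_union, mul_add]

theorem Contour.support_union (Γ Γ' : Contour) :
    (Γ.union Γ').support = Γ.support ∪ Γ'.support := by
  ext u
  simp only [Contour.support, Contour.union, Set.mem_iUnion, Set.mem_union]
  constructor
  · rintro ⟨k, hk⟩
    induction k using Fin.addCases with
    | left k => left; exact ⟨k, by simpa using hk⟩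
    | right k => right; exact ⟨k, by simpa using hk⟩
  · rintro (⟨k, hk⟩ | ⟨k, hk⟩)
    · exact ⟨Fin.castAdd _ k, by simpa using hk⟩
    · exact ⟨Fin.natAdd _ k, by simpa using hk⟩

/-- The winding number does not change if the point moves by less than its distance to the
contour: `log ((u - p) / (u - q))` is a primitive of the difference of the integrands. -/
theorem Contour.winding_eq_of_norm_sub_lt (Γ : Contour) {p q : ℂ}
    (h : ∀ u ∈ Γ.support, ‖p - q‖ < ‖u - q‖) : Γ.winding p = Γ.winding q := by
  have hq : ∀ u ∈ Γ.support, u - q ≠ 0 := fun u hu h0 => by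
    have := h u hu
    rw [h0, norm_zero] at this
    exact absurd this (not_lt.2 (norm_nonneg _))
  have hp : ∀ u ∈ Γ.support, u - p ≠ 0 := fun u hu h0 => by
    have := h u hu
    rw [sub_eq_zero.1 h0] at this
    exact lt_irrefl _ this
  rw [Γ.winding_eq, Γ.winding_eq]
  congr 1
  rw [← sub_eq_zero]
  have hc : ∀ r : ℂ, (∀ u ∈ Γ.support, u - r ≠ 0) →
      ContinuousOn (fun u => 1 / (u - r)) Γ.support := fun r hr =>
    continuousOn_const.div (by fun_prop) hr
  have h1 : Γ.integral (fun u => 1 / (u - p)) - Γ.integral (fun u => 1 / (u - q)) =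
      Γ.integral (fun u => 1 / (u - p) + (-1) * (1 / (u - q))) := by
    rw [Γ.integral_add (g := fun u => (-1) * (1 / (u - q))) (hc p hp)
      (continuousOn_const.mul (hc q hq)), Γ.integral_const_mul]
    ring
  rw [h1]
  refine Γ.integral_eq_zero_of_hasDerivAt
    (G := fun u => Complex.log ((u - p) / (u - q))) (fun u hu => ?_)
    ((hc p hp).add (continuousOn_const.mul (hc q hq)))
  have hslit : (u - p) / (u - q) ∈ Complex.slitPlane := by
    refine Complex.ball_one_subset_slitPlane ?_
    rw [mem_ball_iff_norm]
    have : (u - p) / (u - q) - 1 = -((p - q) / (u - q)) := by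
      have := hq u hu
      field_simp
      ring
    rw [this, norm_neg, norm_div, div_lt_one (norm_pos_iff.2 (hq u hu))]
    exact h u hu
  have hd : HasDerivAt (fun u => (u - p) / (u - q))
      ((1 * (u - q) - (u - p) * 1) / (u - q) ^ 2) u :=
    ((hasDerivAt_id u).sub_const p).fun_div ((hasDerivAt_id u).sub_const q) (hq u hu)
  refine (hd.clog hslit).congr_deriv ?_
  have h3 := hp u hu
  have h4 := hq u hu
  field_simp
  ring

/-- A rational function of order at most `u⁻²` at infinity has total residue zero. -/
theorem RatOn.integral_circle_eq_zero {S : Set ℂ} {f : ℂ → ℂ} (hf : RatOn S f) {c : ℂ} {R C : ℝ}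
    (hR : 0 < R) (hS : ∀ a ∈ S, ‖a - c‖ < R)
    (hC : ∀ u, R ≤ ‖u - c‖ → ‖f u‖ ≤ C / ‖u - c‖ ^ 2) :
    (Contour.circle c R).integral f = 0 := by
  have hconst : ∀ R', R ≤ R' → (Contour.circle c R).integral f =
      (Contour.circle c R').integral f := by
    intro R' hR'
    have hpos : 0 < R' := hR.trans_le hR'
    have := hf.sum_integral_eq_zero (Finset.univ : Finset (Fin 2)) ![1, -1]
      ![Contour.circle c R, Contour.circle c R'] (fun i _ a ha h => by
        have h1 := hS a ha
        fin_cases i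
        · exact h1.ne ((Contour.mem_support_circle hR).1 h)
        · exact (h1.trans_le hR').ne ((Contour.mem_support_circle hpos).1 h))
      (fun a ha => by
        simp [Fin.sum_univ_two, Contour.winding_circle_of_mem (hS a ha),
          Contour.winding_circle_of_mem ((hS a ha).trans_le hR')])
    simp only [Fin.sum_univ_two, Matrix.cons_val_zero, Matrix.cons_val_one, one_mul, neg_mul]
      at this
    exact sub_eq_zero.1 (by rw [sub_eq_add_neg]; exact this)
  have hbound : ∀ R', R ≤ R' → ‖(Contour.circle c R).integral f‖ ≤ 2 * Real.pi * C * R'⁻¹ := by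
    intro R' hR'
    have hpos : 0 < R' := hR.trans_le hR'
    rw [hconst R' hR', Contour.integral_circle]
    refine (circleIntegral.norm_integral_le_of_norm_le_const (C := C / R' ^ 2) hpos.le
      fun u hu => ?_).trans (le_of_eq ?_)
    · rw [mem_sphere_iff_norm] at hu
      have := hC u (by rw [hu]; exact hR')
      rwa [hu] at this
    · field_simp
  have hlim : Filter.Tendsto (fun R' : ℝ => 2 * Real.pi * C * R'⁻¹) Filter.atTop (nhds 0) := by
    simpa using tendsto_inv_atTop_zero.const_mul (2 * Real.pi * C)
  exact norm_le_zero_iff.1 (ge_of_tendsto hlim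
    (Filter.eventually_atTop.2 ⟨R, fun R' hR' => hbound R' hR'⟩))

end SixVertex

namespace SixVertex

open MeasureTheory

/-! ### Iterated contour integrals -/

section MultiIntegral

variable {n L : ℕ}

/-- The product of the supports of the contours. -/
def multiSupport (Γ : Fin L → Contour) : Set (Fin L → ℂ) := {u | ∀ i, u i ∈ (Γ i).support}

theorem mem_multiSupport (Γ : Fin L → Contour) (k : (i : Fin L) → Fin (Γ i).card) {s : Fin L → ℝ}
    (hs : s ∈ Set.Icc (0 : Fin L → ℝ) 1) :
    (fun i => ((Γ i).loop (k i)).toFun (s i)) ∈ multiSupport Γ :=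
  fun i => (Γ i).mem_support (k i) ⟨hs.1 i, hs.2 i⟩

theorem isCompact_multiSupport (Γ : Fin L → Contour) : IsCompact (multiSupport Γ) := by
  have : multiSupport Γ = Set.univ.pi fun i => (Γ i).support := by
    ext u; simp [multiSupport]
  rw [this]
  exact isCompact_univ_pi fun i => (Γ i).isCompact_support

theorem integrableOn_multiIntegrand {Γ : Fin L → Contour} {F : (Fin L → ℂ) → ℂ}
    (hF : ContinuousOn F (multiSupport Γ)) (k : (i : Fin L) → Fin (Γ i).card) :
    IntegrableOn (fun s : Fin L → ℝ => F (fun i => ((Γ i).loop (k i)).toFun (s i)) *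
      ∏ i, deriv ((Γ i).loop (k i)).toFun (s i)) (Set.Icc 0 1) := by
  have hγ : ContinuousOn (fun s : Fin L → ℝ => fun i => ((Γ i).loop (k i)).toFun (s i))
      (Set.Icc 0 1) := by
    refine continuousOn_pi.2 fun i => ?_
    exact ((Γ i).loop (k i)).continuousOn.comp (continuous_apply i).continuousOn
      fun s hs => ⟨hs.1 i, hs.2 i⟩
  have hc := hF.comp hγ fun s hs => mem_multiSupport Γ k hs
  choose C hC using fun i => ((Γ i).loop (k i)).bounded
  refine Integrable.mul_bdd (c := ∏ i, C i) (hc.integrableOn_compact isCompact_Icc) ?_ ?_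
  · exact (Finset.measurable_fun_prod _ fun i _ =>
      (measurable_deriv _).comp (measurable_pi_apply i)).aestronglyMeasurable
  · refine (ae_restrict_iff' measurableSet_Icc).2 (Filter.Eventually.of_forall fun s hs => ?_)
    rw [norm_prod]
    exact Finset.prod_le_prod (fun i _ => norm_nonneg _) fun i _ => hC i _ ⟨hs.1 i, hs.2 i⟩

theorem multiIntegral_congr {Γ : Fin L → Contour} {F G : (Fin L → ℂ) → ℂ}
    (h : ∀ u ∈ multiSupport Γ, F u = G u) : multiIntegral Γ F = multiIntegral Γ G := by
  refine Finset.sum_congr rfl fun k _ => setIntegral_congr_fun measurableSet_Icc fun s hs => ?_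
  simp only [h _ (mem_multiSupport Γ k hs)]

theorem multiIntegral_add {Γ : Fin L → Contour} {F G : (Fin L → ℂ) → ℂ}
    (hF : ContinuousOn F (multiSupport Γ)) (hG : ContinuousOn G (multiSupport Γ)) :
    multiIntegral Γ (fun u => F u + G u) = multiIntegral Γ F + multiIntegral Γ G := by
  simp only [multiIntegral, ← Finset.sum_add_distrib, add_mul]
  exact Finset.sum_congr rfl fun k _ => MeasureTheory.integral_add
    (integrableOn_multiIntegrand hF k) (integrableOn_multiIntegrand hG k)

theorem multiIntegral_const_mul (Γ : Fin L → Contour) (c : ℂ) (F : (Fin L → ℂ) → ℂ) :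
    multiIntegral Γ (fun u => c * F u) = c * multiIntegral Γ F := by
  simp only [multiIntegral, Finset.mul_sum, mul_assoc, MeasureTheory.integral_const_mul]

theorem multiIntegral_zero_fun (Γ : Fin L → Contour) : multiIntegral Γ (fun _ => 0) = 0 := by
  simp [multiIntegral]

theorem multiIntegral_sum {Γ : Fin L → Contour} {ι : Type*} (I : Finset ι)
    {F : ι → (Fin L → ℂ) → ℂ} (hF : ∀ i ∈ I, ContinuousOn (F i) (multiSupport Γ)) :
    multiIntegral Γ (fun u => ∑ i ∈ I, F i u) = ∑ i ∈ I, multiIntegral Γ (F i) := by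
  classical
  induction I using Finset.induction_on with
  | empty => simpa using multiIntegral_zero_fun Γ
  | insert i I hi ih =>
    simp only [Finset.sum_insert hi]
    rw [multiIntegral_add (hF i (Finset.mem_insert_self i I))
      (continuousOn_finsetSum _ fun j hj => hF j (Finset.mem_insert_of_mem hj)),
      ih fun j hj => hF j (Finset.mem_insert_of_mem hj)]

theorem multiIntegral_fin_zero (Γ : Fin 0 → Contour) (F : (Fin 0 → ℂ) → ℂ) :
    multiIntegral Γ F = F Fin.elim0 := by
  have h : ∀ g : (Fin 0 → ℝ) → ℂ, ∫ s in Set.Icc (0 : Fin 0 → ℝ) 1, g s = g Fin.elim0 := by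
    intro g
    have : Set.Icc (0 : Fin 0 → ℝ) 1 = Set.univ :=
      Set.eq_univ_of_forall fun s => ⟨fun i => i.elim0, fun i => i.elim0⟩
    rw [this, Measure.restrict_univ, volume_pi, Measure.pi_of_empty _ Fin.elim0, integral_dirac]
  unfold multiIntegral
  rw [Finset.univ_unique, Finset.sum_singleton, h]
  simp only [Finset.univ_eq_empty, Finset.prod_empty, mul_one]
  congr 1
  exact Subsingleton.elim _ _

theorem insertNth_mem_multiSupport {Γ : Fin (n + 1) → Contour} {j : Fin (n + 1)} {a : ℂ}
    {v : Fin n → ℂ} (ha : a ∈ (Γ j).support)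
    (hv : v ∈ multiSupport fun i => Γ (j.succAbove i)) :
    (j.insertNth a v : Fin (n + 1) → ℂ) ∈ multiSupport Γ := by
  intro i
  induction i using Fin.succAboveCases j with
  | x => simpa using ha
  | p i => simpa using hv i

theorem continuous_insertNth_prod (j : Fin (n + 1)) :
    Continuous fun p : ℂ × (Fin n → ℂ) => (j.insertNth p.1 p.2 : Fin (n + 1) → ℂ) := by
  refine continuous_pi fun i => ?_
  induction i using Fin.succAboveCases j with
  | x => simpa using continuous_fst
  | p i =>
    simp only [Fin.insertNth_apply_succAbove]
    fun_prop

/-- Fubini: the integral over the `j`-th variable can be taken first. -/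
theorem multiIntegral_eq_insertNth {Γ : Fin (n + 1) → Contour} (j : Fin (n + 1))
    {F : (Fin (n + 1) → ℂ) → ℂ} (hF : ContinuousOn F (multiSupport Γ)) :
    multiIntegral Γ F = multiIntegral (fun i => Γ (j.succAbove i))
      fun v => (Γ j).integral fun a => F (j.insertNth a v) := by
  unfold multiIntegral
  rw [← (Fin.insertNthEquiv (fun i => Fin (Γ i).card) j).sum_comp, Fintype.sum_prod_type_right]
  refine Finset.sum_congr rfl fun k' _ => ?_
  have e := (volume_preserving_piFinSuccAbove (fun _ : Fin (n + 1) => ℝ) j).symm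
  have hIcc : (MeasurableEquiv.piFinSuccAbove (fun _ : Fin (n + 1) => ℝ) j).symm ⁻¹' Set.Icc 0 1 =
      Set.Icc 0 1 ×ˢ Set.Icc 0 1 := by
    ext ⟨a, v⟩
    simp only [Set.mem_preimage, Set.mem_prod, Set.mem_Icc, Pi.le_def,
      MeasurableEquiv.piFinSuccAbove_symm_apply, Fin.insertNthEquiv, Equiv.coe_fn_mk]
    rw [Fin.forall_iff_succAbove j, Fin.forall_iff_succAbove j]
    simp
    tauto
  have hF' : ∀ (k : Fin (Γ j).card) (a : ℝ) (v : Fin n → ℝ), (fun i =>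
      ((Γ i).loop (Fin.insertNthEquiv (fun i => Fin (Γ i).card) j (k, k') i)).toFun
        ((j.insertNth a v : Fin (n + 1) → ℝ) i)) = (j.insertNth (((Γ j).loop k).toFun a)
        fun i => ((Γ (j.succAbove i)).loop (k' i)).toFun (v i) : Fin (n + 1) → ℂ) := by
    intro k a v
    funext i
    induction i using Fin.succAboveCases j with
    | x => simp [Fin.insertNthEquiv]
    | p i => simp [Fin.insertNthEquiv]
  set G : Fin (Γ j).card → ℝ × (Fin n → ℝ) → ℂ := fun k z =>
    F (j.insertNth (((Γ j).loop k).toFun z.1)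
      fun i => ((Γ (j.succAbove i)).loop (k' i)).toFun (z.2 i)) *
    deriv ((Γ j).loop k).toFun z.1 *
      ∏ i, deriv ((Γ (j.succAbove i)).loop (k' i)).toFun (z.2 i) with hG
  have hcomp : ∀ (k : Fin (Γ j).card),
      (fun s : Fin (n + 1) → ℝ => F (fun i =>
        ((Γ i).loop (Fin.insertNthEquiv (fun i => Fin (Γ i).card) j (k, k') i)).toFun (s i)) *
        ∏ i, deriv ((Γ i).loop (Fin.insertNthEquiv (fun i => Fin (Γ i).card) j (k, k') i)).toFun
          (s i)) ∘ (MeasurableEquiv.piFinSuccAbove (fun _ : Fin (n + 1) => ℝ) j).symm = G k := by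
    intro k
    funext ⟨a, v⟩
    simp only [Function.comp, MeasurableEquiv.piFinSuccAbove_symm_apply]
    have h := hF' k a v
    simp only [Fin.insertNthEquiv, Equiv.coe_fn_mk] at h ⊢
    rw [h, Fin.prod_univ_succAbove _ j, ← mul_assoc]
    simp [hG]
  have hint : ∀ k, IntegrableOn (G k) (Set.Icc 0 1 ×ˢ Set.Icc 0 1) (volume.prod volume) := by
    intro k
    have := integrableOn_multiIntegrand hF
      (Fin.insertNthEquiv (fun i => Fin (Γ i).card) j (k, k'))
    rw [← e.integrableOn_comp_preimage (MeasurableEquiv.measurableEmbedding _), hIcc, hcomp] at this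
    exact this
  have key : ∀ k, ∫ s in Set.Icc (0 : Fin (n + 1) → ℝ) 1,
        F (fun i => ((Γ i).loop (Fin.insertNthEquiv (fun i => Fin (Γ i).card) j (k, k') i)).toFun
          (s i)) *
        ∏ i, deriv ((Γ i).loop (Fin.insertNthEquiv (fun i => Fin (Γ i).card) j (k, k') i)).toFun
          (s i) =
      ∫ v in Set.Icc (0 : Fin n → ℝ) 1, ∫ a in Set.Icc (0 : ℝ) 1, G k (a, v) := by
    intro k
    have h1 := hint k
    rw [IntegrableOn, ← Measure.prod_restrict] at h1
    rw [← integral_prod_symm _ h1, Measure.prod_restrict, ← hcomp k, ← hIcc]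
    exact (e.setIntegral_preimage_emb (MeasurableEquiv.measurableEmbedding _) _ _).symm
  rw [Finset.sum_congr rfl fun k _ => key k, ← integral_finsetSum]
  · refine setIntegral_congr_fun measurableSet_Icc fun v _ => ?_
    simp only [hG, Contour.integral, Finset.sum_mul, ← MeasureTheory.integral_mul_const]
  · intro k _
    have h1 := hint k
    rw [IntegrableOn, ← Measure.prod_restrict] at h1
    exact h1.integral_prod_right

theorem Contour.continuousOn_integral_insertNth {Γ : Fin (n + 1) → Contour} (j : Fin (n + 1))
    {F : (Fin (n + 1) → ℂ) → ℂ} (hF : ContinuousOn F (multiSupport Γ)) :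
    ContinuousOn (fun v => (Γ j).integral fun a => F (j.insertNth a v))
      (multiSupport fun i => Γ (j.succAbove i)) := by
  obtain ⟨M, hM⟩ := (isCompact_multiSupport Γ).exists_bound_of_continuousOn hF
  refine continuousOn_finsetSum _ fun k _ => ?_
  obtain ⟨C, hC⟩ := ((Γ j).loop k).bounded
  refine continuousOn_of_dominated (bound := fun _ => M * C) (fun v hv => ?_) (fun v hv => ?_)
    (integrable_const _) ?_
  · refine (Loop.integrableOn_deriv_mul _ ?_).aestronglyMeasurable
    exact hF.comp ((continuous_insertNth_prod j).comp_continuousOn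
      (((Γ j).loop k).continuousOn.prodMk continuousOn_const))
      fun a ha => insertNth_mem_multiSupport ((Γ j).mem_support k ha) hv
  · refine (ae_restrict_iff' measurableSet_Icc).2 (Filter.Eventually.of_forall fun a ha => ?_)
    rw [norm_mul]
    have h1 := hM _ (insertNth_mem_multiSupport ((Γ j).mem_support k ha) hv)
    exact mul_le_mul h1 (hC a ha) (norm_nonneg _) ((norm_nonneg _).trans h1)
  · refine (ae_restrict_iff' measurableSet_Icc).2 (Filter.Eventually.of_forall fun a ha => ?_)
    refine ContinuousOn.mul ?_ continuousOn_const
    exact hF.comp ((continuous_insertNth_prod j).comp_continuousOn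
      (continuousOn_const.prodMk continuousOn_id))
      fun v hv => insertNth_mem_multiSupport ((Γ j).mem_support k ha) hv

/-- If the contour of one variable is replaced by a combination of contours that gives the same
inner integrals, the multiple integral is replaced by the same combination. -/
theorem multiIntegral_eq_sum_update {Γ : Fin L → Contour} (j : Fin L)
    {F : (Fin L → ℂ) → ℂ} {ι : Type*} (I : Finset ι) (c : ι → ℂ) (Γ' : ι → Contour)
    (hF : ContinuousOn F (multiSupport Γ))
    (hF' : ∀ i ∈ I, ContinuousOn F (multiSupport (Function.update Γ j (Γ' i))))
    (h : ∀ u, (∀ i ≠ j, u i ∈ (Γ i).support) →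
      (Γ j).integral (fun a => F (Function.update u j a)) =
        ∑ i ∈ I, c i * (Γ' i).integral fun a => F (Function.update u j a)) :
    multiIntegral Γ F = ∑ i ∈ I, c i * multiIntegral (Function.update Γ j (Γ' i)) F := by
  obtain ⟨n, rfl⟩ : ∃ n, L = n + 1 := ⟨L - 1, by have := j.pos; omega⟩
  rw [multiIntegral_eq_insertNth j hF]
  have h1 : ∀ i ∈ I, c i * multiIntegral (Function.update Γ j (Γ' i)) F =
      multiIntegral (fun i => Γ (j.succAbove i))
        fun v => c i * (Γ' i).integral fun a => F (j.insertNth a v) := by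
    intro i hi
    rw [multiIntegral_const_mul, multiIntegral_eq_insertNth j (hF' i hi)]
    simp
  rw [Finset.sum_congr rfl h1, ← multiIntegral_sum]
  · refine multiIntegral_congr fun v hv => ?_
    have := h (j.insertNth 0 v) fun i hi => by
      obtain ⟨k, rfl⟩ := Fin.exists_succAbove_eq hi
      simpa using hv k
    simpa [Fin.update_insertNth] using this
  · intro i hi
    have := Contour.continuousOn_integral_insertNth j (hF' i hi)
    simp only [Function.update_self, ne_eq, Fin.succAbove_ne, not_false_eq_true,
      Function.update_of_ne] at this
    exact continuousOn_const.mul this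

/-- If the integral over two of the variables does not change when the contours of the other
variables are kept, then the multiple integral does not change. -/
theorem multiIntegral_congr_two {Γ Γ' : Fin L → Contour} {i j : Fin L} (hij : i ≠ j)
    {F F' : (Fin L → ℂ) → ℂ} (hΓ : ∀ k, k ≠ i → k ≠ j → Γ k = Γ' k)
    (hF : ContinuousOn F (multiSupport Γ)) (hF' : ContinuousOn F' (multiSupport Γ'))
    (h : ∀ u, (∀ k, k ≠ i → k ≠ j → u k ∈ (Γ k).support) →
      ((Γ j).integral fun b => (Γ i).integral fun a =>
        F (Function.update (Function.update u j b) i a)) =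
      ((Γ' j).integral fun b => (Γ' i).integral fun a =>
        F' (Function.update (Function.update u j b) i a))) :
    multiIntegral Γ F = multiIntegral Γ' F' := by
  obtain ⟨n, rfl⟩ : ∃ n, L = n + 1 := ⟨L - 1, by have := j.pos; omega⟩
  obtain ⟨j, rfl⟩ := Fin.exists_succAbove_eq hij.symm
  obtain ⟨n, rfl⟩ : ∃ m, n = m + 1 := ⟨n - 1, by have := j.pos; omega⟩
  rw [multiIntegral_eq_insertNth i hF, multiIntegral_eq_insertNth i hF',
    multiIntegral_eq_insertNth j (Contour.continuousOn_integral_insertNth i hF),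
    multiIntegral_eq_insertNth j (Contour.continuousOn_integral_insertNth i hF')]
  have hΓ' : (fun k => Γ (i.succAbove (j.succAbove k))) =
      fun k => Γ' (i.succAbove (j.succAbove k)) := by
    funext k
    exact hΓ _ (Fin.succAbove_ne _ _) fun h =>
      Fin.succAbove_ne j k (Fin.succAbove_right_injective h)
  rw [← hΓ']
  refine multiIntegral_congr fun v hv => ?_
  have := h (i.insertNth 0 (j.insertNth 0 v)) fun k hki hkj => by
    obtain ⟨k, rfl⟩ := Fin.exists_succAbove_eq hki
    obtain ⟨k, rfl⟩ := Fin.exists_succAbove_eq (y := j) (x := k)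
      fun h => hkj (by rw [h])
    simpa using hv k
  simpa only [← Fin.insertNth_update, Fin.update_insertNth] using this

/-- The contour of the variable `i` can be replaced if the difference of the inner integrals
integrates to zero over another variable. -/
theorem multiIntegral_eq_update_of_two {Γ : Fin L → Contour} {i j : Fin L} (hij : i ≠ j)
    (c : Contour) {F : (Fin L → ℂ) → ℂ} (hF : ContinuousOn F (multiSupport Γ))
    (hF' : ContinuousOn F (multiSupport (Function.update Γ i c)))
    (h : ∀ u, (∀ k, k ≠ i → k ≠ j → u k ∈ (Γ k).support) →
      ((Γ j).integral fun b =>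
        ((Γ i).integral fun a => F (Function.update (Function.update u j b) i a)) -
          c.integral fun a => F (Function.update (Function.update u j b) i a)) = 0) :
    multiIntegral Γ F = multiIntegral (Function.update Γ i c) F := by
  obtain ⟨n, rfl⟩ : ∃ n, L = n + 1 := ⟨L - 1, by have := j.pos; omega⟩
  obtain ⟨j, rfl⟩ := Fin.exists_succAbove_eq hij.symm
  obtain ⟨n, rfl⟩ : ∃ m, n = m + 1 := ⟨n - 1, by have := j.pos; omega⟩
  have hc := Contour.continuousOn_integral_insertNth i hF
  have hc' := Contour.continuousOn_integral_insertNth i hF'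
  rw [multiIntegral_eq_insertNth i hF, multiIntegral_eq_insertNth i hF']
  simp only [Function.update_self, ne_eq, Fin.succAbove_ne, not_false_eq_true,
    Function.update_of_ne] at hc' ⊢
  have hneg : ContinuousOn (fun v : Fin (n + 1) → ℂ =>
      (-1) * c.integral fun a => F (i.insertNth a v))
      (multiSupport fun k => Γ (i.succAbove k)) := continuousOn_const.mul hc'
  have hsum : ContinuousOn (fun v : Fin (n + 1) → ℂ =>
      ((Γ i).integral fun a => F (i.insertNth a v)) +
        (-1) * c.integral fun a => F (i.insertNth a v))
      (multiSupport fun k => Γ (i.succAbove k)) := hc.add hneg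
  rw [← sub_eq_zero, sub_eq_add_neg, ← neg_one_mul, ← multiIntegral_const_mul,
    ← multiIntegral_add hc hneg, multiIntegral_eq_insertNth j hsum,
    ← multiIntegral_zero_fun fun k => Γ (i.succAbove (j.succAbove k))]
  refine multiIntegral_congr fun v hv => ?_
  have := h (i.insertNth 0 (j.insertNth 0 v)) fun k hki hkj => by
    obtain ⟨k, rfl⟩ := Fin.exists_succAbove_eq hki
    obtain ⟨k, rfl⟩ := Fin.exists_succAbove_eq (y := j) (x := k)
      fun h => hkj (by rw [h])
    simpa using hv k
  simpa only [← Fin.insertNth_update, Fin.update_insertNth, sub_eq_add_neg, neg_one_mul] using this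

end MultiIntegral

end SixVertex

namespace SixVertex

/-! ### The nested integrand -/

section Nested

variable {n L : ℕ} {τ : ℂ}

/-- The factor `(u_A - u_B) / (u_A - τ u_B)`, `A < B`, attached to an unordered pair of variables,
written as a function of the values `a`, `b` of the variables with the indices `A`, `B`. -/
noncomputable def cross (τ : ℂ) (A B : Fin L) (a b : ℂ) : ℂ :=
  if A < B then (a - b) / (a - τ * b) else (b - a) / (b - τ * a)

/-- The product of the cross factors and of one-variable functions `h A`, over the variables with
indices in `I`. -/
noncomputable def nested (τ : ℂ) (h : Fin L → ℂ → ℂ) (I : Finset (Fin L)) (u : Fin L → ℂ) : ℂ :=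
  (∏ A ∈ I, ∏ B ∈ I with A < B, (u A - u B) / (u A - τ * u B)) * ∏ A ∈ I, h A (u A)

theorem nested_insert (h : Fin L → ℂ → ℂ) {I : Finset (Fin L)} {A : Fin L} (hA : A ∉ I)
    (u : Fin L → ℂ) : nested τ h (insert A I) u =
      nested τ h I u * (h A (u A) * ∏ B ∈ I, cross τ A B (u A) (u B)) := by
  unfold nested
  rw [Finset.prod_insert hA, Finset.prod_insert hA]
  have h1 : (insert A I).filter (A < ·) = I.filter (A < ·) := by
    rw [Finset.filter_insert, if_neg (lt_irrefl A)]
  have h2 : ∀ A' ∈ I, ∏ B ∈ insert A I with A' < B, (u A' - u B) / (u A' - τ * u B) =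
      (if A' < A then (u A' - u A) / (u A' - τ * u A) else 1) *
        ∏ B ∈ I with A' < B, (u A' - u B) / (u A' - τ * u B) := by
    intro A' _
    rw [Finset.filter_insert]
    split_ifs
    · rw [Finset.prod_insert (by simp [hA])]
    · rw [one_mul]
  rw [h1, Finset.prod_congr rfl h2, Finset.prod_mul_distrib, Finset.prod_filter]
  have h3 : ∏ B ∈ I, cross τ A B (u A) (u B) =
      (∏ B ∈ I, if A < B then (u A - u B) / (u A - τ * u B) else 1) *
        ∏ B ∈ I, if B < A then (u B - u A) / (u B - τ * u A) else 1 := by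
    rw [← Finset.prod_mul_distrib]
    refine Finset.prod_congr rfl fun B hB => ?_
    have hne : A ≠ B := fun h => hA (h ▸ hB)
    rcases hne.lt_or_gt with hlt | hlt
    · simp [cross, hlt, hlt.not_gt]
    · simp [cross, hlt, hlt.not_gt]
  rw [h3]
  ring

theorem nested_congr {h : Fin L → ℂ → ℂ} {I : Finset (Fin L)} {u v : Fin L → ℂ}
    (huv : ∀ A ∈ I, u A = v A) : nested τ h I u = nested τ h I v := by
  unfold nested
  congr 1
  · refine Finset.prod_congr rfl fun A hA => Finset.prod_congr rfl fun B hB => ?_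
    rw [huv A hA, huv B (Finset.mem_filter.1 hB).1]
  · exact Finset.prod_congr rfl fun A hA => by rw [huv A hA]

theorem nested_congr_fun {h k : Fin L → ℂ → ℂ} {I : Finset (Fin L)} {u : Fin L → ℂ}
    (hk : ∀ A ∈ I, h A (u A) = k A (u A)) : nested τ h I u = nested τ k I u := by
  unfold nested
  rw [Finset.prod_congr rfl hk]

/-- The integrand as a function of one variable. -/
theorem nested_update (h : Fin L → ℂ → ℂ) (j : Fin L) (u : Fin L → ℂ) (a : ℂ) :
    nested τ h Finset.univ (Function.update u j a) =
      nested τ h (Finset.univ.erase j) u *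
        (h j a * ∏ B ∈ Finset.univ.erase j, cross τ j B a (u B)) := by
  rw [← Finset.insert_erase (Finset.mem_univ j), nested_insert h (Finset.notMem_erase j _),
    Finset.erase_insert (Finset.notMem_erase j _)]
  congr 1
  · exact nested_congr fun A hA => Function.update_of_ne (Finset.ne_of_mem_erase hA) _ _
  · rw [Function.update_self]
    congr 1
    exact Finset.prod_congr rfl fun B hB => by
      rw [Function.update_of_ne (Finset.ne_of_mem_erase hB)]

/-- The integrand as a function of two variables. -/
theorem nested_update_update (h : Fin L → ℂ → ℂ) {i j : Fin L} (hij : i ≠ j) (u : Fin L → ℂ)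
    (a b : ℂ) :
    nested τ h Finset.univ (Function.update (Function.update u j b) i a) =
      nested τ h ((Finset.univ.erase i).erase j) u *
        (h j b * ∏ B ∈ (Finset.univ.erase i).erase j, cross τ j B b (u B)) *
        (h i a * (cross τ i j a b * ∏ B ∈ (Finset.univ.erase i).erase j, cross τ i B a (u B))) := by
  have hj : j ∈ Finset.univ.erase i := Finset.mem_erase.2 ⟨hij.symm, Finset.mem_univ j⟩
  have hne : ∀ B ∈ (Finset.univ.erase i).erase j, Function.update u j b B = u B := fun B hB =>
    Function.update_of_ne (Finset.ne_of_mem_erase hB) _ _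
  rw [nested_update, ← Finset.mul_prod_erase _ _ hj, Function.update_self,
    Finset.prod_congr rfl fun B hB => by rw [hne B hB]]
  congr 1
  rw [← Finset.insert_erase hj, nested_insert h (Finset.notMem_erase j _),
    Finset.erase_insert (Finset.notMem_erase j _), nested_congr hne, Function.update_self,
    Finset.prod_congr rfl fun B hB => by rw [hne B hB]]

theorem nested_map_succ (h : Fin (n + 1) → ℂ → ℂ) (u : Fin (n + 1) → ℂ) :
    nested τ h (Finset.univ.erase 0) u =
      nested τ (fun i => h i.succ) Finset.univ (fun i => u i.succ) := by
  have : (Finset.univ.erase 0 : Finset (Fin (n + 1))) = Finset.univ.map (Fin.succEmb n) := by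
    ext i
    induction i using Fin.cases <;> simp
  rw [this]
  simp [nested, Finset.prod_map, Finset.filter_map, Function.comp_def]

/-- The contours do not meet the poles of the cross factors. -/
def Separated (τ : ℂ) (Γ : Fin L → Contour) : Prop :=
  ∀ A B, A < B → ∀ a ∈ (Γ A).support, ∀ b ∈ (Γ B).support, a ≠ τ * b

theorem continuousOn_nested {Γ : Fin L → Contour} {h : Fin L → ℂ → ℂ} (hΓ : Separated τ Γ)
    (hh : ∀ A, ContinuousOn (h A) (Γ A).support) :
    ContinuousOn (nested τ h Finset.univ) (multiSupport Γ) := by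
  unfold nested
  refine ContinuousOn.mul ?_ ?_
  · refine continuousOn_finsetProd _ fun A _ => continuousOn_finsetProd _ fun B hB => ?_
    refine ContinuousOn.div (by fun_prop) (by fun_prop) fun u hu => ?_
    exact sub_ne_zero.2 (hΓ A B (Finset.mem_filter.1 hB).2 _ (hu A) _ (hu B))
  · exact continuousOn_finsetProd _ fun A _ =>
      (hh A).comp (continuous_apply A).continuousOn fun u hu => hu A

/-- The poles in the variable `j` that come from the cross factors. -/
def crossPoles (τ : ℂ) (j : Fin L) (u : Fin L → ℂ) : Set ℂ :=
  {p | (∃ B, B < j ∧ p = u B / τ) ∨ ∃ B, j < B ∧ p = τ * u B}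

theorem ratOn_cross (hτ : τ ≠ 0) {j B : Fin L} (hB : B ≠ j) {b : ℂ} {S : Set ℂ}
    (h1 : B < j → b / τ ∈ S) (h2 : j < B → τ * b ∈ S) : RatOn S (fun a => cross τ j B a b) := by
  rcases hB.lt_or_gt with hlt | hlt
  · have : (fun a => cross τ j B a b) = fun a => (b - a) / (-τ * a + b) := by
      funext a
      rw [cross, if_neg hlt.not_gt]
      ring
    rw [this]
    refine RatOn.div_linear ((RatOn.const S b).sub (RatOn.id S)) (fun u hu => ?_)
      (Or.inl (neg_ne_zero.2 hτ))
    have : u = b / τ := by field_simp; linear_combination -hu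
    rw [this]
    exact h1 hlt
  · have : (fun a => cross τ j B a b) = fun a => (a - b) / (1 * a + -(τ * b)) := by
      funext a
      rw [cross, if_pos hlt]
      ring
    rw [this]
    refine RatOn.div_linear ((RatOn.id S).sub (RatOn.const S b)) (fun u hu => ?_)
      (Or.inl one_ne_zero)
    have : u = τ * b := by linear_combination hu
    rw [this]
    exact h2 hlt

theorem ratOn_prod_cross (hτ : τ ≠ 0) {j : Fin L} {u : Fin L → ℂ} {I : Finset (Fin L)} {S : Set ℂ}
    (hI : j ∉ I) (hS : ∀ B ∈ I, (B < j → u B / τ ∈ S) ∧ (j < B → τ * u B ∈ S)) :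
    RatOn S (fun a => ∏ B ∈ I, cross τ j B a (u B)) :=
  RatOn.prod _ fun B hB => ratOn_cross hτ (ne_of_mem_of_not_mem hB hI) (hS B hB).1 (hS B hB).2

theorem ratOn_prod_cross_univ (hτ : τ ≠ 0) (j : Fin L) (u : Fin L → ℂ) :
    RatOn (crossPoles τ j u) (fun a => ∏ B ∈ Finset.univ.erase j, cross τ j B a (u B)) :=
  ratOn_prod_cross hτ (Finset.notMem_erase j _) fun B _ =>
    ⟨fun h => Or.inl ⟨B, h, rfl⟩, fun h => Or.inr ⟨B, h, rfl⟩⟩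

end Nested

/-! ### The one-variable functions -/

section OneBody

variable {n L : ℕ} {τ κ : ℂ}

/-- The eigenvalue of one time step, as a function of the spectral parameter. -/
noncomputable def timeFactor (τ κ u : ℂ) : ℂ := (1 + u * τ⁻¹ * κ) / (1 + u * κ)

/-- The multiplier of one space step, as a function of the spectral parameter. -/
noncomputable def spaceFactor (τ u : ℂ) : ℂ := (1 + u) / (1 + u * τ⁻¹)

/-- The one-variable factor of the integrand. -/
noncomputable def oneBody (τ κ : ℂ) (t : ℕ) (y : ℤ) (u : ℂ) : ℂ :=
  timeFactor τ κ u ^ t * spaceFactor τ u ^ y / u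

theorem ratOn_timeFactor {S : Set ℂ} (hκ : κ ≠ 0) (hS : -κ⁻¹ ∈ S) :
    RatOn S (timeFactor τ κ) := by
  have : timeFactor τ κ = fun u => (1 + u * (τ⁻¹ * κ)) / (κ * u + 1) := by
    funext u; rw [timeFactor]; ring
  rw [this]
  refine RatOn.div_linear ((RatOn.const S 1).add ((RatOn.id S).mul (RatOn.const S _)))
    (fun u hu => ?_) (Or.inl hκ)
  have : u = -κ⁻¹ := by field_simp; linear_combination hu
  rwa [this]

theorem ratOn_spaceFactor {S : Set ℂ} (hτ : τ ≠ 0) (hS : -τ ∈ S) : RatOn S (spaceFactor τ) := by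
  have : spaceFactor τ = fun u => (1 + u) / (τ⁻¹ * u + 1) := by
    funext u; rw [spaceFactor]; ring
  rw [this]
  refine RatOn.div_linear ((RatOn.const S 1).add (RatOn.id S)) (fun u hu => ?_)
    (Or.inl (inv_ne_zero hτ))
  have : u = -τ := by field_simp at hu; linear_combination hu
  rwa [this]

theorem ratOn_spaceFactor_inv {S : Set ℂ} (hS : -1 ∈ S) :
    RatOn S (fun u => (spaceFactor τ u)⁻¹) := by
  have : (fun u => (spaceFactor τ u)⁻¹) = fun u => (1 + u * τ⁻¹) / (1 * u + 1) := by
    funext u; rw [spaceFactor, inv_div]; ring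
  rw [this]
  refine RatOn.div_linear ((RatOn.const S 1).add ((RatOn.id S).mul (RatOn.const S _)))
    (fun u hu => ?_) (Or.inl one_ne_zero)
  have : u = -1 := by linear_combination hu
  rwa [this]

/-- The poles of the one-variable factor when the exponent is nonnegative. -/
def basePoles (τ κ : ℂ) : Set ℂ := {0, -τ, -κ⁻¹}

theorem ratOn_oneBody (hτ : τ ≠ 0) (hκ : κ ≠ 0) (t y : ℕ) :
    RatOn (basePoles τ κ) (oneBody τ κ t y) := by
  have : oneBody τ κ t y =
      fun u => (timeFactor τ κ u ^ t * spaceFactor τ u ^ y) / (1 * u + 0) := by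
    funext u; simp [oneBody]
  rw [this]
  refine RatOn.div_linear (RatOn.mul (RatOn.pow (ratOn_timeFactor hκ (by simp [basePoles])) t)
    (RatOn.pow (ratOn_spaceFactor hτ (by simp [basePoles])) y)) (fun u hu => ?_)
    (Or.inl one_ne_zero)
  simp only [one_mul, add_zero] at hu
  simp [hu, basePoles]

theorem integrand_eq_nested (b₁ b₂ : ℝ) (t : ℕ) (x : ℤ) :
    integrand b₁ b₂ t x (L := L) = nested ((b₂ : ℂ) / b₁)
      (fun _ => oneBody ((b₂ : ℂ) / b₁) ((1 - b₁) / (1 - b₂)) t x) Finset.univ := by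
  funext u
  simp only [integrand, nested, oneBody, timeFactor, spaceFactor]
  congr 1
  refine Finset.prod_congr rfl fun A _ => Finset.prod_congr ?_ fun _ _ => rfl
  ext B
  simp

/-- If the first exponent is not positive, the only pole of the first variable inside its contour
is `0`, and the integral over this variable can be evaluated. -/
theorem multiIntegral_nested_of_nonpos (hτ : τ ≠ 0) (hκ : κ ≠ 0) {Γ : Fin (n + 1) → Contour}
    {h : Fin (n + 1) → ℂ → ℂ} {t : ℕ} {y : ℤ} (hy : y ≤ 0) (hh : h 0 = oneBody τ κ t y)
    (h_zero : ∀ A, (Γ A).Includes 0) (h_kappa : (Γ 0).Excludes (-κ⁻¹))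
    (h_cross : ∀ B, 0 < B → ∀ u ∈ (Γ B).support, (Γ 0).Excludes (τ * u))
    (h_one : y < 0 → (Γ 0).Excludes (-1))
    (hF : ContinuousOn (nested τ h Finset.univ) (multiSupport Γ)) :
    multiIntegral Γ (nested τ h Finset.univ) = 2 * Real.pi * Complex.I * τ⁻¹ ^ n *
      multiIntegral (fun i => Γ i.succ) (nested τ (fun i => h i.succ) Finset.univ) := by
  rw [multiIntegral_eq_insertNth 0 hF, ← multiIntegral_const_mul]
  simp only [Fin.succAbove_zero]
  refine multiIntegral_congr fun v hv => ?_
  set u : Fin (n + 1) → ℂ := Fin.insertNth 0 0 v with hu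
  have hus : ∀ i : Fin n, u i.succ = v i := fun i => by
    rw [hu, ← Fin.succAbove_zero, Fin.insertNth_apply_succAbove]
  have husB : ∀ B : Fin (n + 1), 0 < B → u B ∈ (Γ B).support := by
    intro B hB
    obtain ⟨i, rfl⟩ := Fin.exists_succ_eq.2 hB.ne'
    rw [hus]
    exact hv i
  have hins : ∀ a, (Fin.insertNth 0 a v : Fin (n + 1) → ℂ) = Function.update u 0 a := fun a => by
    rw [hu, Fin.update_insertNth]
  set g : ℂ → ℂ := fun a => timeFactor τ κ a ^ t * spaceFactor τ a ^ y *
    ∏ B ∈ Finset.univ.erase 0, cross τ 0 B a (u B) with hg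
  set S : Set ℂ := {p | p = -κ⁻¹ ∨ (y < 0 ∧ p = -1) ∨ ∃ B, 0 < B ∧ p = τ * u B} with hS
  have hSex : ∀ p ∈ S, (Γ 0).Excludes p := by
    rintro p (rfl | ⟨h1, rfl⟩ | ⟨B, hB, rfl⟩)
    · exact h_kappa
    · exact h_one h1
    · exact h_cross B hB _ (husB B hB)
  have hgS : RatOn S g := by
    refine ((RatOn.pow (ratOn_timeFactor hκ (Or.inl rfl)) t).mul ?_).mul ?_
    · obtain ⟨m, rfl⟩ := Int.exists_eq_neg_ofNat hy
      rcases Nat.eq_zero_or_pos m with rfl | hm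
      · simpa using RatOn.const S 1
      · have := (ratOn_spaceFactor_inv (τ := τ) (S := S)
          (Or.inr (Or.inl ⟨by simpa using hm, rfl⟩))).pow m
        simpa using this
    · exact ratOn_prod_cross hτ (Finset.notMem_erase 0 _) fun B hB =>
        ⟨fun h0 => absurd h0 (not_lt.2 (Fin.zero_le B)), fun h0 => Or.inr (Or.inr ⟨B, h0, rfl⟩)⟩
  have h0S : (0 : ℂ) ∉ S := fun h0 => by
    have := (hSex 0 h0).2
    rw [(h_zero 0).2] at this
    exact one_ne_zero this
  have key := hgS.sum_integral_div_sub h0S ({()} : Finset Unit) (fun _ => 1) (fun _ => Γ 0)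
    (fun _ _ a ha => (hSex a ha).1) (fun _ _ => (h_zero 0).1)
    (fun a ha => by simpa using (hSex a ha).2)
  simp only [Finset.sum_singleton, one_mul, (h_zero 0).2, mul_one, sub_zero] at key
  have hg0 : g 0 = τ⁻¹ ^ n := by
    have : ∀ B ∈ Finset.univ.erase (0 : Fin (n + 1)), cross τ 0 B 0 (u B) = τ⁻¹ := by
      intro B hB
      have hB : 0 < B := Fin.pos_iff_ne_zero.2 (Finset.ne_of_mem_erase hB)
      have hu0 : u B ≠ 0 := fun h0 => (h_zero B).1 (h0 ▸ husB B hB)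
      rw [cross, if_pos hB]
      field_simp
      ring
    simp only [hg]
    rw [Finset.prod_congr rfl this]
    simp [timeFactor, spaceFactor]
  simp only [hins, nested_update, hh]
  rw [Contour.integral_const_mul, nested_map_succ]
  simp only [hus]
  have : (Γ 0).integral (fun a => oneBody τ κ t y a *
      ∏ B ∈ Finset.univ.erase 0, cross τ 0 B a (u B)) = (Γ 0).integral (fun a => g a / a) := by
    refine Contour.integral_congr _ fun a _ => ?_
    simp only [hg, oneBody]
    ring
  rw [this, key, hg0]
  ring

/-- For nonpositive `x` the integral is evaluated by taking residues at `0` successively. -/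
theorem multiIntegral_oneBody_of_nonpos (hτ : τ ≠ 0) (hκ : κ ≠ 0) (t : ℕ) {x : ℤ} (hx : x ≤ 0) :
    ∀ {L : ℕ} (Γ : Fin L → Contour), (∀ A, (Γ A).Includes 0) → (∀ A, (Γ A).Excludes (-κ⁻¹)) →
    (∀ A B, A < B → ∀ u ∈ (Γ B).support, (Γ A).Excludes (τ * u)) →
    (x < 0 → ∀ A, (Γ A).Excludes (-1)) →
    τ ^ (L * (L - 1) / 2) * multiIntegral Γ (nested τ (fun _ => oneBody τ κ t x) Finset.univ) =
      (2 * Real.pi * Complex.I) ^ L := by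
  intro L
  induction L with
  | zero =>
    intro Γ _ _ _ _
    simp [multiIntegral_fin_zero, nested]
  | succ n ih =>
    intro Γ h_zero h_kappa h_cross h_one
    have hsep : Separated τ Γ := fun A B hAB a ha b hb hab =>
      (h_cross A B hAB b hb).1 (hab ▸ ha)
    have hcont : ∀ A, ContinuousOn (oneBody τ κ t x) (Γ A).support := by
      intro A
      obtain ⟨m, rfl⟩ := Int.exists_eq_neg_ofNat hx
      have h1 : ContinuousOn (timeFactor τ κ) (Γ A).support :=
        (ratOn_timeFactor (S := {-κ⁻¹}) hκ rfl).continuousOn.mono fun u hu hu' =>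
          (h_kappa A).1 (by rw [← Set.mem_singleton_iff.1 hu']; exact hu)
      refine ContinuousOn.div ((h1.pow t).mul ?_) continuousOn_id fun u hu h0 =>
        (h_zero A).1 (h0 ▸ hu)
      rcases Nat.eq_zero_or_pos m with rfl | hm
      · simpa using continuousOn_const
      · have h2 : ContinuousOn (fun u => (spaceFactor τ u)⁻¹) (Γ A).support :=
          (ratOn_spaceFactor_inv (S := {-1}) rfl).continuousOn.mono fun u hu hu' =>
            (h_one (by simpa using hm) A).1 (by rw [← Set.mem_singleton_iff.1 hu']; exact hu)
        simpa [Pi.pow_def] using h2.pow m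
    rw [multiIntegral_nested_of_nonpos hτ hκ hx rfl h_zero (h_kappa 0)
      (fun B hB => h_cross 0 B hB) (fun h => h_one h 0) (continuousOn_nested hsep hcont)]
    have := ih (fun i => Γ i.succ) (fun A => h_zero _) (fun A => h_kappa _)
      (fun A B hAB => h_cross _ _ (Fin.succ_lt_succ_iff.2 hAB)) (fun h A => h_one h _)
    rw [pow_succ, ← this]
    have hexp : (n + 1) * (n + 1 - 1) / 2 = n * (n - 1) / 2 + n := by
      rw [← Nat.triangle_succ]
    have hpow : τ ^ n * τ⁻¹ ^ n = 1 := by rw [← mul_pow, mul_inv_cancel₀ hτ, one_pow]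
    rw [hexp, pow_add]
    linear_combination (τ ^ (n * (n - 1) / 2) * (2 * Real.pi * Complex.I) * multiIntegral
      (fun i => Γ i.succ) (nested τ (fun _ => oneBody τ κ t x) Finset.univ)) * hpow

end OneBody

end SixVertex

namespace SixVertex

/-! ### Dumbbells: small circles around `0` and `-τ` -/

/-- The union of a circle around `0` and a circle around `-τ`. -/
noncomputable def dumbbell (τ r ρ : ℝ) : Contour :=
  (Contour.circle 0 r).union (Contour.circle (-(τ : ℂ)) ρ)

section Dumbbell

variable {τ r ρ : ℝ} {p : ℂ}

theorem mem_support_dumbbell (hr : 0 < r) (hρ : 0 < ρ) :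
    p ∈ (dumbbell τ r ρ).support ↔ ‖p‖ = r ∨ ‖p + τ‖ = ρ := by
  rw [dumbbell, Contour.support_union, Set.mem_union, Contour.mem_support_circle hr,
    Contour.mem_support_circle hρ, sub_zero, sub_neg_eq_add]

theorem winding_dumbbell_of_far (hρ : 0 < ρ) (h : ρ < ‖p + τ‖) :
    (dumbbell τ r ρ).winding p = (Contour.circle 0 r).winding p := by
  rw [dumbbell, Contour.winding_union, Contour.winding_circle_of_notMem hρ (a := p)
    (by rwa [sub_neg_eq_add]), add_zero]

theorem winding_dumbbell_of_near (h : ‖p + τ‖ < ρ) :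
    (dumbbell τ r ρ).winding p = (Contour.circle 0 r).winding p + 1 := by
  rw [dumbbell, Contour.winding_union, Contour.winding_circle_of_mem (a := p) (c := -(τ : ℂ))
    (by rwa [sub_neg_eq_add])]

theorem winding_circle_zero_of_lt (h : ‖p‖ < r) : (Contour.circle 0 r).winding p = 1 :=
  Contour.winding_circle_of_mem (by rwa [sub_zero])

theorem winding_circle_zero_of_gt (hr : 0 < r) (h : r < ‖p‖) :
    (Contour.circle 0 r).winding p = 0 :=
  Contour.winding_circle_of_notMem hr (by rwa [sub_zero])

end Dumbbell

theorem sub_le_norm_add_add_norm_add (p : ℂ) (c d : ℝ) : c - d ≤ ‖p + c‖ + ‖p + d‖ := by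
  have h : ‖((c - d : ℝ) : ℂ)‖ ≤ ‖p + c‖ + ‖p + d‖ := by
    have : ((c - d : ℝ) : ℂ) = (p + c) - (p + d) := by push_cast; ring
    rw [this]
    exact norm_sub_le _ _
  rw [Complex.norm_real, Real.norm_eq_abs] at h
  exact (le_abs_self _).trans h

theorem le_norm_add_norm_add (p : ℂ) (c : ℝ) : c ≤ ‖p‖ + ‖p + c‖ := by
  have := sub_le_norm_add_add_norm_add p c 0
  simp only [sub_zero, Complex.ofReal_zero, add_zero] at this
  linarith

/-- The parameters, and a length `δ` that is small compared with the distances between the points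
`0`, `-τ²`, `-τ`, `-1`, `-κ⁻¹`. -/
structure Scale (τ κ δ : ℝ) : Prop where
  tau_pos : 0 < τ
  tau_lt : τ < 1
  kappa_pos : 0 < κ
  pos : 0 < δ
  lt_sq : 4 * δ < τ ^ 2
  lt_mul : 4 * δ < τ * (1 - τ)
  lt_kappa : 4 * δ < κ⁻¹ - 1

namespace Scale

variable {τ κ δ : ℝ}

theorem four_lt_tau (hs : Scale τ κ δ) : 4 * δ < τ := by
  have := hs.lt_sq
  nlinarith [hs.tau_pos, hs.tau_lt]

theorem four_lt_one_sub (hs : Scale τ κ δ) : 4 * δ < 1 - τ := by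
  have := hs.lt_mul
  nlinarith [hs.tau_pos, hs.tau_lt]

theorem tau_mul_lt (hs : Scale τ κ δ) : τ * δ < δ := by
  nlinarith [hs.tau_pos, hs.tau_lt, hs.pos]

theorem tau_mul_pos (hs : Scale τ κ δ) : 0 < τ * δ := mul_pos hs.tau_pos hs.pos

theorem tau_ne_zero (hs : Scale τ κ δ) : (τ : ℂ) ≠ 0 := by exact_mod_cast hs.tau_pos.ne'

theorem kappa_ne_zero (hs : Scale τ κ δ) : (κ : ℂ) ≠ 0 := by exact_mod_cast hs.kappa_pos.ne'

theorem norm_tau_mul (hs : Scale τ κ δ) (u : ℂ) : ‖(τ : ℂ) * u‖ = τ * ‖u‖ := by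
  rw [norm_mul, Complex.norm_of_nonneg hs.tau_pos.le]

theorem norm_div_tau (hs : Scale τ κ δ) (u : ℂ) : ‖u / (τ : ℂ)‖ = ‖u‖ / τ := by
  rw [norm_div, Complex.norm_of_nonneg hs.tau_pos.le]

theorem norm_tau_mul_add (hs : Scale τ κ δ) (u c : ℂ) : ‖(τ : ℂ) * u + τ * c‖ = τ * ‖u + c‖ := by
  rw [← mul_add, hs.norm_tau_mul]

theorem norm_tau_mul_add_tau (hs : Scale τ κ δ) (u : ℂ) : ‖(τ : ℂ) * u + τ‖ = τ * ‖u + 1‖ := by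
  rw [← hs.norm_tau_mul_add, mul_one]

theorem norm_div_tau_add_one (hs : Scale τ κ δ) (u : ℂ) : ‖u / (τ : ℂ) + 1‖ = ‖u + τ‖ / τ := by
  rw [← hs.norm_div_tau, add_div, div_self hs.tau_ne_zero]

end Scale

/-- Radii of circles around `0` for nested contours: the image of a later circle under
multiplication by `τ` encloses every earlier circle. -/
structure Radii {L : ℕ} (τ δ : ℝ) (r : Fin L → ℝ) : Prop where
  pos : ∀ A, 0 < r A
  le : ∀ A, r A ≤ δ
  lt : ∀ A B, A < B → r A < τ * r B

section NoWindingAtMinusOne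

variable {τ κ δ : ℝ} {L : ℕ}

theorem RatOn.integral_circle_neg_one {f : ℂ → ℂ} {σ : ℝ} (hσ : 0 < σ)
    {S : Set ℂ} (hf : RatOn S f) (hS : ∀ p ∈ S, σ < ‖p + 1‖) :
    (Contour.circle (-1) σ).integral f = 0 := by
  have := hf.sum_integral_eq_zero {()} (fun _ => 1) (fun _ => Contour.circle (-1) σ)
    (fun _ _ a ha h => by
      rw [Contour.mem_support_circle hσ, sub_neg_eq_add] at h
      exact (hS a ha).ne' h)
    (fun a ha => by
      rw [Finset.sum_singleton, Contour.winding_circle_of_notMem hσ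
        (by rw [sub_neg_eq_add]; exact hS a ha), mul_zero])
  simpa using this

theorem basePoles_far (hs : Scale τ κ δ) {p : ℂ} (hp : p ∈ basePoles (τ : ℂ) κ) :
    4 * δ < ‖p + 1‖ := by
  have h1 := hs.four_lt_one_sub
  have h2 := hs.pos
  have h3 := hs.lt_kappa
  have h4 := hs.tau_pos
  simp only [basePoles, Set.mem_insert_iff, Set.mem_singleton_iff] at hp
  rcases hp with rfl | rfl | rfl
  · simp; linarith
  · have := sub_le_norm_add_add_norm_add (-(τ : ℂ)) 1 τ
    simp at this
    linarith
  · have := sub_le_norm_add_add_norm_add (-(κ : ℂ)⁻¹) κ⁻¹ 1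
    simp at this
    linarith

end NoWindingAtMinusOne

end SixVertex

namespace SixVertex

/-! ### The winding around `-1` is irrelevant -/

section NoWindingAtMinusOne

variable {τ κ δ : ℝ} {L : ℕ}

/-- The point `u` keeps the distance `δ` from `-1`, and `τ u` from `0` and `-1`. -/
def Clear (τ δ : ℝ) (u : ℂ) : Prop := δ < ‖u + 1‖ ∧ δ < ‖τ * u + 1‖ ∧ δ < ‖τ * u‖

/-- For a pole `u_A = τ b` of the variable `u_A`, with `b` near `-1`, the cross factors of `u_A` and
of `u_j = b` with a third variable have a product without poles near `b = -1`. -/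
theorem exists_ratOn_cross_mul_cross (hs : Scale τ κ δ) {r : Fin L → ℝ} (hr : Radii τ δ r)
    {A j B : Fin L} (hAj : A < j) (hBA : B ≠ A) (hBj : B ≠ j) {σ ρ : ℝ} (hσδ : σ < δ)
    (hρ : 0 < ρ) (hρle : ρ ≤ τ * δ) (hρσ : ρ ≠ τ * σ) {u : ℂ}
    (hu : B < j → ‖u‖ = r B ∨ ‖u + τ‖ = ρ) (hu' : j < B → Clear τ δ u) :
    ∃ g, RatOn {p | δ < ‖p + 1‖} g ∧ ∀ b, ‖b + 1‖ = σ →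
      cross (τ : ℂ) A B (τ * b) u * cross (τ : ℂ) j B b u = g b := by
  have hτ := hs.tau_ne_zero
  have h1 := hs.four_lt_one_sub
  have h2 := hs.pos
  have h3 := hs.tau_pos
  have h4 := hs.four_lt_tau
  have h5 := hs.tau_mul_lt
  have h6 := hs.lt_sq
  have h7 := hs.lt_mul
  rcases hBj.lt_or_gt with hlt | hlt
  · -- `u` is on a dumbbell: it differs from `τ b` and from `b`
    have hub : ∀ b : ℂ, ‖b + 1‖ = σ → u - τ * b ≠ 0 ∧ b - u ≠ 0 := by
      intro b hb
      have hτb : ‖(τ : ℂ) * b + τ‖ = τ * σ := by rw [hs.norm_tau_mul_add_tau, hb]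
      constructor
      · intro h0
        rw [← sub_eq_zero.1 h0] at hτb
        rcases hu hlt with h | h
        · have := le_norm_add_norm_add u τ
          have := hr.le B
          nlinarith
        · exact hρσ (h.symm.trans hτb)
      · intro h0
        rw [sub_eq_zero.1 h0] at hb
        rcases hu hlt with h | h
        · have := le_norm_add_norm_add u 1
          have := hr.le B
          push_cast at *
          linarith
        · have := sub_le_norm_add_add_norm_add u 1 τ
          push_cast at *
          linarith
    rcases hBA.lt_or_gt with hlt' | hlt'
    · refine ⟨fun b => (u - b) / (-(τ : ℂ) ^ 2 * b + u), ?_, fun b hb => ?_⟩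
      · refine RatOn.div_linear ((RatOn.const _ u).sub (RatOn.id _)) (fun p hp => ?_)
          (Or.inl (neg_ne_zero.2 (pow_ne_zero 2 hτ)))
        have hpu : u + ((τ ^ 2 : ℝ) : ℂ) = (τ : ℂ) * (τ * p + τ * 1) := by
          push_cast
          linear_combination hp
        have hnorm : ‖u + ((τ ^ 2 : ℝ) : ℂ)‖ = τ * (τ * ‖p + 1‖) := by
          rw [hpu, hs.norm_tau_mul, hs.norm_tau_mul_add]
        rw [Set.mem_ofPred_eq]
        rcases hu hlt with h | h
        · have e1 := le_norm_add_norm_add u (τ ^ 2)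
          have e2 := hr.lt B A hlt'
          have e3 := hr.lt A j hAj
          have e4 := hr.le j
          rw [hnorm, h] at e1
          by_contra! hle
          have : τ * (τ * ‖p + 1‖) ≤ τ * (τ * δ) := by gcongr
          nlinarith
        · have e1 := sub_le_norm_add_add_norm_add u τ (τ ^ 2)
          rw [hnorm, h] at e1
          by_contra! hle
          have : τ * (τ * ‖p + 1‖) ≤ τ * (τ * δ) := by gcongr
          nlinarith
      · obtain ⟨hne, hne'⟩ := hub b hb
        rw [cross, if_neg hlt'.not_gt, cross, if_neg hlt.not_gt]
        have : -(τ : ℂ) ^ 2 * b + u = u - τ * (τ * b) := by ring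
        beta_reduce
        rw [this, mul_comm, div_mul_div_comm, mul_comm (u - τ * b), mul_div_mul_right _ _ hne]
    · refine ⟨fun _ => (τ : ℂ)⁻¹, RatOn.const _ _, fun b hb => ?_⟩
      obtain ⟨hne, hne'⟩ := hub b hb
      rw [cross, if_pos hlt', cross, if_neg hlt.not_gt]
      have : (τ : ℂ) * b - τ * u = τ * (b - u) := by ring
      rw [this]
      field_simp
      ring
  · obtain ⟨hc1, hc2, hc3⟩ := hu' hlt
    refine ⟨fun b => (τ * b - u) / τ / (1 * b + -(τ * u)), ?_, fun b hb => ?_⟩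
    · refine RatOn.div_linear ?_ (fun p hp => ?_) (Or.inl one_ne_zero)
      · simpa [div_eq_mul_inv] using
          (((RatOn.const _ (τ : ℂ)).mul (RatOn.id _)).sub (RatOn.const _ u)).mul
            (RatOn.const _ (τ : ℂ)⁻¹)
      · have : p = τ * u := by linear_combination hp
        rw [this]
        exact hc2
    · have hne : b - u ≠ 0 := fun h0 => by
        rw [sub_eq_zero.1 h0] at hb
        linarith
      rw [cross, if_pos (hAj.trans hlt), cross, if_pos hlt]
      have e1 : (τ : ℂ) * b - τ * u = τ * (b - u) := by ring
      have e2 : 1 * b + -(τ * u) = b - τ * u := by ring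
      beta_reduce
      rw [e1, e2]
      field_simp

/-- The circle around `-τ` in the contour of `u_A` can be enlarged past `τ u_j`, for `u_j` on a
circle around `-1` and `A < j`: the residue at `u_A = τ u_j` has no poles in `u_j` near `-1`. -/
theorem multiIntegral_eq_enlarge (hs : Scale τ κ δ) {r : Fin L → ℝ} (hr : Radii τ δ r)
    {A j : Fin L} (hAj : A < j) {ρ : Fin L → ℝ} {σ : ℝ} (hσ : 0 < σ) (hσδ : σ < δ)
    (hρ : ∀ B < j, 0 < ρ B ∧ ρ B ≤ τ * δ ∧ ρ B ≠ τ * σ) (hρA : ρ A < τ * σ)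
    {Γ : Fin L → Contour} (hΓ : ∀ B < j, Γ B = dumbbell τ (r B) (ρ B))
    (hΓj : Γ j = Contour.circle (-1) σ)
    (hΓ' : ∀ B, j < B → ∀ u ∈ (Γ B).support, Clear τ δ u)
    {h : Fin L → ℂ → ℂ} (hh : RatOn (basePoles (τ : ℂ) κ) (h A))
    (hreg : ∃ g, RatOn {p | δ < ‖p + 1‖} g ∧
      ∀ b, b ≠ -1 → ‖b + 1‖ ≤ δ → h A (τ * b) * h j b = g b)
    (hF : ContinuousOn (nested (τ : ℂ) h Finset.univ) (multiSupport Γ))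
    (hF' : ContinuousOn (nested (τ : ℂ) h Finset.univ)
      (multiSupport (Function.update Γ A (dumbbell τ (r A) (τ * δ))))) :
    multiIntegral Γ (nested (τ : ℂ) h Finset.univ) =
      multiIntegral (Function.update Γ A (dumbbell τ (r A) (τ * δ)))
        (nested (τ : ℂ) h Finset.univ) := by
  have hτ := hs.tau_ne_zero
  have h1 := hs.four_lt_one_sub
  have h2 := hs.pos
  have h3 := hs.tau_pos
  have h4 := hs.four_lt_tau
  have h5 := hs.tau_mul_lt
  have h6 := hs.lt_sq
  have h7 := hs.lt_mul
  have h8 := hs.lt_kappa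
  have h9 := hs.tau_mul_pos
  have hτσ : τ * σ < τ * δ := by gcongr
  refine multiIntegral_eq_update_of_two hAj.ne _ hF hF' fun u hu => ?_
  set R : Finset (Fin L) := (Finset.univ.erase A).erase j with hR
  have hRmem : ∀ B ∈ R, B ≠ A ∧ B ≠ j := fun B hB =>
    ⟨Finset.ne_of_mem_erase (Finset.mem_of_mem_erase hB), Finset.ne_of_mem_erase hB⟩
  have husmall : ∀ B ∈ R, B < j → ‖u B‖ = r B ∨ ‖u B + τ‖ = ρ B := by
    intro B hB hlt
    have := hu B (hRmem B hB).1 (hRmem B hB).2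
    rw [hΓ B hlt] at this
    exact (mem_support_dumbbell (hr.pos B) (hρ B hlt).1).1 this
  have hularge : ∀ B ∈ R, j < B → Clear τ δ (u B) := fun B hB hlt =>
    hΓ' B hlt _ (hu B (hRmem B hB).1 (hRmem B hB).2)
  -- the poles of `u_A` other than `τ u_j`: both contours wind around them in the same way
  set S : Set ℂ := {p | p ∈ basePoles (τ : ℂ) κ ∨
    ∃ B ∈ R, (B < A ∧ p = u B / τ) ∨ (A < B ∧ p = τ * u B)} with hS
  have hSp : ∀ p ∈ S, p = -(τ : ℂ) ∨ (‖p‖ ≠ r A ∧ τ * δ < ‖p + τ‖) := by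
    have hrA := hr.le A
    have hrA' := hr.pos A
    rintro p (hp | ⟨B, hB, ⟨hlt, rfl⟩ | ⟨hlt, rfl⟩⟩)
    · simp only [basePoles, Set.mem_insert_iff, Set.mem_singleton_iff] at hp
      rcases hp with rfl | rfl | rfl
      · right
        refine ⟨by simpa using hrA'.ne, ?_⟩
        rw [zero_add, Complex.norm_of_nonneg h3.le]
        linarith
      · exact Or.inl rfl
      · right
        have e1 := sub_le_norm_add_add_norm_add (-(κ : ℂ)⁻¹) κ⁻¹ τ
        have e2 : ‖-(κ : ℂ)⁻¹‖ = κ⁻¹ := by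
          rw [norm_neg, norm_inv, Complex.norm_of_nonneg hs.kappa_pos.le]
        rw [e2]
        simp only [Complex.ofReal_inv, neg_add_cancel, norm_zero, zero_add] at e1
        exact ⟨by linarith, by linarith⟩
    · right
      have hBj := hlt.trans hAj
      have e0 := hr.lt B A hlt
      rcases husmall B hB hBj with e | e
      · have e1 : ‖u B / (τ : ℂ)‖ < r A := by
          rw [hs.norm_div_tau, e, div_lt_iff₀ h3]; linarith
        have e2 := le_norm_add_norm_add (u B / (τ : ℂ)) τ
        exact ⟨e1.ne, by linarith⟩
      · have e1 : ‖u B / (τ : ℂ) + 1‖ ≤ δ := by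
          rw [hs.norm_div_tau_add_one, e, div_le_iff₀ h3]
          linarith [(hρ B hBj).2.1]
        have e2 := le_norm_add_norm_add (u B / (τ : ℂ)) 1
        have e3 := sub_le_norm_add_add_norm_add (u B / (τ : ℂ)) 1 τ
        push_cast at e2 e3
        exact ⟨by linarith, by linarith⟩
    · right
      rcases (hRmem B hB).2.lt_or_gt with hBj | hBj
      · have e0 := hr.lt A B hlt
        rcases husmall B hB hBj with e | e
        · have e1 : ‖(τ : ℂ) * u B‖ = τ * r B := by rw [hs.norm_tau_mul, e]
          have e2 := le_norm_add_norm_add ((τ : ℂ) * u B) τ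
          have e3 : τ * r B ≤ τ * δ := by have := hr.le B; gcongr
          exact ⟨by linarith, by linarith⟩
        · have e1 : ‖(τ : ℂ) * u B + ((τ ^ 2 : ℝ) : ℂ)‖ = τ * ρ B := by
            rw [← e, ← hs.norm_tau_mul]; push_cast; ring_nf
          have e2 := le_norm_add_norm_add ((τ : ℂ) * u B) (τ ^ 2)
          have e3 := sub_le_norm_add_add_norm_add ((τ : ℂ) * u B) τ (τ ^ 2)
          have e4 : τ * ρ B ≤ 1 * δ := by
            have := (hρ B hBj).2.1
            have := (hρ B hBj).1
            apply mul_le_mul <;> linarith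
          rw [e1] at e2 e3
          exact ⟨by linarith, by nlinarith⟩
      · obtain ⟨hc1, hc2, hc3⟩ := hularge B hB hBj
        refine ⟨by linarith, ?_⟩
        rw [hs.norm_tau_mul_add_tau]
        gcongr
  have hfS : RatOn S (fun a => h A a * ∏ B ∈ R, cross (τ : ℂ) A B a (u B)) := by
    refine (hh.mono fun p hp => Or.inl hp).mul (ratOn_prod_cross hτ ?_ fun B hB => ⟨fun hlt => ?_,
      fun hlt => ?_⟩)
    · simp [hR]
    · exact Or.inr ⟨B, hB, Or.inl ⟨hlt, rfl⟩⟩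
    · exact Or.inr ⟨B, hB, Or.inr ⟨hlt, rfl⟩⟩
  have hAs := hΓ A hAj
  obtain ⟨hρ0, hρ1, -⟩ := hρ A hAj
  rw [hAs, hΓj]
  set K := nested (τ : ℂ) h R u with hK
  -- the difference of the integrals over `u_A` is a residue at `τ u_j`
  have hdiff : ∀ b : ℂ, ‖b + 1‖ = σ →
      ((dumbbell τ (r A) (ρ A)).integral fun a => nested (τ : ℂ) h Finset.univ
        (Function.update (Function.update u j b) A a)) -
      ((dumbbell τ (r A) (τ * δ)).integral fun a => nested (τ : ℂ) h Finset.univ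
        (Function.update (Function.update u j b) A a)) =
      -(2 * Real.pi * Complex.I) * K * ((h j b * ∏ B ∈ R, cross (τ : ℂ) j B b (u B)) *
        ((h A (τ * b) * ∏ B ∈ R, cross (τ : ℂ) A B (τ * b) (u B)) * (τ * b - b))) := by
    intro b hb
    have hτb : ‖(τ : ℂ) * b + τ‖ = τ * σ := by rw [hs.norm_tau_mul_add_tau, hb]
    have hτb' := le_norm_add_norm_add ((τ : ℂ) * b) τ
    have hrA := hr.le A
    have hrA' := hr.pos A
    have hbS : (τ : ℂ) * b ∉ S := by
      intro hmem
      rcases hSp _ hmem with h0 | ⟨-, h0⟩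
      · rw [h0, neg_add_cancel, norm_zero] at hτb
        exact (mul_pos h3 hσ).ne hτb
      · linarith
    have hfb := hfS.mul ((RatOn.id S).sub (RatOn.const S b))
    have key := hfb.sum_integral_div_sub hbS Finset.univ ![(1 : ℂ), -1]
      ![dumbbell τ (r A) (ρ A), dumbbell τ (r A) (τ * δ)]
      (by
        intro i _ a ha hmem
        fin_cases i
        · rcases (mem_support_dumbbell (hr.pos A) hρ0).1 hmem with h0 | h0 <;>
            rcases hSp a ha with rfl | ⟨h0', h0''⟩
          · rw [norm_neg, Complex.norm_of_nonneg h3.le] at h0; linarith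
          · exact h0' h0
          · rw [neg_add_cancel, norm_zero] at h0; exact hρ0.ne h0
          · linarith
        · rcases (mem_support_dumbbell (hr.pos A) h9).1 hmem with h0 | h0 <;>
            rcases hSp a ha with rfl | ⟨h0', h0''⟩
          · rw [norm_neg, Complex.norm_of_nonneg h3.le] at h0; linarith
          · exact h0' h0
          · rw [neg_add_cancel, norm_zero] at h0; exact h9.ne h0
          · linarith)
      (by
        intro i _ hmem
        fin_cases i
        · rcases (mem_support_dumbbell (hr.pos A) hρ0).1 hmem with h0 | h0 <;> linarith
        · rcases (mem_support_dumbbell (hr.pos A) h9).1 hmem with h0 | h0 <;> linarith)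
      (by
        intro a ha
        simp only [Fin.sum_univ_two, Matrix.cons_val_zero, Matrix.cons_val_one]
        rcases hSp a ha with rfl | ⟨-, h0⟩
        · rw [winding_dumbbell_of_near (by simpa using hρ0),
            winding_dumbbell_of_near (by simpa using h9)]
          ring
        · rw [winding_dumbbell_of_far hρ0 (by linarith), winding_dumbbell_of_far h9 h0]
          ring)
    simp only [Fin.sum_univ_two, Matrix.cons_val_zero, Matrix.cons_val_one] at key
    rw [winding_dumbbell_of_far hρ0 (p := (τ : ℂ) * b) (by rw [hτb]; exact hρA),
      winding_dumbbell_of_near (p := (τ : ℂ) * b) (ρ := τ * δ) (by rw [hτb]; exact hτσ)] at key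
    have hX : ∀ c : Contour, (c.integral fun a => nested (τ : ℂ) h Finset.univ
        (Function.update (Function.update u j b) A a)) =
        K * (h j b * ∏ B ∈ R, cross (τ : ℂ) j B b (u B)) *
          c.integral fun a => (h A a * ∏ B ∈ R, cross (τ : ℂ) A B a (u B)) * (a - b) /
            (a - τ * b) := by
      intro c
      rw [← Contour.integral_const_mul]
      refine c.integral_congr fun a _ => ?_
      rw [nested_update_update h hAj.ne, cross, if_pos hAj]
      ring
    rw [hX, hX]
    linear_combination K * (h j b * ∏ B ∈ R, cross (τ : ℂ) j B b (u B)) * key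
  obtain ⟨g, hg, hgb⟩ := hreg
  have hcr : ∀ B : Fin L, ∃ gB : ℂ → ℂ, B ∈ R → RatOn {p | δ < ‖p + 1‖} gB ∧ ∀ b, ‖b + 1‖ = σ →
      cross (τ : ℂ) A B (τ * b) (u B) * cross (τ : ℂ) j B b (u B) = gB b := by
    intro B
    by_cases hB : B ∈ R
    · by_cases hBj : B < j
      · obtain ⟨e1, e2, e3⟩ := hρ B hBj
        obtain ⟨gB, hgB⟩ := exists_ratOn_cross_mul_cross hs hr hAj (hRmem B hB).1 (hRmem B hB).2
          hσδ e1 e2 e3 (husmall B hB) (hularge B hB)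
        exact ⟨gB, fun _ => hgB⟩
      · obtain ⟨gB, hgB⟩ := exists_ratOn_cross_mul_cross hs hr hAj (hRmem B hB).1 (hRmem B hB).2
          hσδ hρ0 hρ1 hρA.ne (fun h0 => absurd h0 hBj) (hularge B hB)
        exact ⟨gB, fun _ => hgB⟩
    · exact ⟨0, fun h0 => absurd h0 hB⟩
  choose G hG using hcr
  rw [Contour.integral_congr (g := fun b => -(2 * Real.pi * Complex.I) * K *
    (g b * (∏ B ∈ R, G B b) * (τ * b - b)))]
  · refine RatOn.integral_circle_neg_one hσ (S := {p | δ < ‖p + 1‖}) ?_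
      fun p hp => hσδ.trans hp
    refine (RatOn.const _ _).mul ((hg.mul (RatOn.prod _ fun B hB => (hG B hB).1)).mul ?_)
    exact ((RatOn.const _ _).mul (RatOn.id _)).sub (RatOn.id _)
  · intro b hb
    rw [Contour.mem_support_circle hσ, sub_neg_eq_add] at hb
    rw [hdiff b hb, ← hgb b (fun h0 => by simp [h0] at hb; exact hσ.ne hb) (by linarith),
      ← Finset.prod_congr rfl fun B hB => (hG B hB).2 b hb, Finset.prod_mul_distrib]
    ring

end NoWindingAtMinusOne

end SixVertex

namespace SixVertex

section NoWindingAtMinusOne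

variable {τ κ δ : ℝ} {L : ℕ}

theorem notMem_dumbbell_of_basePoles (hs : Scale τ κ δ) {r ρ : ℝ} (hr : 0 < r) (hrδ : r ≤ δ)
    (hρ : 0 < ρ) (hρδ : ρ ≤ τ * δ) {p : ℂ} (hp : p ∈ basePoles (τ : ℂ) κ) :
    p ∉ (dumbbell τ r ρ).support := by
  have h1 := hs.four_lt_tau
  have h2 := hs.pos
  have h3 := hs.tau_pos
  have h5 := hs.tau_mul_lt
  have h6 := hs.lt_kappa
  have h7 := hs.tau_lt
  rw [mem_support_dumbbell hr hρ]
  simp only [basePoles, Set.mem_insert_iff, Set.mem_singleton_iff] at hp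
  rcases hp with rfl | rfl | rfl
  · rw [zero_add, norm_zero, Complex.norm_of_nonneg h3.le]
    rintro (h | h) <;> linarith
  · rw [neg_add_cancel, norm_zero, norm_neg, Complex.norm_of_nonneg h3.le]
    rintro (h | h) <;> linarith
  · have e1 := sub_le_norm_add_add_norm_add (-(κ : ℂ)⁻¹) κ⁻¹ τ
    have e2 : ‖-(κ : ℂ)⁻¹‖ = κ⁻¹ := by
      rw [norm_neg, norm_inv, Complex.norm_of_nonneg hs.kappa_pos.le]
    simp only [Complex.ofReal_inv, neg_add_cancel, norm_zero, zero_add] at e1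
    rw [e2]
    rintro (h | h) <;> linarith

theorem ne_tau_mul_of_dumbbell (hs : Scale τ κ δ) {r r' ρ ρ' : ℝ} (hrδ : r ≤ δ)
    (hr' : r' ≤ δ) (hrr : r < τ * r') (hρ : ρ ≤ τ * δ) (hρ' : ρ' ≤ τ * δ)
    {a b : ℂ} (ha : ‖a‖ = r ∨ ‖a + τ‖ = ρ) (hb : ‖b‖ = r' ∨ ‖b + τ‖ = ρ') : a ≠ τ * b := by
  have h1 := hs.four_lt_tau
  have h2 := hs.pos
  have h3 := hs.tau_pos
  have h4 := hs.lt_sq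
  have h5 := hs.tau_mul_lt
  have h6 := hs.lt_mul
  rintro rfl
  rcases hb with hb | hb
  · have e1 : ‖(τ : ℂ) * b‖ = τ * r' := by rw [hs.norm_tau_mul, hb]
    have e2 := le_norm_add_norm_add ((τ : ℂ) * b) τ
    have e3 : τ * r' ≤ τ * δ := by gcongr
    rcases ha with ha | ha <;> linarith
  · have e1 : ‖(τ : ℂ) * b + ((τ ^ 2 : ℝ) : ℂ)‖ = τ * ρ' := by
      rw [← hb, ← hs.norm_tau_mul]; push_cast; ring_nf
    have e2 := le_norm_add_norm_add ((τ : ℂ) * b) (τ ^ 2)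
    have e3 := sub_le_norm_add_add_norm_add ((τ : ℂ) * b) τ (τ ^ 2)
    have e4 : τ * ρ' ≤ δ := by
      have e5 : τ * ρ' ≤ τ * (τ * δ) := by gcongr
      have e6 : τ * (τ * δ) ≤ τ * δ := by gcongr
      linarith
    rw [e1] at e2 e3
    rcases ha with ha | ha <;> nlinarith

/-- If the variable `j` runs over a small circle around `-1` and the variables before it over
dumbbells, then the contours avoid all poles. -/
theorem continuousOn_nested_of_circle_neg_one (hs : Scale τ κ δ) {r : Fin L → ℝ}
    (hr : Radii τ δ r) {j : Fin L} {R : Fin L → ℝ} {σ : ℝ} (hσ : 0 < σ) (hσδ : σ < δ)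
    (hR : ∀ A, 0 < R A ∧ R A ≤ τ * δ ∧ R A ≠ τ * σ)
    {Γ : Fin L → Contour} (hΓ : ∀ B < j, Γ B = dumbbell τ (r B) (R B))
    (hΓj : Γ j = Contour.circle (-1) σ)
    (hΓ' : ∀ B, j < B → ∀ u ∈ (Γ B).support, Clear τ δ u)
    (hsep : ∀ A B, j < A → A < B → ∀ a ∈ (Γ A).support, ∀ b ∈ (Γ B).support, a ≠ τ * b)
    (hpoles : ∀ B, j < B → ∀ p ∈ basePoles (τ : ℂ) κ, p ∉ (Γ B).support)
    {h : Fin L → ℂ → ℂ} (hh : ∀ A, RatOn (basePoles (τ : ℂ) κ) (h A)) :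
    ContinuousOn (nested (τ : ℂ) h Finset.univ) (multiSupport Γ) := by
  have h2 := hs.pos
  have h3 := hs.tau_pos
  have h4 := hs.four_lt_tau
  have h5 := hs.tau_mul_lt
  have hτσ : τ * σ < τ * δ := by gcongr
  have hcirc : ∀ b ∈ (Γ j).support, ‖b + 1‖ = σ := by
    intro b hb
    rw [hΓj, Contour.mem_support_circle hσ, sub_neg_eq_add] at hb
    exact hb
  have hdb : ∀ A < j, ∀ a ∈ (Γ A).support, ‖a‖ = r A ∨ ‖a + τ‖ = R A := by
    intro A hA a ha
    rw [hΓ A hA, mem_support_dumbbell (hr.pos A) (hR A).1] at ha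
    exact ha
  have hsepG : Separated (τ : ℂ) Γ := by
    intro A B hAB a ha b hb hab
    rcases lt_trichotomy B j with hB | rfl | hB
    · exact ne_tau_mul_of_dumbbell hs (hr.le A) (hr.le B) (hr.lt A B hAB) (hR A).2.1
        (hR B).2.1 (hdb A (hAB.trans hB) a ha) (hdb B hB b hb) hab
    · have hb' := hcirc b hb
      have e1 : ‖a + τ‖ = τ * σ := by rw [hab, hs.norm_tau_mul_add_tau, hb']
      have e2 := le_norm_add_norm_add a τ
      have e3 := hr.le A
      rcases hdb A hAB a ha with e | e
      · linarith
      · exact (hR A).2.2 (e.symm.trans e1)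
    · obtain ⟨hc1, hc2, hc3⟩ := hΓ' B hB b hb
      rcases lt_trichotomy A j with hA | rfl | hA
      · have e3 := hr.le A
        rcases hdb A hA a ha with e | e
        · rw [hab] at e
          linarith
        · rw [hab, hs.norm_tau_mul_add_tau] at e
          have e4 : τ * δ < τ * ‖b + 1‖ := by gcongr
          have := (hR A).2.1
          linarith
      · have := hcirc a ha
        rw [hab] at this
        linarith
      · exact hsep A B hA hAB a ha b hb hab
  have hpolesG : ∀ A, ∀ p ∈ basePoles (τ : ℂ) κ, p ∉ (Γ A).support := by
    intro A p hp hmem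
    rcases lt_trichotomy A j with hA | rfl | hA
    · rw [hΓ A hA] at hmem
      exact notMem_dumbbell_of_basePoles hs (hr.pos A) (hr.le A) (hR A).1 (hR A).2.1 hp hmem
    · have e1 := hcirc p hmem
      have e2 := basePoles_far hs hp
      linarith
    · exact hpoles A hA p hp hmem
  exact continuousOn_nested hsepG fun A => (hh A).continuousOn.mono fun u hu hp =>
    hpolesG A u hp hu

/-- The integral vanishes if one of the variables runs over a small circle around `-1` and the
variables before it run over dumbbells. Hence the winding number around `-1` is irrelevant. -/
theorem multiIntegral_eq_zero_of_circle_neg_one (hs : Scale τ κ δ) {r : Fin L → ℝ}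
    (hr : Radii τ δ r) {j : Fin L} {ρ σ : ℝ} (hρ : 0 < ρ) (hρσ : ρ < τ * σ) (hσδ : σ < δ)
    {Γ : Fin L → Contour} (hΓ : ∀ B < j, Γ B = dumbbell τ (r B) ρ)
    (hΓj : Γ j = Contour.circle (-1) σ)
    (hΓ' : ∀ B, j < B → ∀ u ∈ (Γ B).support, Clear τ δ u)
    (hsep : ∀ A B, j < A → A < B → ∀ a ∈ (Γ A).support, ∀ b ∈ (Γ B).support, a ≠ τ * b)
    (hpoles : ∀ B, j < B → ∀ p ∈ basePoles (τ : ℂ) κ, p ∉ (Γ B).support)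
    {h : Fin L → ℂ → ℂ} (hh : ∀ A, RatOn (basePoles (τ : ℂ) κ) (h A))
    (hreg : ∀ A < j, ∃ g, RatOn {p | δ < ‖p + 1‖} g ∧
      ∀ b, b ≠ -1 → ‖b + 1‖ ≤ δ → h A (τ * b) * h j b = g b) :
    multiIntegral Γ (nested (τ : ℂ) h Finset.univ) = 0 := by
  have hτ := hs.tau_ne_zero
  have h1 := hs.four_lt_one_sub
  have h2 := hs.pos
  have h3 := hs.tau_pos
  have h4 := hs.four_lt_tau
  have h5 := hs.tau_mul_lt
  have h9 := hs.tau_mul_pos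
  have hσ : 0 < σ := by
    by_contra! hle
    nlinarith
  have hτσ : τ * σ < τ * δ := by gcongr
  -- the radius of the circle around `-τ` is enlarged for the indices in `s`
  set R : Finset (Fin L) → Fin L → ℝ := fun s A => if A ∈ s then τ * δ else ρ with hR
  have hRpos : ∀ s A, 0 < R s A ∧ R s A ≤ τ * δ ∧ R s A ≠ τ * σ := by
    intro s A
    simp only [hR]
    split_ifs
    · exact ⟨h9, le_rfl, hτσ.ne'⟩
    · exact ⟨hρ, by linarith, hρσ.ne⟩
  set G : Finset (Fin L) → Fin L → Contour := fun s A =>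
    if A < j then dumbbell τ (r A) (R s A) else Γ A with hG
  have hGlt : ∀ s, ∀ B < j, G s B = dumbbell τ (r B) (R s B) := fun s B hB => if_pos hB
  have hGj : ∀ s, G s j = Contour.circle (-1) σ := fun s => (if_neg (lt_irrefl j)).trans hΓj
  have hGgt : ∀ s, ∀ B, j < B → G s B = Γ B := fun s B hB => if_neg hB.not_gt
  have hdb : ∀ s, ∀ A < j, ∀ a ∈ (G s A).support, ‖a‖ = r A ∨ ‖a + τ‖ = R s A := by
    intro s A hA a ha
    rw [hGlt s A hA, mem_support_dumbbell (hr.pos A) (hRpos s A).1] at ha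
    exact ha
  have hcont : ∀ s, ContinuousOn (nested (τ : ℂ) h Finset.univ) (multiSupport (G s)) := by
    intro s
    refine continuousOn_nested_of_circle_neg_one hs hr hσ hσδ (hRpos s) (hGlt s) (hGj s)
      (fun B hB => ?_) (fun A B hA hAB => ?_) (fun B hB => ?_) hh
    · rw [hGgt s B hB]; exact hΓ' B hB
    · rw [hGgt s A hA, hGgt s B (hA.trans hAB)]; exact hsep A B hA hAB
    · rw [hGgt s B hB]; exact hpoles B hB
  have hstep : ∀ s : Finset (Fin L), (∀ A ∈ s, A < j) →
      multiIntegral (G ∅) (nested (τ : ℂ) h Finset.univ) =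
        multiIntegral (G s) (nested (τ : ℂ) h Finset.univ) := by
    intro s
    induction s using Finset.induction_on with
    | empty => exact fun _ => rfl
    | insert A s hA ih =>
      intro hlt
      rw [ih fun B hB => hlt B (Finset.mem_insert_of_mem hB)]
      have hAj := hlt A (Finset.mem_insert_self A s)
      have hupd : G (insert A s) = Function.update (G s) A (dumbbell τ (r A) (τ * δ)) := by
        funext B
        by_cases hBA : B = A
        · subst hBA
          rw [Function.update_self, hGlt _ B hAj]
          simp [hR]
        · rw [Function.update_of_ne hBA]
          simp [hG, hR, hBA]
      have hc := hcont (insert A s)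
      rw [hupd] at hc ⊢
      refine multiIntegral_eq_enlarge hs hr hAj hσ hσδ (fun B _ => hRpos s B) ?_ (hGlt s) (hGj s)
        (fun B hB => by rw [hGgt s B hB]; exact hΓ' B hB) (hh A) (hreg A hAj) (hcont s) hc
      simpa [hR, hA] using hρσ
  have hG0 : Γ = G ∅ := by
    funext A
    by_cases hA : A < j
    · rw [hGlt _ A hA, hΓ A hA]; simp [hR]
    · simp [hG, hA]
  rw [hG0, hstep (Finset.univ.filter (· < j)) fun A hA => (Finset.mem_filter.1 hA).2]
  set s : Finset (Fin L) := Finset.univ.filter (· < j) with hsdef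
  -- with all these circles enlarged there is no pole in the variable `j` near `-1`
  have := multiIntegral_eq_sum_update (Γ := G s) j (F := nested (τ : ℂ) h Finset.univ)
    (∅ : Finset Unit) (fun _ => 0) (fun _ => Γ j) (hcont s) (by simp) fun u hu => by
      rw [Finset.sum_empty, hGj]
      simp only [nested_update]
      rw [Contour.integral_const_mul, RatOn.integral_circle_neg_one hσ
        (((hh j).mono Set.subset_union_left).mul
          ((ratOn_prod_cross_univ hτ j u).mono Set.subset_union_right)), mul_zero]
      rintro p (hp | ⟨B, hB, rfl⟩ | ⟨B, hB, rfl⟩)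
      · have := basePoles_far hs hp
        linarith
      · rcases hdb s B hB (u B) (hu B hB.ne) with e | e
        · have e1 : ‖u B / (τ : ℂ)‖ < δ := by
            rw [hs.norm_div_tau, e, div_lt_iff₀ h3]
            have := hr.lt B j hB
            have := hr.le j
            nlinarith
          have e2 := le_norm_add_norm_add (u B / (τ : ℂ)) 1
          push_cast at e2
          linarith
        · have : R s B = τ * δ := if_pos (by simp [hsdef, hB])
          rw [hs.norm_div_tau_add_one, e, this, mul_div_cancel_left₀ _ h3.ne']
          exact hσδ
      · have := hu B hB.ne'
        rw [hGgt s B hB] at this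
        exact hσδ.trans (hΓ' B hB _ this).2.1
  simpa using this

end NoWindingAtMinusOne

end SixVertex

namespace SixVertex

/-! ### The boundary relation of the integrals -/

section Dumbbells

variable {τ κ δ : ℝ} {L : ℕ}

/-- In the product of the factors at `τ b` and at `b`, the zero of the second one at `b = -1`
cancels the pole of the first one, if the second exponent is not smaller. -/
theorem exists_ratOn_oneBody_mul_oneBody (hs : Scale τ κ δ) (t : ℕ) {m n : ℕ} (hmn : m ≤ n) :
    ∃ g, RatOn {p | δ < ‖p + 1‖} g ∧ ∀ b, b ≠ -1 → ‖b + 1‖ ≤ δ →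
      oneBody (τ : ℂ) κ t m (τ * b) * oneBody (τ : ℂ) κ t n b = g b := by
  have hτ := hs.tau_ne_zero
  have hκ := hs.kappa_ne_zero
  have h1 := hs.four_lt_one_sub
  have h2 := hs.pos
  have h3 := hs.tau_pos
  have h4 := hs.lt_kappa
  have h5 : κ⁻¹ < (τ * κ)⁻¹ := by
    rw [mul_inv]
    have := (one_lt_inv₀ h3).2 hs.tau_lt
    have := inv_pos.2 hs.kappa_pos
    nlinarith
  set S : Set ℂ := {p | δ < ‖p + 1‖} with hS
  have hbase : basePoles (τ : ℂ) κ ⊆ S := fun p hp => by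
    have := basePoles_far hs hp
    rw [hS, Set.mem_ofPred_eq]
    linarith
  refine ⟨fun b => (((1 + b * κ) / (τ * κ * b + 1)) ^ t * timeFactor (τ : ℂ) κ b ^ t *
    (((1 + τ * b) / ((τ : ℂ)⁻¹ * b + 1)) ^ m * spaceFactor (τ : ℂ) b ^ (n - m)) * (τ : ℂ)⁻¹) /
      (1 * b + 0) / (1 * b + 0), ?_, fun b hb hbδ => ?_⟩
  · have h0 : ∀ u : ℂ, 1 * u + 0 = 0 → u ∈ S := fun u hu =>
      hbase (by simp only [one_mul, add_zero] at hu; simp [hu, basePoles])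
    refine RatOn.div_linear (RatOn.div_linear (RatOn.mul (RatOn.mul (RatOn.mul (RatOn.pow ?_ t)
      (RatOn.pow ?_ t)) (RatOn.mul (RatOn.pow ?_ m) (RatOn.pow ?_ _))) (RatOn.const _ _)) h0
      (Or.inl one_ne_zero)) h0 (Or.inl one_ne_zero)
    · refine RatOn.div_linear ((RatOn.const _ _).add ((RatOn.id _).mul (RatOn.const _ _)))
        (fun u hu => ?_) (Or.inl (mul_ne_zero hτ hκ))
      have hu' : u = -(((τ * κ)⁻¹ : ℝ) : ℂ) := by
        push_cast
        field_simp
        linear_combination hu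
      have := sub_le_norm_add_add_norm_add u (τ * κ)⁻¹ 1
      rw [hu', neg_add_cancel, norm_zero] at this
      rw [hS, Set.mem_ofPred_eq, hu']
      push_cast at this ⊢
      linarith
    · exact ratOn_timeFactor hκ (hbase (by simp [basePoles]))
    · refine RatOn.div_linear ((RatOn.const _ _).add ((RatOn.const _ _).mul (RatOn.id _)))
        (fun u hu => hbase ?_) (Or.inl (inv_ne_zero hτ))
      have : u = -τ := by field_simp at hu; linear_combination hu
      simp [this, basePoles]
    · exact ratOn_spaceFactor hτ (hbase (by simp [basePoles]))
  · have e1 : timeFactor (τ : ℂ) κ (τ * b) = (1 + b * κ) / (τ * κ * b + 1) := by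
      rw [timeFactor, mul_comm (τ : ℂ) b, mul_assoc b, mul_inv_cancel₀ hτ, mul_one]
      ring_nf
    have hb1 : 1 + b ≠ 0 := fun h0 => hb (by linear_combination h0)
    have e2 : spaceFactor (τ : ℂ) (τ * b) * spaceFactor (τ : ℂ) b =
        (1 + τ * b) / ((τ : ℂ)⁻¹ * b + 1) := by
      rw [spaceFactor, spaceFactor, mul_comm (τ : ℂ) b, mul_assoc b, mul_inv_cancel₀ hτ, mul_one,
        div_mul_div_cancel₀ hb1]
      ring_nf
    beta_reduce
    rw [oneBody, oneBody, e1, ← e2, mul_pow]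
    obtain ⟨k, rfl⟩ := Nat.exists_eq_add_of_le hmn
    rw [Nat.add_sub_cancel_left]
    simp only [zpow_natCast, one_mul, add_zero]
    rw [pow_add]
    field_simp

theorem winding_dumbbell_congr {r r' ρ : ℝ} (hr : 0 < r) (hrr : r < r') (hρ : 0 < ρ) {p : ℂ}
    (h : ‖p‖ < r ∨ r' < ‖p‖) (h' : ‖p + τ‖ ≠ ρ) :
    (dumbbell τ r ρ).winding p = (dumbbell τ r' ρ).winding p := by
  have : (Contour.circle 0 r).winding p = (Contour.circle 0 r').winding p := by
    rcases h with h | h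
    · rw [winding_circle_zero_of_lt h, winding_circle_zero_of_lt (h.trans hrr)]
    · rw [winding_circle_zero_of_gt hr (hrr.trans h), winding_circle_zero_of_gt (hr.trans hrr) h]
  rcases h'.lt_or_gt with h' | h'
  · rw [winding_dumbbell_of_near h', winding_dumbbell_of_near h', this]
  · rw [winding_dumbbell_of_far hρ h', winding_dumbbell_of_far hρ h', this]

/-- Where `u / τ` is, for `u` on a dumbbell. -/
theorem div_tau_cases (hs : Scale τ κ δ) {r ρ s : ℝ} (hrs : r < τ * s) (hsδ : s ≤ δ)
    (hρ : ρ < τ * δ) {u : ℂ} (hu : ‖u‖ = r ∨ ‖u + τ‖ = ρ) :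
    (‖u / (τ : ℂ)‖ < s ∧ τ * δ < ‖u / (τ : ℂ) + τ‖ ∧ δ < ‖u / (τ : ℂ) + 1‖) ∨
      (‖u / (τ : ℂ) + 1‖ = ρ / τ ∧ ρ / τ < δ ∧ δ < ‖u / (τ : ℂ)‖ ∧
        τ * δ < ‖u / (τ : ℂ) + τ‖) := by
  have h1 := hs.four_lt_one_sub
  have h2 := hs.pos
  have h3 := hs.tau_pos
  have h4 := hs.four_lt_tau
  have h5 := hs.tau_mul_lt
  have e1 := le_norm_add_norm_add (u / (τ : ℂ)) τ
  have e2 := le_norm_add_norm_add (u / (τ : ℂ)) 1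
  have e3 := sub_le_norm_add_add_norm_add (u / (τ : ℂ)) 1 τ
  push_cast at e2 e3
  rcases hu with hu | hu
  · left
    have : ‖u / (τ : ℂ)‖ < s := by rw [hs.norm_div_tau, hu, div_lt_iff₀ h3]; linarith
    exact ⟨this, by linarith, by linarith⟩
  · right
    have e4 : ‖u / (τ : ℂ) + 1‖ = ρ / τ := by rw [hs.norm_div_tau_add_one, hu]
    have e5 : ρ / τ < δ := by rw [div_lt_iff₀ h3]; linarith
    exact ⟨e4, e5, by linarith, by linarith⟩

/-- Where `τ u` is, for `u` on a dumbbell. -/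
theorem tau_mul_cases (hs : Scale τ κ δ) {r ρ s : ℝ} (hrs : s < τ * r) (hrδ : r ≤ δ)
    (hsδ : s ≤ δ) (hρ : ρ ≤ τ * δ) {u : ℂ} (hu : ‖u‖ = r ∨ ‖u + τ‖ = ρ) :
    s < ‖τ * u‖ ∧ τ * δ < ‖τ * u + τ‖ := by
  have h2 := hs.pos
  have h3 := hs.tau_pos
  have h4 := hs.four_lt_tau
  have h5 := hs.tau_mul_lt
  have h6 := hs.lt_sq
  have h7 := hs.lt_mul
  rcases hu with hu | hu
  · have e1 : ‖(τ : ℂ) * u‖ = τ * r := by rw [hs.norm_tau_mul, hu]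
    have e2 := le_norm_add_norm_add ((τ : ℂ) * u) τ
    have e3 : τ * r ≤ τ * δ := by gcongr
    exact ⟨by linarith, by linarith⟩
  · have e1 : ‖(τ : ℂ) * u + ((τ ^ 2 : ℝ) : ℂ)‖ = τ * ρ := by
      rw [← hu, ← hs.norm_tau_mul]; push_cast; ring_nf
    have e2 := le_norm_add_norm_add ((τ : ℂ) * u) (τ ^ 2)
    have e3 := sub_le_norm_add_add_norm_add ((τ : ℂ) * u) τ (τ ^ 2)
    have e4 : τ * ρ ≤ δ := by
      have e5 : τ * ρ ≤ τ * (τ * δ) := by gcongr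
      have e6 : τ * (τ * δ) ≤ τ * δ := by gcongr
      linarith
    rw [e1] at e2 e3
    exact ⟨by linarith, by nlinarith⟩

theorem basePoles_cases (hs : Scale τ κ δ) {p : ℂ} (hp : p ∈ basePoles (τ : ℂ) κ) :
    p = 0 ∨ (δ < ‖p‖ ∧ (p = -τ ∨ (p = -(κ : ℂ)⁻¹ ∧ δ < ‖p + τ‖))) := by
  have h1 := hs.four_lt_one_sub
  have h2 := hs.pos
  have h3 := hs.tau_pos
  have h4 := hs.four_lt_tau
  have h6 := hs.lt_kappa
  simp only [basePoles, Set.mem_insert_iff, Set.mem_singleton_iff] at hp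
  rcases hp with rfl | rfl | rfl
  · exact Or.inl rfl
  · right
    rw [norm_neg, Complex.norm_of_nonneg h3.le]
    exact ⟨by linarith, Or.inl rfl⟩
  · right
    have e1 := sub_le_norm_add_add_norm_add (-(κ : ℂ)⁻¹) κ⁻¹ τ
    have e2 : ‖-(κ : ℂ)⁻¹‖ = κ⁻¹ := by
      rw [norm_neg, norm_inv, Complex.norm_of_nonneg hs.kappa_pos.le]
    simp only [Complex.ofReal_inv, neg_add_cancel, norm_zero, zero_add] at e1
    rw [e2]
    exact ⟨by linarith, Or.inr ⟨rfl, by linarith⟩⟩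

theorem continuousOn_nested_dumbbell (hs : Scale τ κ δ) {r : Fin L → ℝ} (hr : Radii τ δ r) {ρ : ℝ}
    (hρ : 0 < ρ) (hρδ : ρ < τ * δ) {h : Fin L → ℂ → ℂ}
    (hh : ∀ A, RatOn (basePoles (τ : ℂ) κ) (h A)) :
    ContinuousOn (nested (τ : ℂ) h Finset.univ) (multiSupport fun A => dumbbell τ (r A) ρ) := by
  refine continuousOn_nested (fun A B hAB a ha b hb => ?_) fun A =>
    (hh A).continuousOn.mono fun u hu hp => ?_
  · rw [mem_support_dumbbell (hr.pos _) hρ] at ha hb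
    exact ne_tau_mul_of_dumbbell hs (hr.le A) (hr.le B) (hr.lt A B hAB) hρδ.le hρδ.le ha hb
  · exact notMem_dumbbell_of_basePoles hs (hr.pos A) (hr.le A) hρ hρδ.le hp hu

/-- The antisymmetry argument: for equal neighbouring exponents a combination of three integrands
cancels the cross factor of the two neighbouring variables, and the remaining integrand is
antisymmetric in these variables, which can be integrated over the same contour. -/
theorem multiIntegral_boundary (hs : Scale τ κ δ) {r : Fin L → ℝ} (hr : Radii τ δ r) {ρ : ℝ}
    (hρ : 0 < ρ) (hρδ : ρ < τ * δ) (t : ℕ) {i j : Fin L} (hij : (j : ℕ) = i + 1) (y : Fin L → ℕ)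
    {k : ℕ} (hyi : y i = k + 1) (hyj : y j = k + 1) :
    multiIntegral (fun A => dumbbell τ (r A) ρ)
        (nested (τ : ℂ) (fun A => oneBody (τ : ℂ) κ t (y A)) Finset.univ) =
      (1 + τ) * multiIntegral (fun A => dumbbell τ (r A) ρ)
        (nested (τ : ℂ) (fun A => oneBody (τ : ℂ) κ t (Function.update y i k A)) Finset.univ) -
      τ * multiIntegral (fun A => dumbbell τ (r A) ρ)
        (nested (τ : ℂ) (fun A => oneBody (τ : ℂ) κ t
          (Function.update (Function.update y i k) j k A)) Finset.univ) := by
  have hτ := hs.tau_ne_zero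
  have hκ := hs.kappa_ne_zero
  have hlt : i < j := Fin.lt_def.2 (by omega)
  have h2 := hs.pos
  have h3 := hs.tau_pos
  have h4 := hs.four_lt_tau
  have h5 := hs.tau_mul_lt
  have hcont : ∀ y : Fin L → ℕ, ContinuousOn (nested (τ : ℂ) (fun A => oneBody (τ : ℂ) κ t (y A))
      Finset.univ) (multiSupport fun A => dumbbell τ (r A) ρ) := fun y =>
    continuousOn_nested_dumbbell hs hr hρ hρδ fun A => ratOn_oneBody hτ hκ t (y A)
  rw [← sub_eq_zero]
  set F₀ := nested (τ : ℂ) (fun A => oneBody (τ : ℂ) κ t (y A)) Finset.univ with hF₀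
  set F₁ := nested (τ : ℂ) (fun A => oneBody (τ : ℂ) κ t (Function.update y i k A)) Finset.univ
    with hF₁
  set F₂ := nested (τ : ℂ) (fun A => oneBody (τ : ℂ) κ t
          (Function.update (Function.update y i k) j k A)) Finset.univ with hF₂
  have c₀ := hcont y
  have c₁ : ContinuousOn (fun u => -(1 + (τ : ℂ)) * F₁ u)
      (multiSupport fun A => dumbbell τ (r A) ρ) := continuousOn_const.mul (hcont _)
  have c₂ : ContinuousOn (fun u => (τ : ℂ) * F₂ u)
      (multiSupport fun A => dumbbell τ (r A) ρ) := continuousOn_const.mul (hcont _)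
  have c₀₁ : ContinuousOn (fun u => F₀ u + -(1 + (τ : ℂ)) * F₁ u)
      (multiSupport fun A => dumbbell τ (r A) ρ) := c₀.add c₁
  have hcomb : multiIntegral (fun A => dumbbell τ (r A) ρ) F₀ -
      ((1 + τ) * multiIntegral (fun A => dumbbell τ (r A) ρ) F₁ -
        τ * multiIntegral (fun A => dumbbell τ (r A) ρ) F₂) =
      multiIntegral (fun A => dumbbell τ (r A) ρ)
        (fun u => F₀ u + -(1 + (τ : ℂ)) * F₁ u + (τ : ℂ) * F₂ u) := by
    rw [multiIntegral_add c₀₁ c₂, multiIntegral_add c₀ c₁, multiIntegral_const_mul,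
      multiIntegral_const_mul]
    ring
  rw [hcomb, ← multiIntegral_zero_fun fun A => dumbbell τ (r A) ρ]
  refine multiIntegral_congr_two hlt.ne (fun _ _ _ => rfl) (c₀₁.add c₂) continuousOn_const
    fun u hu => ?_
  simp only [Contour.integral_zero]
  set R : Finset (Fin L) := (Finset.univ.erase i).erase j with hR
  have hRmem : ∀ B ∈ R, B ≠ i ∧ B ≠ j := fun B hB =>
    ⟨Finset.ne_of_mem_erase (Finset.mem_of_mem_erase hB), Finset.ne_of_mem_erase hB⟩
  have hcases : ∀ B ∈ R, B < i ∨ j < B := by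
    intro B hB
    obtain ⟨h, h'⟩ := hRmem B hB
    rw [Ne, Fin.ext_iff] at h h'
    rw [Fin.lt_def, Fin.lt_def]
    omega
  have hcross : ∀ B ∈ R, ∀ b, cross (τ : ℂ) j B b (u B) = cross (τ : ℂ) i B b (u B) := by
    intro B hB b
    rcases hcases B hB with h | h
    · rw [cross, cross, if_neg (h.trans hlt).not_gt, if_neg h.not_gt]
    · rw [cross, cross, if_pos h, if_pos (hlt.trans h)]
  set m : ℂ → ℂ := fun a => oneBody (τ : ℂ) κ t k a / ((τ : ℂ)⁻¹ * a + 1) *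
    ∏ B ∈ R, cross (τ : ℂ) i B a (u B) with hm
  set S : Set ℂ := basePoles (τ : ℂ) κ ∪ {p | ∃ B ∈ R, (B < i ∧ p = u B / τ) ∨
    (i < B ∧ p = τ * u B)} with hS
  have hmS : RatOn S m := by
    refine RatOn.mul (RatOn.div_linear ((ratOn_oneBody hτ hκ t k).mono Set.subset_union_left)
      (fun p hp => Or.inl ?_) (Or.inl (inv_ne_zero hτ))) (ratOn_prod_cross hτ ?_ fun B hB =>
        ⟨fun hlt => ?_, fun hlt => ?_⟩)
    · have : p = -τ := by field_simp at hp; linear_combination hp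
      simp [this, basePoles]
    · simp [hR]
    · exact Or.inr ⟨B, hB, Or.inl ⟨hlt, rfl⟩⟩
    · exact Or.inr ⟨B, hB, Or.inr ⟨hlt, rfl⟩⟩
  have hrij : r i < r j := by
    have e1 := hr.lt i j hlt
    have e2 := hr.pos j
    have e3 := hs.tau_lt
    nlinarith
  -- the poles do not lie between the two dumbbells
  have hSp : ∀ p ∈ S, (‖p‖ < r i ∨ r j < ‖p‖) ∧ ‖p + τ‖ ≠ ρ := by
    have hrj := hr.le j
    rintro p (hp | ⟨B, hB, ⟨h, rfl⟩ | ⟨h, rfl⟩⟩)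
    · rcases basePoles_cases hs hp with rfl | ⟨e1, rfl | ⟨-, e2⟩⟩
      · rw [norm_zero, zero_add, Complex.norm_of_nonneg h3.le]
        exact ⟨Or.inl (hr.pos i), by linarith⟩
      · rw [neg_add_cancel, norm_zero]
        exact ⟨Or.inr (by linarith), hρ.ne⟩
      · exact ⟨Or.inr (by linarith), by linarith⟩
    · have hB' := hu B (hRmem B hB).1 (hRmem B hB).2
      rw [mem_support_dumbbell (hr.pos B) hρ] at hB'
      rcases div_tau_cases hs (hr.lt B i h) (hr.le i) hρδ hB' with ⟨e1, e2, -⟩ | ⟨-, -, e1, e2⟩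
      · exact ⟨Or.inl e1, by linarith⟩
      · exact ⟨Or.inr (by linarith), by linarith⟩
    · have hB' := hu B (hRmem B hB).1 (hRmem B hB).2
      rw [mem_support_dumbbell (hr.pos B) hρ] at hB'
      have hjB : j < B := (hcases B hB).resolve_left h.not_gt
      obtain ⟨e1, e2⟩ := tau_mul_cases hs (hr.lt j B hjB) (hr.le B) hrj hρδ.le hB'
      exact ⟨Or.inr e1, by linarith⟩
  have heq : ∀ f : ℂ → ℂ, RatOn S f →
      (dumbbell τ (r i) ρ).integral f = (dumbbell τ (r j) ρ).integral f := by
    intro f hf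
    have := hf.sum_integral_eq_zero Finset.univ ![(1 : ℂ), -1]
      ![dumbbell τ (r i) ρ, dumbbell τ (r j) ρ]
      (by
        intro l _ a ha hmem
        obtain ⟨e1, e2⟩ := hSp a ha
        fin_cases l
        · rcases (mem_support_dumbbell (hr.pos i) hρ).1 hmem with h0 | h0
          · rcases e1 with e1 | e1 <;> linarith
          · exact e2 h0
        · rcases (mem_support_dumbbell (hr.pos j) hρ).1 hmem with h0 | h0
          · rcases e1 with e1 | e1 <;> linarith
          · exact e2 h0)
      (by
        intro a ha
        obtain ⟨e1, e2⟩ := hSp a ha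
        simp only [Fin.sum_univ_two, Matrix.cons_val_zero, Matrix.cons_val_one]
        rw [winding_dumbbell_congr (hr.pos i) hrij hρ e1 e2]
        ring)
    simp only [Fin.sum_univ_two, Matrix.cons_val_zero, Matrix.cons_val_one] at this
    linear_combination this
  set K := nested (τ : ℂ) (fun A => oneBody (τ : ℂ) κ t (y A)) R u with hK
  have hpt : ∀ a ∈ (dumbbell τ (r i) ρ).support, ∀ b ∈ (dumbbell τ (r j) ρ).support,
      F₀ (Function.update (Function.update u j b) i a) +
        -(1 + (τ : ℂ)) * F₁ (Function.update (Function.update u j b) i a) +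
        (τ : ℂ) * F₂ (Function.update (Function.update u j b) i a) =
      (-((1 - τ) / τ) * K * m b) * ((a - b) * m a) := by
    intro a ha b hb
    have hab : a - τ * b ≠ 0 := by
      rw [mem_support_dumbbell (hr.pos _) hρ] at ha hb
      exact sub_ne_zero.2 (ne_tau_mul_of_dumbbell hs (hr.le i) (hr.le j) (hr.lt i j hlt) hρδ.le
        hρδ.le ha hb)
    have hne : ∀ (s : ℝ), 0 < s → s ≤ δ → ∀ c ∈ (dumbbell τ s ρ).support, τ + c ≠ 0 := by
      intro s hs0 hsδ c hc h0
      have : c = -τ := by linear_combination h0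
      exact notMem_dumbbell_of_basePoles hs hs0 hsδ hρ hρδ.le
        (p := c) (by simp [this, basePoles]) hc
    have ha' := hne _ (hr.pos i) (hr.le i) a ha
    have hb' := hne _ (hr.pos j) (hr.le j) b hb
    have hone : ∀ c, oneBody (τ : ℂ) κ t ((k + 1 : ℕ) : ℤ) c =
        oneBody (τ : ℂ) κ t k c * spaceFactor τ c := by
      intro c
      simp only [oneBody, zpow_natCast, pow_succ]
      ring
    have hK1 : nested (τ : ℂ) (fun A => oneBody (τ : ℂ) κ t (Function.update y i k A)) R u = K :=
      nested_congr_fun fun A hA => by rw [Function.update_of_ne (hRmem A hA).1]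
    have hK2 : nested (τ : ℂ) (fun A => oneBody (τ : ℂ) κ t
        (Function.update (Function.update y i k) j k A)) R u = K :=
      nested_congr_fun fun A hA => by
        rw [Function.update_of_ne (hRmem A hA).2, Function.update_of_ne (hRmem A hA).1]
    rw [hF₀, hF₁, hF₂, nested_update_update _ hlt.ne, nested_update_update _ hlt.ne,
      nested_update_update _ hlt.ne, ← hR, hK1, hK2, ← hK, cross, if_pos hlt]
    simp only [Function.update_self, Function.update_of_ne hlt.ne, Function.update_of_ne hlt.ne',
      hyi, hyj, hone]
    rw [Finset.prod_congr rfl fun B hB => hcross B hB b]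
    simp only [hm]
    have key : (a - b) / (a - τ * b) * (spaceFactor (τ : ℂ) a * spaceFactor (τ : ℂ) b -
        (1 + τ) * spaceFactor (τ : ℂ) b + τ) = -((1 - τ) / τ) * ((a - b) *
          (1 / ((τ : ℂ)⁻¹ * a + 1)) * (1 / ((τ : ℂ)⁻¹ * b + 1))) := by
      have e1 : ∀ c : ℂ, 1 + c * (τ : ℂ)⁻¹ = (τ + c) / τ := fun c => by field_simp
      have e2 : ∀ c : ℂ, (τ : ℂ)⁻¹ * c + 1 = (τ + c) / τ := fun c => by field_simp; ring
      have h1 : (1 : ℂ) * ((1 + a) / ((τ + a) / τ)) * ((1 + b) / ((τ + b) / τ)) -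
          (1 + τ) * ((1 + b) / ((τ + b) / τ)) + τ = -((1 - τ) / τ) * ((a - τ * b) *
          (1 / ((τ + a) / τ)) * (1 / ((τ + b) / τ))) := by
        field_simp
        ring
      simp only [spaceFactor, e1, e2]
      rw [one_mul] at h1
      rw [h1, div_mul_eq_mul_div, div_eq_iff hab]
      ring
    linear_combination (K * oneBody (τ : ℂ) κ t k b * oneBody (τ : ℂ) κ t k a *
      (∏ B ∈ R, cross (τ : ℂ) i B b (u B)) * (∏ B ∈ R, cross (τ : ℂ) i B a (u B))) * key
  have hcm : ∀ s : ℝ, s = r i ∨ s = r j → ContinuousOn m (dumbbell τ s ρ).support := by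
    intro s hs'
    refine hmS.continuousOn.mono fun p hp hpS => ?_
    obtain ⟨e1, e2⟩ := hSp p hpS
    rcases hs' with rfl | rfl
    · rcases (mem_support_dumbbell (hr.pos i) hρ).1 hp with h0 | h0
      · rcases e1 with e1 | e1 <;> linarith
      · exact e2 h0
    · rcases (mem_support_dumbbell (hr.pos j) hρ).1 hp with h0 | h0
      · rcases e1 with e1 | e1 <;> linarith
      · exact e2 h0
  have hinner : ∀ b ∈ (dumbbell τ (r j) ρ).support, ((dumbbell τ (r i) ρ).integral fun a =>
      F₀ (Function.update (Function.update u j b) i a) +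
        -(1 + (τ : ℂ)) * F₁ (Function.update (Function.update u j b) i a) +
        (τ : ℂ) * F₂ (Function.update (Function.update u j b) i a)) =
      (-((1 - τ) / τ) * K * (dumbbell τ (r i) ρ).integral (fun a => a * m a)) * m b +
      ((1 - τ) / τ * K * (dumbbell τ (r i) ρ).integral m) * (b * m b) := by
    intro b hb
    have c := hcm (r i) (Or.inl rfl)
    rw [Contour.integral_congr _ fun a ha => hpt a ha b hb, Contour.integral_const_mul]
    have : (fun a => (a - b) * m a) = fun a => a * m a + (-b) * m a := by funext a; ring
    rw [this, Contour.integral_add _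
      (show ContinuousOn (fun a => a * m a) _ from continuousOn_id.mul c)
      (show ContinuousOn (fun a => (-b) * m a) _ from continuousOn_const.mul c),
      Contour.integral_const_mul]
    ring
  have c := hcm (r j) (Or.inr rfl)
  have c' : ContinuousOn (fun b => b * m b) (dumbbell τ (r j) ρ).support := continuousOn_id.mul c
  rw [Contour.integral_congr _ hinner, Contour.integral_add _
    (show ContinuousOn (fun b => _ * m b) _ from continuousOn_const.mul c)
    (show ContinuousOn (fun b => _ * (b * m b)) _ from continuousOn_const.mul c'),
    Contour.integral_const_mul, Contour.integral_const_mul, heq m hmS,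
    heq _ ((RatOn.id S).mul hmS)]
  ring

end Dumbbells

end SixVertex

namespace SixVertex

/-! ### The evolution equation of the integrals -/

section Dumbbells

variable {τ κ δ : ℝ} {L n : ℕ}

/-- The integral over dumbbells with possibly different exponents of the space factors. -/
noncomputable def dumbbellIntegral (τ κ : ℝ) (r : Fin L → ℝ) (ρ : ℝ) (t : ℕ) (y : Fin L → ℕ) :
    ℂ :=
  multiIntegral (fun A => dumbbell τ (r A) ρ)
    (nested (τ : ℂ) (fun A => oneBody (τ : ℂ) κ t (y A)) Finset.univ)

theorem Radii.succ {r : Fin (n + 1) → ℝ} (hr : Radii τ δ r) :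
    Radii τ δ fun i : Fin n => r i.succ :=
  ⟨fun _ => hr.pos _, fun _ => hr.le _, fun _ _ h => hr.lt _ _ (Fin.succ_lt_succ_iff.2 h)⟩

/-- A first exponent `0` can be dropped: inside its contour the first variable has no pole but
`0`. -/
theorem dumbbellIntegral_of_zero (hs : Scale τ κ δ) {r : Fin (n + 1) → ℝ} (hr : Radii τ δ r)
    {ρ : ℝ} (hρ : 0 < ρ) (hρδ : ρ < τ * δ) (t : ℕ) {y : Fin (n + 1) → ℕ} (hy : y 0 = 0) :
    dumbbellIntegral τ κ r ρ t y = 2 * Real.pi * Complex.I * (τ : ℂ)⁻¹ ^ n *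
      dumbbellIntegral τ κ (fun i => r i.succ) ρ t (fun i => y i.succ) := by
  have h1 := hs.four_lt_tau
  have h2 := hs.pos
  have h3 := hs.tau_pos
  have h5 := hs.tau_mul_lt
  refine multiIntegral_nested_of_nonpos hs.tau_ne_zero hs.kappa_ne_zero (y := (y 0 : ℤ)) (t := t)
    (by simp [hy]) rfl (fun A => ⟨?_, ?_⟩) ⟨?_, ?_⟩ (fun B hB u hu => ⟨?_, ?_⟩) (by simp [hy])
    (continuousOn_nested_dumbbell hs hr hρ hρδ fun A =>
      ratOn_oneBody hs.tau_ne_zero hs.kappa_ne_zero t (y A))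
  · exact notMem_dumbbell_of_basePoles hs (hr.pos A) (hr.le A) hρ hρδ.le (by simp [basePoles])
  · rw [winding_dumbbell_of_far hρ, winding_circle_zero_of_lt (by simpa using hr.pos A)]
    rw [zero_add, Complex.norm_of_nonneg h3.le]
    linarith
  · exact notMem_dumbbell_of_basePoles hs (hr.pos 0) (hr.le 0) hρ hρδ.le (by simp [basePoles])
  · have h0 : ¬ (-(κ : ℂ)⁻¹ = 0) := neg_ne_zero.2 (inv_ne_zero hs.kappa_ne_zero)
    have := hr.le 0
    rcases basePoles_cases hs (p := -(κ : ℂ)⁻¹) (by simp [basePoles]) with h | ⟨e1, e2 | ⟨-, e2⟩⟩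
    · exact absurd h h0
    · have e3 : κ⁻¹ = τ := by exact_mod_cast neg_injective e2
      have := hs.lt_kappa
      have := hs.tau_lt
      linarith
    · rw [winding_dumbbell_of_far hρ (by linarith), winding_circle_zero_of_gt (hr.pos 0)
        (by linarith)]
  · rw [mem_support_dumbbell (hr.pos B) hρ] at hu
    rw [mem_support_dumbbell (hr.pos 0) hρ]
    intro hmem
    exact ne_tau_mul_of_dumbbell hs (hr.le 0) (hr.le B) (hr.lt 0 B hB) hρδ.le hρδ.le hmem hu rfl
  · rw [mem_support_dumbbell (hr.pos B) hρ] at hu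
    obtain ⟨e1, e2⟩ := tau_mul_cases hs (hr.lt 0 B hB) (hr.le B) (hr.le 0) hρδ.le hu
    rw [winding_dumbbell_of_far hρ (by linarith), winding_circle_zero_of_gt (hr.pos 0) e1]

theorem nested_mul_add_mul (τ : ℂ) (c d : ℂ) (f g : Fin L → ℂ → ℂ) (u : Fin L → ℂ) :
    nested τ (fun A a => c * f A a + d * g A a) Finset.univ u =
      ∑ S : Finset (Fin L), c ^ S.card * d ^ (L - S.card) *
        nested τ (fun A => if A ∈ S then f A else g A) Finset.univ u := by
  simp only [nested]
  rw [Finset.prod_add, Finset.powerset_univ, Finset.mul_sum]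
  refine Finset.sum_congr rfl fun S _ => ?_
  have h1 : ∏ A, (if A ∈ S then f A else g A) (u A) =
      (∏ A ∈ S, f A (u A)) * ∏ A ∈ Finset.univ \ S, g A (u A) := by
    rw [← Finset.prod_mul_prod_compl S, Finset.compl_eq_univ_sdiff]
    congr 1
    · exact Finset.prod_congr rfl fun A hA => by rw [if_pos hA]
    · exact Finset.prod_congr rfl fun A hA => by rw [if_neg (Finset.mem_sdiff.1 hA).2]
  rw [h1, Finset.prod_mul_distrib, Finset.prod_mul_distrib, Finset.prod_const, Finset.prod_const,
    ← Finset.compl_eq_univ_sdiff, Finset.card_compl, Fintype.card_fin]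
  ring

/-- Lowering the exponents with indices in `S` by one. -/
def lower (S : Finset (Fin L)) (y : Fin L → ℕ) (A : Fin L) : ℕ := if A ∈ S then y A - 1 else y A

/-- Expanding a product over the variables of sums of two factors gives a sum over the sets of
lowered exponents. -/
theorem sum_dumbbellIntegral_lower (hs : Scale τ κ δ) {r : Fin L → ℝ} (hr : Radii τ δ r)
    {ρ : ℝ} (hρ : 0 < ρ) (hρδ : ρ < τ * δ) (t : ℕ) (y : Fin L → ℕ) (c d : ℂ) :
    ∑ S : Finset (Fin L), c ^ S.card * d ^ (L - S.card) * dumbbellIntegral τ κ r ρ t (lower S y) =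
      multiIntegral (fun A => dumbbell τ (r A) ρ) (nested (τ : ℂ) (fun A a =>
        c * oneBody (τ : ℂ) κ t ((y A - 1 : ℕ) : ℤ) a + d * oneBody (τ : ℂ) κ t (y A) a)
          Finset.univ) := by
  have hcont : ∀ S : Finset (Fin L), ContinuousOn (nested (τ : ℂ) (fun A => if A ∈ S then
      oneBody (τ : ℂ) κ t ((y A - 1 : ℕ) : ℤ) else oneBody (τ : ℂ) κ t (y A)) Finset.univ)
      (multiSupport fun A => dumbbell τ (r A) ρ) := by
    intro S
    refine continuousOn_nested_dumbbell hs hr hρ hρδ fun A => ?_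
    split_ifs <;> exact ratOn_oneBody hs.tau_ne_zero hs.kappa_ne_zero t _
  rw [multiIntegral_congr fun u _ => nested_mul_add_mul (τ : ℂ) c d
      (fun A => oneBody (τ : ℂ) κ t ((y A - 1 : ℕ) : ℤ)) (fun A => oneBody (τ : ℂ) κ t (y A)) u,
    multiIntegral_sum _ fun S _ => show ContinuousOn (fun u => c ^ S.card * d ^ (L - S.card) *
      nested (τ : ℂ) _ Finset.univ u) _ from continuousOn_const.mul (hcont S)]
  refine Finset.sum_congr rfl fun S _ => ?_
  rw [multiIntegral_const_mul, dumbbellIntegral]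
  congr 2
  refine congrArg (fun h => nested (τ : ℂ) h Finset.univ) (funext fun A => ?_)
  unfold lower
  split_ifs <;> rfl

/-- The evolution equation of the integrals, which holds variable by variable. -/
theorem sum_dumbbellIntegral_succ (hs : Scale τ κ δ) {r : Fin L → ℝ} (hr : Radii τ δ r)
    {ρ : ℝ} (hρ : 0 < ρ) (hρδ : ρ < τ * δ) {b₁ b₂ : ℝ} (hτ : τ * b₁ = b₂)
    (hκ : κ * (1 - b₂) = 1 - b₁) (t : ℕ) {y : Fin L → ℕ} (hy : ∀ A, 1 ≤ y A) :
    ∑ S : Finset (Fin L), (-(b₂ : ℂ)) ^ S.card * dumbbellIntegral τ κ r ρ (t + 1) (lower S y) =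
      ∑ S : Finset (Fin L), (1 - b₁ - b₂ : ℂ) ^ S.card * (b₁ : ℂ) ^ (L - S.card) *
        dumbbellIntegral τ κ r ρ t (lower S y) := by
  have hτ0 := hs.tau_ne_zero
  have h := sum_dumbbellIntegral_lower hs hr hρ hρδ (t + 1) y (-(b₂ : ℂ)) 1
  simp only [one_pow, mul_one, one_mul] at h
  rw [h, sum_dumbbellIntegral_lower hs hr hρ hρδ]
  refine multiIntegral_congr fun u hu => nested_congr_fun fun A _ => ?_
  have hp : ∀ p ∈ basePoles (τ : ℂ) κ, u A ≠ p := fun p hp h => by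
    have := hu A
    rw [h] at this
    exact notMem_dumbbell_of_basePoles hs (hr.pos A) (hr.le A) hρ hρδ.le hp this
  obtain ⟨k, hk⟩ := Nat.exists_eq_add_of_le' (hy A)
  have hz : (τ : ℂ) + u A ≠ 0 := fun h0 =>
    hp (-τ) (by simp [basePoles]) (by linear_combination h0)
  have hw : 1 + u A * κ ≠ 0 := fun h0 => hp (-(κ : ℂ)⁻¹) (by simp [basePoles]) (by
    have := hs.kappa_ne_zero
    field_simp
    linear_combination h0)
  have key : timeFactor (τ : ℂ) κ (u A) * (spaceFactor τ (u A) - b₂) =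
      (1 - b₁ - b₂) + b₁ * spaceFactor τ (u A) := by
    have e1 : 1 + u A * (τ : ℂ)⁻¹ = (τ + u A) / τ := by field_simp
    have e2 : 1 + u A * (τ : ℂ)⁻¹ * κ = (τ + u A * κ) / τ := by field_simp
    have e3 : (τ : ℂ) * b₁ = b₂ := by exact_mod_cast hτ
    have e4 : (κ : ℂ) * (1 - b₂) = 1 - b₁ := by exact_mod_cast hκ
    rw [timeFactor, spaceFactor, e1, e2]
    field_simp
    rw [← e3]
    rw [← e3] at e4
    linear_combination (u A * (1 - τ) * τ) * e4
  simp only [oneBody, hk, Nat.add_sub_cancel, zpow_natCast, pow_succ]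
  linear_combination (timeFactor (τ : ℂ) κ (u A) ^ t * spaceFactor (τ : ℂ) (u A) ^ k / u A) * key

end Dumbbells

end SixVertex

namespace SixVertex

/-! ### The integrals at time zero -/

section Dumbbells

variable {τ κ δ : ℝ} {L n : ℕ}

theorem norm_spaceFactor_le (h0 : 0 < τ) (h1 : τ < 1) {u : ℂ} (hu : 2 ≤ ‖u‖) :
    ‖spaceFactor (τ : ℂ) u‖ ≤ 3 := by
  have hτ : (τ : ℂ) ≠ 0 := by exact_mod_cast h0.ne'
  have e : spaceFactor (τ : ℂ) u = τ * (1 + u) / (τ + u) := by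
    have e1 : 1 + u * (τ : ℂ)⁻¹ = (τ + u) / τ := by field_simp
    rw [spaceFactor, e1, div_div_eq_mul_div, mul_comm]
  have e2 : ‖u‖ - τ ≤ ‖(τ : ℂ) + u‖ := by
    have := norm_sub_norm_le u (-(τ : ℂ))
    rwa [norm_neg, Complex.norm_of_nonneg h0.le, sub_neg_eq_add, add_comm u] at this
  have e3 : ‖1 + u‖ ≤ 1 + ‖u‖ := by simpa using norm_add_le 1 u
  rw [e, norm_div, norm_mul, Complex.norm_of_nonneg h0.le, div_le_iff₀ (by linarith)]
  nlinarith [norm_nonneg (1 + u)]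

theorem spaceFactor_sub_eq (hτ : (τ : ℂ) ≠ 0) {u : ℂ} (hu : (τ : ℂ) + u ≠ 0) :
    spaceFactor (τ : ℂ) u - τ = (1 - τ) * τ / (τ + u) := by
  have e1 : 1 + u * (τ : ℂ)⁻¹ = (τ + u) / τ := by field_simp
  rw [spaceFactor, e1]
  field_simp
  ring

theorem norm_spaceFactor_sub_le (h0 : 0 < τ) (h1 : τ < 1) {u : ℂ} (hu : 2 ≤ ‖u‖) :
    ‖spaceFactor (τ : ℂ) u - τ‖ ≤ 2 / ‖u‖ := by
  have hτ : (τ : ℂ) ≠ 0 := by exact_mod_cast h0.ne'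
  have e2 : ‖u‖ - τ ≤ ‖(τ : ℂ) + u‖ := by
    have := norm_sub_norm_le u (-(τ : ℂ))
    rwa [norm_neg, Complex.norm_of_nonneg h0.le, sub_neg_eq_add, add_comm u] at this
  have e3 : (τ : ℂ) + u ≠ 0 := by rw [← norm_pos_iff]; linarith
  have e4 : (1 - (τ : ℂ)) * τ = (((1 - τ) * τ : ℝ) : ℂ) := by push_cast; ring
  rw [spaceFactor_sub_eq hτ e3, norm_div, e4, Complex.norm_of_nonneg (by nlinarith),
    div_le_div_iff₀ (by linarith) (by linarith)]
  have e5 : (1 - τ) * τ ≤ 1 := by nlinarith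
  nlinarith [norm_nonneg u]

theorem norm_cross_le (hs : Scale τ κ δ) {r ρ : ℝ} (hr : r ≤ δ) (hρ : ρ ≤ δ) {j B : Fin L}
    (hB : B < j) {u a : ℂ} (hu : ‖u‖ = r ∨ ‖u + τ‖ = ρ) (ha : 2 ≤ ‖a‖) :
    ‖cross (τ : ℂ) j B a u‖ ≤ 8 / τ := by
  have h3 := hs.tau_pos
  have h4 := hs.four_lt_tau
  have h5 := hs.tau_lt
  have hu' : ‖u‖ ≤ τ + δ := by
    rcases hu with hu | hu
    · linarith
    · have := norm_sub_le (u + τ) τ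
      rw [add_sub_cancel_right, Complex.norm_of_nonneg h3.le] at this
      linarith
  have e1 : τ * ‖a‖ - ‖u‖ ≤ ‖u - τ * a‖ := by
    have := norm_sub_norm_le ((τ : ℂ) * a) u
    rwa [hs.norm_tau_mul, norm_sub_rev] at this
  have e2 := norm_sub_le u a
  rw [cross, if_neg hB.not_gt, norm_div, div_le_div_iff₀ (by nlinarith) h3]
  nlinarith

/-- At time `0` the multiplier of the last variable tends to `τ` at infinity. The pole at `u = -1`
of the last variable does not contribute. -/
theorem dumbbellIntegral_zero_time (hs : Scale τ κ δ) {r : Fin (n + 1) → ℝ} (hr : Radii τ δ r)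
    {ρ : ℝ} (hρ : 0 < ρ) (hρδ : ρ < τ * δ) {y : Fin (n + 1) → ℕ} {k : ℕ}
    (hk : y (Fin.last n) = k + 1) (hy : ∀ A < Fin.last n, y A ≤ k) :
    dumbbellIntegral τ κ r ρ 0 y =
      τ * dumbbellIntegral τ κ r ρ 0 (Function.update y (Fin.last n) k) := by
  have hτ := hs.tau_ne_zero
  have hκ := hs.kappa_ne_zero
  have h2 := hs.pos
  have h3 := hs.tau_pos
  have h4 := hs.four_lt_tau
  have h5 := hs.tau_mul_lt
  have h7 := hs.tau_lt
  set j := Fin.last n with hj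
  have hlt : ∀ B, B ≠ j → B < j := fun B hB => lt_of_le_of_ne (Fin.le_last B) hB
  set D : Fin (n + 1) → Contour := fun A => dumbbell τ (r A) ρ with hD
  have hcont : ∀ y : Fin (n + 1) → ℕ, ContinuousOn (nested (τ : ℂ)
      (fun A => oneBody (τ : ℂ) κ 0 (y A)) Finset.univ) (multiSupport D) := fun y =>
    continuousOn_nested_dumbbell hs hr hρ hρδ fun A => ratOn_oneBody hτ hκ 0 (y A)
  set F₀ := nested (τ : ℂ) (fun A => oneBody (τ : ℂ) κ 0 (y A)) Finset.univ with hF₀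
  set F₁ := nested (τ : ℂ) (fun A => oneBody (τ : ℂ) κ 0 (Function.update y j k A)) Finset.univ
    with hF₁
  set h : Fin (n + 1) → ℂ → ℂ := Function.update (fun A => oneBody (τ : ℂ) κ 0 (y A)) j
    fun a => oneBody (τ : ℂ) κ 0 k a * (spaceFactor (τ : ℂ) a - τ) with hh
  have hhj : h j = fun a => oneBody (τ : ℂ) κ 0 k a * (spaceFactor (τ : ℂ) a - τ) :=
    Function.update_self _ _ _
  have hhA : ∀ A, A ≠ j → h A = oneBody (τ : ℂ) κ 0 (y A) := fun A hA =>
    Function.update_of_ne hA _ _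
  have hrat : ∀ A, RatOn (basePoles (τ : ℂ) κ) (h A) := by
    intro A
    by_cases hA : A = j
    · rw [hA, hhj]
      exact (ratOn_oneBody hτ hκ 0 k).mul
        ((ratOn_spaceFactor hτ (by simp [basePoles])).sub (RatOn.const _ _))
    · rw [hhA A hA]
      exact ratOn_oneBody hτ hκ 0 (y A)
  have hdiff : ∀ u, F₀ u + -(τ : ℂ) * F₁ u = nested (τ : ℂ) h Finset.univ u := by
    intro u
    rw [← Function.update_eq_self j u, hF₀, hF₁]
    simp only [nested_update]
    rw [nested_congr_fun (k := h) fun A hA => by rw [hhA A (Finset.ne_of_mem_erase hA)],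
      nested_congr_fun (h := fun A => oneBody (τ : ℂ) κ 0 (Function.update y j k A)) (k := h)
        fun A hA => by
          rw [hhA A (Finset.ne_of_mem_erase hA), Function.update_of_ne (Finset.ne_of_mem_erase hA)],
      Function.update_self, hhj, hk]
    simp only [oneBody, zpow_natCast, pow_succ]
    ring
  have c₁ : ContinuousOn (fun u => -(τ : ℂ) * F₁ u) (multiSupport D) :=
    continuousOn_const.mul (hcont _)
  suffices hzero : multiIntegral D (nested (τ : ℂ) h Finset.univ) = 0 by
    rw [← multiIntegral_congr fun u _ => hdiff u, multiIntegral_add (hcont y) c₁,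
      multiIntegral_const_mul] at hzero
    rw [dumbbellIntegral, dumbbellIntegral]
    linear_combination hzero
  -- a radius `σ` such that the poles `u_B / τ` near `-1` are inside the circle around `-1`
  obtain ⟨σ, hρσ, hσδ⟩ : ∃ σ, ρ / τ < σ ∧ σ < δ := exists_between (by
    rw [div_lt_iff₀ h3]; linarith)
  have hσ : 0 < σ := (div_pos hρ h3).trans hρσ
  have hρσ' : ρ < τ * σ := by rw [div_lt_iff₀ h3] at hρσ; linarith
  set Γ := Function.update D j (Contour.circle (-1) σ) with hΓ
  have hΓj : Γ j = Contour.circle (-1) σ := Function.update_self _ _ _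
  have hΓB : ∀ B < j, Γ B = dumbbell τ (r B) ρ := fun B hB => Function.update_of_ne hB.ne _ _
  have hno : ∀ B, ¬ j < B := fun B => (Fin.le_last B).not_gt
  have hcirc : multiIntegral Γ (nested (τ : ℂ) h Finset.univ) = 0 := by
    refine multiIntegral_eq_zero_of_circle_neg_one hs hr hρ hρσ' hσδ hΓB hΓj
      (fun B hB => absurd hB (hno B)) (fun A _ hA => absurd hA (hno A))
      (fun B hB => absurd hB (hno B)) hrat fun A hA => ?_
    obtain ⟨g, hg, hgb⟩ := exists_ratOn_oneBody_mul_oneBody hs 0 (hy A hA)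
    refine ⟨fun b => g b * (spaceFactor (τ : ℂ) b - τ), hg.mul
      ((ratOn_spaceFactor hτ ?_).sub (RatOn.const _ _)), fun b hb hb' => ?_⟩
    · have := basePoles_far hs (p := -(τ : ℂ)) (by simp [basePoles])
      rw [Set.mem_ofPred_eq]
      linarith
    · beta_reduce
      rw [hhA A hA.ne, hhj, ← hgb b hb hb']
      ring
  have hcontD : ContinuousOn (nested (τ : ℂ) h Finset.univ) (multiSupport D) :=
    continuousOn_nested_dumbbell hs hr hρ hρδ hrat
  have hcontΓ : ContinuousOn (nested (τ : ℂ) h Finset.univ) (multiSupport Γ) :=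
    continuousOn_nested_of_circle_neg_one hs hr (R := fun _ => ρ) hσ hσδ
      (fun _ => ⟨hρ, hρδ.le, hρσ'.ne⟩) hΓB hΓj (fun B hB => absurd hB (hno B))
      (fun A _ hA => absurd hA (hno A)) (fun B hB => absurd hB (hno B)) hrat
  rw [multiIntegral_eq_sum_update j ({()} : Finset Unit) (fun _ => -1)
    (fun _ => Contour.circle (-1) σ) hcontD (fun _ _ => hcontΓ) fun u hu => ?_]
  · rw [Finset.sum_singleton, ← hΓ, hcirc, mul_zero]
  rw [Finset.sum_singleton]
  have huB : ∀ B < j, ‖u B‖ = r B ∨ ‖u B + τ‖ = ρ := fun B hB =>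
    (mem_support_dumbbell (hr.pos B) hρ).1 (hu B hB.ne)
  set S : Set ℂ := {p | p = 0 ∨ p = -(τ : ℂ) ∨ ∃ B < j, p = u B / τ} with hS
  have hfS : RatOn S (fun a => nested (τ : ℂ) h Finset.univ (Function.update u j a)) := by
    simp only [nested_update]
    refine (RatOn.const _ _).mul (RatOn.mul ?_ (ratOn_prod_cross hτ (Finset.notMem_erase j _)
      fun B hB => ⟨fun h => Or.inr (Or.inr ⟨B, h, rfl⟩), fun h => absurd h (hno B)⟩))
    have : h j = fun a =>
        spaceFactor (τ : ℂ) a ^ k * (spaceFactor (τ : ℂ) a - τ) / (1 * a + 0) := by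
      rw [hhj]
      funext a
      simp only [oneBody, zpow_natCast, pow_zero]
      ring
    rw [this]
    have hsf : RatOn S (spaceFactor (τ : ℂ)) := ratOn_spaceFactor hτ (Or.inr (Or.inl rfl))
    exact RatOn.div_linear ((hsf.pow k).mul (hsf.sub (RatOn.const _ _)))
      (fun a ha => Or.inl (by linear_combination ha)) (Or.inl one_ne_zero)
  have hrj := hr.le j
  have hrj' := hr.pos j
  have hSp : ∀ p ∈ S, ‖p‖ < 2 ∧ p ∉ (D j).support ∧ p ∉ (Contour.circle (-1) σ).support ∧
      (D j).winding p + (Contour.circle (-1) σ).winding p = 1 := by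
    intro p hp
    rw [hD, mem_support_dumbbell hrj' hρ, Contour.mem_support_circle hσ, sub_neg_eq_add]
    rcases hp with rfl | rfl | ⟨B, hB, rfl⟩
    · have e1 : ‖(0 : ℂ) + τ‖ = τ := by rw [zero_add, Complex.norm_of_nonneg h3.le]
      rw [winding_dumbbell_of_far hρ (by linarith), winding_circle_zero_of_lt (by simpa using hrj'),
        Contour.winding_circle_of_notMem hσ (by simp; linarith), e1, zero_add, norm_zero, norm_one]
      refine ⟨by norm_num, ?_, by linarith, add_zero 1⟩
      rintro (h | h) <;> linarith
    · have e1 : ‖-(τ : ℂ)‖ = τ := by rw [norm_neg, Complex.norm_of_nonneg h3.le]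
      have e2 := basePoles_far hs (p := -(τ : ℂ)) (by simp [basePoles])
      rw [winding_dumbbell_of_near (by simpa using hρ),
        winding_circle_zero_of_gt hrj' (by linarith),
        Contour.winding_circle_of_notMem hσ (by rw [sub_neg_eq_add]; linarith), e1, neg_add_cancel,
        norm_zero]
      refine ⟨by linarith, ?_, by linarith, by norm_num⟩
      rintro (h | h) <;> linarith
    · rcases div_tau_cases hs (hr.lt B j hB) hrj hρδ (huB B hB) with ⟨e1, e2, e3⟩ | ⟨e1, e2, e3, e4⟩
      · rw [winding_dumbbell_of_far hρ (by linarith), winding_circle_zero_of_lt e1,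
          Contour.winding_circle_of_notMem hσ (by rw [sub_neg_eq_add]; linarith)]
        refine ⟨by linarith, ?_, by linarith, add_zero 1⟩
        rintro (h | h) <;> linarith
      · rw [winding_dumbbell_of_far hρ (by linarith), winding_circle_zero_of_gt hrj' (by linarith),
          Contour.winding_circle_of_mem (by rw [sub_neg_eq_add]; linarith)]
        have e5 := norm_sub_le (u B / (τ : ℂ) + 1) 1
        rw [add_sub_cancel_right, norm_one] at e5
        refine ⟨by linarith, ?_, by linarith, zero_add 1⟩
        rintro (h | h) <;> linarith
  -- the integrand is `O(a⁻²)`, as `spaceFactor τ a - τ` is `O(a⁻¹)`; all poles are in `‖p‖ < 2`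
  have hbig : (Contour.circle 0 2).integral
      (fun a => nested (τ : ℂ) h Finset.univ (Function.update u j a)) = 0 := by
    refine hfS.integral_circle_eq_zero
      (C := ‖nested (τ : ℂ) h (Finset.univ.erase j) u‖ * (3 ^ k * 2 * (8 / τ) ^ n)) two_pos
      (fun p hp => by rw [sub_zero]; exact (hSp p hp).1) fun a ha => ?_
    rw [sub_zero] at ha ⊢
    have hcard : (Finset.univ.erase j).card = n := by
      rw [Finset.card_erase_of_mem (Finset.mem_univ j), Finset.card_univ, Fintype.card_fin]
      rfl
    have e1 : ‖∏ B ∈ Finset.univ.erase j, cross (τ : ℂ) j B a (u B)‖ ≤ (8 / τ) ^ n := by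
      rw [norm_prod]
      refine (Finset.prod_le_prod (g := fun _ => 8 / τ) (fun _ _ => norm_nonneg _)
        fun B hB => ?_).trans_eq (by rw [Finset.prod_const, hcard])
      have hB' := hlt B (Finset.ne_of_mem_erase hB)
      exact norm_cross_le hs (hr.le B) (by linarith) hB' (huB B hB') ha
    have e2 : ‖h j a‖ ≤ 3 ^ k / ‖a‖ * (2 / ‖a‖) := by
      rw [hhj]
      simp only [oneBody, zpow_natCast, pow_zero, one_mul]
      rw [norm_mul, norm_div, norm_pow]
      gcongr
      · exact norm_spaceFactor_le h3 h7 ha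
      · exact norm_spaceFactor_sub_le h3 h7 ha
    rw [nested_update, norm_mul, norm_mul]
    calc _ ≤ ‖nested (τ : ℂ) h (Finset.univ.erase j) u‖ *
          ((3 ^ k / ‖a‖ * (2 / ‖a‖)) * (8 / τ) ^ n) := by gcongr
      _ = _ := by ring
  have := hfS.sum_integral_eq_zero Finset.univ ![(1 : ℂ), 1, -1]
    ![D j, Contour.circle (-1) σ, Contour.circle 0 2]
    (by
      intro l _ a ha hmem
      obtain ⟨e0, e1, e2, e3⟩ := hSp a ha
      fin_cases l
      · exact e1 hmem
      · exact e2 hmem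
      · have := (Contour.mem_support_circle two_pos).1 hmem
        rw [sub_zero] at this
        exact e0.ne this)
    (by
      intro a ha
      obtain ⟨e0, e1, e2, e3⟩ := hSp a ha
      simp only [Fin.sum_univ_three, Matrix.cons_val_zero, Matrix.cons_val_one, Matrix.cons_val]
      rw [winding_circle_zero_of_lt e0]
      linear_combination e3)
  simp only [Fin.sum_univ_three, Matrix.cons_val_zero, Matrix.cons_val_one, Matrix.cons_val] at this
  linear_combination this + hbig

end Dumbbells

end SixVertex

namespace SixVertex

open Filter Topology

/-! ### Deformation of the contours to dumbbells -/

section Deformation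

variable {τ κ δ : ℝ} {L n : ℕ}

/-- The contours of the first `m` variables are replaced by dumbbells. -/
noncomputable def mixed (τ : ℝ) (r : Fin L → ℝ) (ρ : ℝ) (Γ : Fin L → Contour) (m : ℕ) (A : Fin L) :
    Contour :=
  if (A : ℕ) < m then dumbbell τ (r A) ρ else Γ A

theorem mixed_update (τ : ℝ) (r : Fin L → ℝ) (ρ : ℝ) (Γ : Fin L → Contour) (j : Fin L) :
    Function.update (mixed τ r ρ Γ j) j (dumbbell τ (r j) ρ) = mixed τ r ρ Γ (j + 1) := by
  funext A
  by_cases hA : A = j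
  · subst hA
    rw [Function.update_self, mixed, if_pos (Nat.lt_succ_self _)]
  · rw [Function.update_of_ne hA, mixed, mixed]
    have : (A : ℕ) ≠ j := fun h => hA (Fin.ext h)
    refine if_congr ?_ rfl rfl
    omega

/-- The length `δ` is small with respect to the contours `Γ`: the points `u_B` keep the distance `δ`
from `-1`, and the points `τ u_B` keep it from `0` and, if a contour of an earlier variable winds
around `-1`, from `-1`. -/
structure Small (τ δ : ℝ) (Γ : Fin L → Contour) : Prop where
  zero : ∀ A, ∀ u ∈ (Γ A).support, δ < ‖τ * u‖
  one : ∀ A B, A < B → ∀ u ∈ (Γ B).support, δ < ‖u + 1‖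
  one' : ∀ A B, A < B → (Γ A).winding (-1) ≠ 0 → ∀ u ∈ (Γ B).support, δ < ‖τ * u + 1‖

theorem eventually_lt_norm {K : Set ℂ} (hK : IsCompact K) {g : ℂ → ℂ} (hg : Continuous g)
    (h0 : ∀ u ∈ K, g u ≠ 0) : ∀ᶠ δ in 𝓝[>] (0 : ℝ), ∀ u ∈ K, δ < ‖g u‖ := by
  rcases K.eq_empty_or_nonempty with rfl | hne
  · simp
  · obtain ⟨u₀, hu₀, hmin⟩ := hK.exists_isMinOn hne hg.norm.continuousOn
    have : ∀ᶠ δ in 𝓝[>] (0 : ℝ), δ < ‖g u₀‖ :=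
      eventually_nhdsWithin_of_eventually_nhds (gt_mem_nhds (norm_pos_iff.2 (h0 u₀ hu₀)))
    filter_upwards [this] with δ hδ u hu
    exact hδ.trans_le (hmin hu)

theorem exists_scale_small (h0 : 0 < τ) (h1 : τ < 1) (hκ : 0 < κ) (hκ1 : κ < 1)
    {Γ : Fin L → Contour} (h_zero : ∀ A, (Γ A).Includes 0)
    (h_tau : ∀ A, (Γ A).Includes (-(τ : ℂ)))
    (h_cross : ∀ A B, A < B → ∀ u ∈ (Γ B).support, (Γ A).Excludes (τ * u)) :
    ∃ δ, Scale τ κ δ ∧ Small τ δ Γ := by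
  have hτ : (τ : ℂ) ≠ 0 := by exact_mod_cast h0.ne'
  have e1 : ∀ᶠ δ in 𝓝[>] (0 : ℝ), ∀ A, ∀ u ∈ (Γ A).support, δ < ‖τ * u‖ := by
    refine eventually_all.2 fun A => eventually_lt_norm (Γ A).isCompact_support (by fun_prop)
      fun u hu h => (h_zero A).1 ?_
    rwa [(mul_eq_zero.1 h).resolve_left hτ] at hu
  -- `τ u_B ≠ -τ` for `A < B`, as the contour of `u_A` winds around `-τ` but not around `τ u_B`
  have e2 : ∀ᶠ δ in 𝓝[>] (0 : ℝ), ∀ A B, A < B → ∀ u ∈ (Γ B).support, δ < ‖u + 1‖ := by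
    refine eventually_all.2 fun A => eventually_all.2 fun B => eventually_imp_distrib_left.2
      fun hAB => eventually_lt_norm (Γ B).isCompact_support (by fun_prop) fun u hu h => ?_
    have hu1 : u = -1 := by linear_combination h
    have := (h_cross A B hAB u hu).2
    rw [hu1, mul_neg_one, (h_tau A).2] at this
    exact one_ne_zero this
  -- similarly `τ u_B ≠ -1` if the contour of `u_A` winds around `-1`
  have e3 : ∀ᶠ δ in 𝓝[>] (0 : ℝ), ∀ A B, A < B → (Γ A).winding (-1) ≠ 0 →
      ∀ u ∈ (Γ B).support, δ < ‖τ * u + 1‖ := by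
    refine eventually_all.2 fun A => eventually_all.2 fun B => eventually_imp_distrib_left.2
      fun hAB => eventually_imp_distrib_left.2 fun hw =>
        eventually_lt_norm (Γ B).isCompact_support (by fun_prop) fun u hu h => hw ?_
    have hu1 : τ * u = -1 := by linear_combination h
    rw [← hu1]
    exact (h_cross A B hAB u hu).2
  have e4 : ∀ c : ℝ, 0 < c → ∀ᶠ δ in 𝓝[>] (0 : ℝ), 4 * δ < c := fun c hc =>
    eventually_nhdsWithin_of_eventually_nhds
      ((continuous_const.mul continuous_id).tendsto' (0 : ℝ) 0 (by simp) |>.eventually_lt_const hc)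
  have h2 : 1 < κ⁻¹ := (one_lt_inv₀ hκ).2 hκ1
  obtain ⟨δ, h3, h4, h5, h6, h7, h8, h9⟩ := (e1.and (e2.and (e3.and ((e4 _ (pow_pos h0 2)).and
    ((e4 _ (mul_pos h0 (sub_pos.2 h1))).and ((e4 _ (sub_pos.2 h2)).and
      (eventually_mem_nhdsWithin)))))) ).exists
  exact ⟨δ, ⟨h0, h1, hκ, h9, h6, h7, h8⟩, ⟨h3, h4, h5⟩⟩

theorem exists_radii (hs : Scale τ κ δ) (L : ℕ) : ∃ r : Fin L → ℝ, Radii τ δ r := by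
  have h0 := hs.tau_pos
  have h1 : (τ / 2) < 1 := by linarith [hs.tau_lt]
  have h2 : 0 < τ / 2 := by linarith
  refine ⟨fun A => δ * (τ / 2) ^ (L - A), fun A => mul_pos hs.pos (pow_pos h2 _), fun A => ?_,
    fun A B hAB => ?_⟩
  · exact mul_le_of_le_one_right hs.pos.le (pow_le_one₀ h2.le h1.le)
  · have e1 : (τ / 2) ^ (L - (A : ℕ)) ≤ (τ / 2) ^ (L - (B : ℕ) + 1) :=
      pow_le_pow_of_le_one h2.le h1.le (by have := Fin.lt_def.1 hAB; omega)
    have e2 := pow_pos h2 (L - (B : ℕ))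
    rw [pow_succ] at e1
    have e3 : δ * (τ / 2) ^ (L - (A : ℕ)) ≤ δ * ((τ / 2) ^ (L - (B : ℕ)) * (τ / 2)) :=
      mul_le_mul_of_nonneg_left e1 hs.pos.le
    nlinarith [mul_pos (mul_pos hs.pos e2) h0]

/-- The contour of the variable `j` is homologous, in the complement of the poles, to a dumbbell and
a multiple of a small circle around `-1`; the latter does not contribute. -/
theorem multiIntegral_mixed_succ (hs : Scale τ κ δ) {r : Fin L → ℝ} (hr : Radii τ δ r)
    {ρ : ℝ} (hρ : 0 < ρ) (hρδ : ρ < τ * δ) (t x : ℕ) {Γ : Fin L → Contour} (hΓ : Small τ δ Γ)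
    (h_zero : ∀ A, (Γ A).Includes 0) (h_tau : ∀ A, (Γ A).Includes (-(τ : ℂ)))
    (h_kappa : ∀ A, (Γ A).Excludes (-(κ : ℂ)⁻¹))
    (h_cross : ∀ A B, A < B → ∀ u ∈ (Γ B).support, (Γ A).Excludes (τ * u)) (j : Fin L) :
    multiIntegral (mixed τ r ρ Γ j)
        (nested (τ : ℂ) (fun _ => oneBody (τ : ℂ) κ t x) Finset.univ) =
      multiIntegral (mixed τ r ρ Γ (j + 1))
        (nested (τ : ℂ) (fun _ => oneBody (τ : ℂ) κ t x) Finset.univ) := by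
  have hτ := hs.tau_ne_zero
  have hκ := hs.kappa_ne_zero
  have h2 := hs.pos
  have h3 := hs.tau_pos
  have h4 := hs.four_lt_tau
  have h5 := hs.tau_mul_lt
  have h7 := hs.tau_lt
  set F := nested (τ : ℂ) (fun _ : Fin L => oneBody (τ : ℂ) κ t x) Finset.univ with hF
  have hrat : RatOn (basePoles (τ : ℂ) κ) (oneBody (τ : ℂ) κ t x) := ratOn_oneBody hτ hκ t x
  have hpolesΓ : ∀ B, ∀ p ∈ basePoles (τ : ℂ) κ, p ∉ (Γ B).support := by
    intro B p hp
    simp only [basePoles, Set.mem_insert_iff, Set.mem_singleton_iff] at hp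
    rcases hp with rfl | rfl | rfl
    exacts [(h_zero B).1, (h_tau B).1, (h_kappa B).1]
  have hsepΓ : Separated (τ : ℂ) Γ := fun A B hAB a ha b hb hab =>
    (h_cross A B hAB b hb).1 (hab ▸ ha)
  have hcont : ∀ m, ContinuousOn F (multiSupport (mixed τ r ρ Γ m)) := by
    intro m
    refine continuousOn_nested (fun A B hAB a ha b hb hab => ?_) fun A =>
      hrat.continuousOn.mono fun u hu hp => ?_
    · have hAB' := Fin.lt_def.1 hAB
      rw [mixed] at ha hb
      split_ifs at ha hb with hA hB hB
      · rw [mem_support_dumbbell (hr.pos _) hρ] at ha hb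
        exact ne_tau_mul_of_dumbbell hs (hr.le A) (hr.le B) (hr.lt A B hAB) hρδ.le hρδ.le ha hb hab
      · rw [mem_support_dumbbell (hr.pos _) hρ, hab] at ha
        rcases ha with ha | ha
        · have := hΓ.zero B b hb
          have := hr.le A
          linarith
        · rw [hs.norm_tau_mul_add_tau] at ha
          have := hΓ.one A B hAB b hb
          have : τ * δ < τ * ‖b + 1‖ := by gcongr
          linarith
      · omega
      · exact hsepΓ A B hAB a ha b hb hab
    · rw [mixed] at hu
      split_ifs at hu
      · exact notMem_dumbbell_of_basePoles hs (hr.pos A) (hr.le A) hρ hρδ.le hp hu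
      · exact hpolesΓ A u hp hu
  have hlt : ∀ B < j, mixed τ r ρ Γ j B = dumbbell τ (r B) ρ := fun B hB =>
    if_pos (Fin.lt_def.1 hB)
  have hge : ∀ B, j ≤ B → mixed τ r ρ Γ j B = Γ B := fun B hB =>
    if_neg (not_lt.2 (Fin.le_def.1 hB))
  obtain ⟨σ, hρσ, hσδ⟩ : ∃ σ, ρ / τ < σ ∧ σ < δ := exists_between (by
    rw [div_lt_iff₀ h3]; linarith)
  have hσ : 0 < σ := (div_pos hρ h3).trans hρσ
  have hρσ' : ρ < τ * σ := by rw [div_lt_iff₀ h3] at hρσ; linarith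
  set w := (Γ j).winding (-1) with hw
  set C : Contour := Contour.circle (-1) σ with hC
  set D : Contour := dumbbell τ (r j) ρ with hD
  have hrj := hr.le j
  have hrj' := hr.pos j
  have hCsupp : ∀ p, p ∈ C.support ↔ ‖p + 1‖ = σ := fun p => by
    rw [hC, Contour.mem_support_circle hσ, sub_neg_eq_add]
  have hDsupp : ∀ p, p ∈ D.support ↔ ‖p‖ = r j ∨ ‖p + τ‖ = ρ := fun p =>
    mem_support_dumbbell hrj' hρ
  have hCfar : ∀ p, σ < ‖p + 1‖ → C.winding p = 0 := fun p hp =>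
    Contour.winding_circle_of_notMem hσ (by rwa [sub_neg_eq_add])
  -- the comparison of the integrals over the variable `j`
  have hone : ∀ u : Fin L → ℂ, (∀ i ≠ j, u i ∈ (mixed τ r ρ Γ j i).support) →
      (Γ j).integral (fun a => F (Function.update u j a)) =
        D.integral (fun a => F (Function.update u j a)) +
          w * C.integral (fun a => F (Function.update u j a)) := by
    intro u hu
    set S : Set ℂ := basePoles (τ : ℂ) κ ∪ crossPoles (τ : ℂ) j u with hS
    have hfS : RatOn S fun a => F (Function.update u j a) := by
      simp only [hF, nested_update]
      exact (RatOn.const _ _).mul ((hrat.mono Set.subset_union_left).mul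
        ((ratOn_prod_cross_univ hτ j u).mono Set.subset_union_right))
    have hSp : ∀ p ∈ S, p ∉ (Γ j).support ∧ p ∉ D.support ∧ (w ≠ 0 → p ∉ C.support) ∧
        (Γ j).winding p = D.winding p + w * C.winding p := by
      rintro p (hp | ⟨B, hB, rfl⟩ | ⟨B, hB, rfl⟩)
      · have e1 := basePoles_far hs hp
        refine ⟨hpolesΓ j p hp, notMem_dumbbell_of_basePoles hs hrj' hrj hρ hρδ.le hp,
          fun _ h => ?_, ?_⟩
        · rw [hCsupp] at h
          linarith
        · rw [hCfar p (by linarith), mul_zero, add_zero]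
          rcases basePoles_cases hs hp with rfl | ⟨e2, rfl | ⟨rfl, e3⟩⟩
          · rw [(h_zero j).2, winding_dumbbell_of_far hρ, winding_circle_zero_of_lt (by simpa)]
            rw [zero_add, Complex.norm_of_nonneg h3.le]
            linarith
          · rw [(h_tau j).2, winding_dumbbell_of_near (by simpa),
              winding_circle_zero_of_gt hrj' (by linarith), zero_add]
          · rw [(h_kappa j).2, winding_dumbbell_of_far hρ (by linarith),
              winding_circle_zero_of_gt hrj' (by linarith)]
      · have huB := hu B hB.ne
        rw [hlt B hB, mem_support_dumbbell (hr.pos B) hρ] at huB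
        have z1 : ∀ v ∈ (Γ j).support, δ < ‖v‖ := fun v hv => by
          have := hΓ.zero j v hv
          rw [hs.norm_tau_mul] at this
          nlinarith [norm_nonneg v]
        have z2 := hΓ.one B j hB
        rcases div_tau_cases hs (hr.lt B j hB) hrj hρδ huB with ⟨e1, e2, e3⟩ | ⟨e1, e2, e3, e4⟩
        · refine ⟨fun h => ?_, fun h => ?_, fun _ h => ?_, ?_⟩
          · have := z1 _ h
            linarith
          · rcases (hDsupp _).1 h with h | h <;> linarith
          · rw [hCsupp] at h
            linarith
          · rw [hCfar _ (by linarith), mul_zero, add_zero, winding_dumbbell_of_far hρ (by linarith),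
              winding_circle_zero_of_lt e1, ← (h_zero j).2]
            -- the contour winds equally around `0` and the pole, which is close to `0`
            refine Contour.winding_eq_of_norm_sub_lt _ fun v hv => ?_
            rw [sub_zero, sub_zero]
            have := z1 v hv
            linarith
        · refine ⟨fun h => ?_, fun h => ?_, fun _ h => ?_, ?_⟩
          · have := z2 _ h
            linarith
          · rcases (hDsupp _).1 h with h | h <;> linarith
          · rw [hCsupp] at h
            linarith
          · rw [winding_dumbbell_of_far hρ (by linarith), winding_circle_zero_of_gt hrj'
              (by linarith), hC, Contour.winding_circle_of_mem (by rw [sub_neg_eq_add]; linarith),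
              mul_one, zero_add, hw]
            -- the contour winds equally around `-1` and the pole, which is close to `-1`
            refine Contour.winding_eq_of_norm_sub_lt _ fun v hv => ?_
            rw [sub_neg_eq_add, sub_neg_eq_add]
            have := z2 v hv
            linarith
      · have huB := hu B hB.ne'
        rw [hge B hB.le] at huB
        have e1 := hΓ.zero B _ huB
        have e2 : τ * δ < ‖(τ : ℂ) * u B + τ‖ := by
          rw [hs.norm_tau_mul_add_tau]
          have := hΓ.one j B hB _ huB
          gcongr
        refine ⟨(h_cross j B hB _ huB).1, fun h => ?_, fun hw0 h => ?_, ?_⟩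
        · rcases (hDsupp _).1 h with h | h <;> linarith
        · have := hΓ.one' j B hB hw0 _ huB
          rw [hCsupp] at h
          linarith
        · rw [(h_cross j B hB _ huB).2, winding_dumbbell_of_far hρ (by linarith),
            winding_circle_zero_of_gt hrj' (by linarith), zero_add]
          by_cases hw0 : w = 0
          · rw [hw0, zero_mul]
          · rw [hCfar _ (hσδ.trans (hΓ.one' j B hB hw0 _ huB)), mul_zero]
    by_cases hw0 : w = 0
    · have := hfS.sum_integral_eq_zero Finset.univ ![(1 : ℂ), -1] ![Γ j, D]
        (by
          intro l _ a ha hmem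
          obtain ⟨e0, e1, -, -⟩ := hSp a ha
          fin_cases l
          exacts [e0 hmem, e1 hmem])
        (by
          intro a ha
          obtain ⟨-, -, -, e3⟩ := hSp a ha
          simp only [Fin.sum_univ_two, Matrix.cons_val_zero, Matrix.cons_val_one]
          rw [e3, hw0]
          ring)
      simp only [Fin.sum_univ_two, Matrix.cons_val_zero, Matrix.cons_val_one] at this
      rw [hw0]
      linear_combination this
    · have := hfS.sum_integral_eq_zero Finset.univ ![(1 : ℂ), -1, -w] ![Γ j, D, C]
        (by
          intro l _ a ha hmem
          obtain ⟨e0, e1, e2, -⟩ := hSp a ha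
          fin_cases l
          exacts [e0 hmem, e1 hmem, e2 hw0 hmem])
        (by
          intro a ha
          obtain ⟨-, -, -, e3⟩ := hSp a ha
          simp only [Fin.sum_univ_three, Matrix.cons_val_zero, Matrix.cons_val_one, Matrix.cons_val]
          rw [e3]
          ring)
      simp only [Fin.sum_univ_three, Matrix.cons_val_zero, Matrix.cons_val_one, Matrix.cons_val]
        at this
      linear_combination this
  have hcD : ContinuousOn F (multiSupport (Function.update (mixed τ r ρ Γ j) j D)) := by
    rw [hD, mixed_update]
    exact hcont _
  rw [← mixed_update τ r ρ Γ j, ← hD]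
  by_cases hw0 : w = 0
  · rw [multiIntegral_eq_sum_update j ({()} : Finset Unit) (fun _ => 1) (fun _ => D) (hcont _)
      (fun _ _ => hcD) fun u hu => by
        rw [Finset.sum_singleton, hge j le_rfl, hone u hu, hw0]
        ring, Finset.sum_singleton, one_mul]
  · set G := Function.update (mixed τ r ρ Γ j) j C with hG
    have hGj : G j = Contour.circle (-1) σ := Function.update_self _ _ _
    have hGlt : ∀ B < j, G B = dumbbell τ (r B) ρ := fun B hB => by
      rw [hG, Function.update_of_ne hB.ne, hlt B hB]
    have hGgt : ∀ B, j < B → G B = Γ B := fun B hB => by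
      rw [hG, Function.update_of_ne hB.ne', hge B hB.le]
    have hclear : ∀ B, j < B → ∀ u ∈ (G B).support, Clear τ δ u := fun B hB u hu => by
      rw [hGgt B hB] at hu
      exact ⟨hΓ.one j B hB u hu, hΓ.one' j B hB hw0 u hu, hΓ.zero B u hu⟩
    have hsep : ∀ A B, j < A → A < B → ∀ a ∈ (G A).support, ∀ b ∈ (G B).support, a ≠ τ * b := by
      intro A B hA hAB
      rw [hGgt A hA, hGgt B (hA.trans hAB)]
      exact hsepΓ A B hAB
    have hpoles : ∀ B, j < B → ∀ p ∈ basePoles (τ : ℂ) κ, p ∉ (G B).support := fun B hB => by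
      rw [hGgt B hB]
      exact hpolesΓ B
    have hcC : ContinuousOn F (multiSupport G) :=
      continuousOn_nested_of_circle_neg_one hs hr (R := fun _ => ρ) hσ hσδ
        (fun _ => ⟨hρ, hρδ.le, hρσ'.ne⟩) hGlt hGj hclear hsep hpoles fun _ => hrat
    have hcirc : multiIntegral G F = 0 :=
      multiIntegral_eq_zero_of_circle_neg_one hs hr hρ hρσ' hσδ hGlt hGj hclear hsep hpoles
        (fun _ => hrat) fun _ _ => exists_ratOn_oneBody_mul_oneBody hs t le_rfl
    rw [multiIntegral_eq_sum_update j Finset.univ ![(1 : ℂ), w] ![D, C] (hcont _)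
      (fun i _ => by
        fin_cases i
        exacts [hcD, hcC]) fun u hu => by
        rw [hge j le_rfl, hone u hu]
        simp]
    simp only [Fin.sum_univ_two, Matrix.cons_val_zero, Matrix.cons_val_one]
    rw [← hG, hcirc]
    ring

theorem multiIntegral_eq_dumbbellIntegral (hs : Scale τ κ δ) {r : Fin L → ℝ} (hr : Radii τ δ r)
    {ρ : ℝ} (hρ : 0 < ρ) (hρδ : ρ < τ * δ) (t x : ℕ) {Γ : Fin L → Contour} (hΓ : Small τ δ Γ)
    (h_zero : ∀ A, (Γ A).Includes 0) (h_tau : ∀ A, (Γ A).Includes (-(τ : ℂ)))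
    (h_kappa : ∀ A, (Γ A).Excludes (-(κ : ℂ)⁻¹))
    (h_cross : ∀ A B, A < B → ∀ u ∈ (Γ B).support, (Γ A).Excludes (τ * u)) :
    multiIntegral Γ (nested (τ : ℂ) (fun _ => oneBody (τ : ℂ) κ t x) Finset.univ) =
      dumbbellIntegral τ κ r ρ t (fun _ => x) := by
  have key : ∀ m ≤ L, multiIntegral Γ (nested (τ : ℂ) (fun _ => oneBody (τ : ℂ) κ t x)
      Finset.univ) = multiIntegral (mixed τ r ρ Γ m)
        (nested (τ : ℂ) (fun _ => oneBody (τ : ℂ) κ t x) Finset.univ) := by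
    intro m
    induction m with
    | zero => intro _; rfl
    | succ m ih =>
      intro hm
      rw [ih (by omega)]
      exact multiIntegral_mixed_succ hs hr hρ hρδ t x hΓ h_zero h_tau h_kappa h_cross ⟨m, hm⟩
  rw [key L le_rfl, dumbbellIntegral]
  have : mixed τ r ρ Γ L = fun A => dumbbell τ (r A) ρ := funext fun A => if_pos A.2
  rw [this]

end Deformation

end SixVertex

namespace SixVertex

open Filter

/-! ### Configurations -/

namespace WInf

/-- A set of integers that is bounded below and contains all large integers is the set of positions
of a configuration. -/
theorem exists_range_eq {B : Set ℤ} {m M : ℤ} (hm : ∀ x ∈ B, m < x) (hM : ∀ x, M < x → x ∈ B) :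
    ∃ X : WInf, Set.range X.1 = B := by
  classical
  set p : ℕ → Prop := fun k => m + k ∈ B with hp
  have hlarge : ∀ k : ℕ, (M - m).toNat < k → p k := fun k hk => hM _ (by omega)
  have hinf : (Set.ofPred p).Infinite := by
    refine Set.infinite_of_not_bddAbove fun ⟨b, hb⟩ => ?_
    have := hb (hlarge (max b (M - m).toNat + 1) (by omega))
    omega
  have hmono := Nat.nth_strictMono hinf
  refine ⟨⟨fun i => m + Nat.nth p i, fun i j hij => ?_, ?_⟩, ?_⟩
  · have := hmono hij
    dsimp only
    omega
  · filter_upwards [eventually_gt_atTop (M - m).toNat] with i hi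
    have h1 : p (Nat.nth p i + 1) := hlarge _ (by have := hmono.le_apply (x := i); omega)
    have h2 : Nat.count p (Nat.nth p i + 1) = i + 1 := by
      rw [Nat.count_succ, Nat.count_nth_of_infinite hinf, if_pos (Nat.nth_mem_of_infinite hinf i)]
    have h3 : Nat.nth p (i + 1) = Nat.nth p i + 1 := by rw [← h2, Nat.nth_count h1]
    rw [h3]
    push_cast
    ring
  · ext x
    constructor
    · rintro ⟨i, rfl⟩
      exact Nat.nth_mem_of_infinite hinf i
    · intro hx
      have hmx := hm x hx
      have h1 : p (x - m).toNat := by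
        have : m + ((x - m).toNat : ℤ) = x := by omega
        rw [hp]
        dsimp only
        rwa [this]
      refine ⟨Nat.count p (x - m).toNat, ?_⟩
      dsimp only
      rw [Nat.nth_count h1]
      omega

theorem ext_range {X Y : WInf} (h : Set.range X.1 = Set.range Y.1) : X = Y :=
  Subtype.ext ((X.2.1.range_inj Y.2.1).1 h)

theorem add_le (X : WInf) (i : ℕ) : X.1 0 + i ≤ X.1 i := by
  induction i with
  | zero => simp
  | succ i ih =>
    have := X.2.1 (Nat.lt_succ_self i)
    push_cast
    simp only [Nat.succ_eq_add_one] at this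
    omega

theorem exists_forall_lt (X : WInf) : ∃ m, ∀ x ≤ m, x ∉ Set.range X.1 := by
  refine ⟨X.1 0 - 1, ?_⟩
  rintro _ hx ⟨i, rfl⟩
  have := X.2.1.monotone (Nat.zero_le i)
  omega

theorem exists_forall_mem (X : WInf) : ∃ M, ∀ x, M < x → x ∈ Set.range X.1 := by
  obtain ⟨N, hN⟩ := eventually_atTop.1 X.2.2
  have h : ∀ k : ℕ, X.1 (N + k) = X.1 N + k := by
    intro k
    induction k with
    | zero => simp
    | succ k ih =>
      rw [← add_assoc, hN _ (Nat.le_add_right N k), ih]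
      push_cast
      ring
  refine ⟨X.1 N, fun x hx => ⟨N + (x - X.1 N).toNat, ?_⟩⟩
  rw [h]
  omega

theorem finite_le (X : WInf) (x : ℤ) : {i : ℕ | X.1 i ≤ x}.Finite := by
  refine (Set.finite_le_nat (x - X.1 0).toNat).subset fun i hi => ?_
  have := X.add_le i
  simp only [Set.mem_ofPred_eq] at hi ⊢
  omega

end WInf

theorem count_eq_zero {X : WInf} {m : ℤ} (hm : ∀ x ≤ m, x ∉ Set.range X.1) : count m X = 0 := by
  rw [count, Set.ncard_eq_zero (X.finite_le m)]
  ext i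
  simp only [Set.mem_ofPred_eq, Set.mem_empty_iff_false, iff_false]
  exact fun h => hm _ h ⟨i, rfl⟩

open Classical in
theorem count_add_one (X : WInf) (x : ℤ) :
    count (x + 1) X = count x X + if x + 1 ∈ Set.range X.1 then 1 else 0 := by
  split_ifs with h
  · obtain ⟨j, hj⟩ := h
    have : {i : ℕ | X.1 i ≤ x + 1} = insert j {i : ℕ | X.1 i ≤ x} := by
      ext i
      simp only [Set.mem_ofPred_eq, Set.mem_insert_iff]
      rw [← X.2.1.injective.eq_iff, hj]
      omega
    rw [count, this, Set.ncard_insert_of_notMem _ (X.finite_le x), count]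
    simp only [Set.mem_ofPred_eq]
    omega
  · have : {i : ℕ | X.1 i ≤ x + 1} = {i : ℕ | X.1 i ≤ x} := by
      ext i
      simp only [Set.mem_ofPred_eq]
      have : X.1 i ≠ x + 1 := fun h' => h ⟨i, h'⟩
      omega
    rw [count, this, count, add_zero]

theorem count_mono (X : WInf) {x y : ℤ} (h : x ≤ y) : count x X ≤ count y X :=
  Set.ncard_le_ncard (fun _ hi => le_trans hi h) (X.finite_le y)

theorem count_step (y : ℕ) : count y step = y := by
  have : {i : ℕ | step.1 i ≤ y} = Set.Iio y := by
    ext i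
    simp only [step, Set.mem_ofPred_eq, Set.mem_Iio]
    omega
  rw [count, this, Set.ncard_Iio_nat]

end SixVertex

namespace SixVertex

open Filter Topology

/-! ### Rows as paths -/

/-- The weight of a vertex as a function of its south, west and east edges, `0` if there is no such
vertex. -/
def edgeWeight (β₁ β₂ : ℝ) : Bool → Bool → Bool → ℝ
  | true, false, false => β₁
  | true, false, true => 1 - β₁
  | true, true, false => 0
  | true, true, true => 1
  | false, false, false => 1
  | false, false, true => 0
  | false, true, false => 1 - β₂
  | false, true, true => β₂

/-- The vertex with given south, west and east edges (arbitrary if there is no such vertex). -/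
def Vertex.ofEdges : Bool → Bool → Bool → Vertex
  | true, false, false => b1
  | true, false, true => c1
  | true, true, _ => a2
  | false, false, _ => a1
  | false, true, false => c2
  | false, true, true => b2

theorem Vertex.weight_eq (β₁ β₂ : ℝ) (v : Vertex) :
    v.weight β₁ β₂ = edgeWeight β₁ β₂ v.south v.west v.east := by
  cases v <;> rfl

theorem Vertex.conservation (v : Vertex) :
    v.south.toNat + v.west.toNat = v.north.toNat + v.east.toNat := by
  cases v <;> rfl

theorem Vertex.ofEdges_spec {β₁ β₂ : ℝ} {s a b : Bool} (h : edgeWeight β₁ β₂ s a b ≠ 0) :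
    (ofEdges s a b).south = s ∧ (ofEdges s a b).west = a ∧ (ofEdges s a b).east = b := by
  cases s <;> cases a <;> cases b <;> simp_all [edgeWeight, ofEdges, south, west, east]

theorem Vertex.east_eq_false {v : Vertex} (hs : v.south = false) (hw : v.west = false) :
    v.east = false := by
  cases v <;> simp_all [south, west, east]

theorem Vertex.east_eq_true {v : Vertex} (hs : v.south = true) (hw : v.west = true) :
    v.east = true := by
  cases v <;> simp_all [south, west, east]

section EdgeWeight

variable {β₁ β₂ : ℝ}

theorem edgeWeight_nonneg (h₁ : 0 < β₁) (h₁' : β₁ < 1) (h₂ : 0 < β₂) (h₂' : β₂ < 1) (s a b : Bool) :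
    0 ≤ edgeWeight β₁ β₂ s a b := by
  cases s <;> cases a <;> cases b <;> simp [edgeWeight] <;> linarith

theorem edgeWeight_le_one (h₁ : 0 < β₁) (h₁' : β₁ < 1) (h₂ : 0 < β₂) (h₂' : β₂ < 1) (s a b : Bool) :
    edgeWeight β₁ β₂ s a b ≤ 1 := by
  cases s <;> cases a <;> cases b <;> simp [edgeWeight] <;> linarith

end EdgeWeight

section Row

variable {X Y : WInf} {ℓ : ℤ → Vertex}

theorem Sends.west_eq_false (h : Sends X Y ℓ) {m : ℤ} (hm : ∀ x ≤ m, x ∉ Set.range X.1) {x : ℤ}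
    (hx : x ≤ m + 1) : (ℓ x).west = false := by
  obtain ⟨N, hN⟩ := eventually_atBot.1 h.left
  rcases le_total x N with hxN | hxN
  · exact hN x hxN
  · revert hx
    induction x, hxN using Int.leInduction with
    | base => exact fun _ => hN N le_rfl
    | succ k _ ih =>
      intro hk
      rw [← h.flow]
      refine Vertex.east_eq_false ?_ (ih (by omega))
      rw [Bool.eq_false_iff, Ne, h.south]
      exact hm k (by omega)

theorem Sends.notMem (h : Sends X Y ℓ) {m : ℤ} (hm : ∀ x ≤ m, x ∉ Set.range X.1) :
    ∀ x ≤ m, x ∉ Set.range Y.1 := by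
  intro x hx
  rw [← h.north]
  have h1 := h.west_eq_false hm (x := x) (by omega)
  have h2 : (ℓ x).south = false := by
    rw [Bool.eq_false_iff, Ne, h.south]
    exact hm x hx
  generalize ℓ x = v at *
  cases v <;> simp_all [Vertex.south, Vertex.west, Vertex.north]

/-- The horizontal edges of a row record the change of the height function. -/
theorem Sends.count_add (h : Sends X Y ℓ) (x : ℤ) :
    count x Y + (ℓ x).east.toNat = count x X := by
  obtain ⟨m, hm⟩ := X.exists_forall_lt
  have h0 : ∀ x ≤ m, count x Y + (ℓ x).east.toNat = count x X := by
    intro x hx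
    rw [count_eq_zero fun z hz => hm z (hz.trans hx),
      count_eq_zero fun z hz => h.notMem hm z (hz.trans hx), h.flow,
      h.west_eq_false hm (by omega)]
    rfl
  rcases le_total x m with hx | hx
  · exact h0 x hx
  · induction x, hx using Int.leInduction with
    | base => exact h0 m le_rfl
    | succ k _ ih =>
      classical
      have hc := (ℓ (k + 1)).conservation
      have hX : (ℓ (k + 1)).south.toNat = if k + 1 ∈ Set.range X.1 then 1 else 0 := by
        split_ifs with hk
        · rw [(h.south _).2 hk]; rfl
        · rw [Bool.eq_false_iff.2 (mt (h.south _).1 hk)]; rfl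
      have hY : (ℓ (k + 1)).north.toNat = if k + 1 ∈ Set.range Y.1 then 1 else 0 := by
        split_ifs with hk
        · rw [(h.north _).2 hk]; rfl
        · rw [Bool.eq_false_iff.2 (mt (h.north _).1 hk)]; rfl
      rw [count_add_one, count_add_one, ← hX, ← hY]
      rw [← h.flow] at hc
      omega

end Row

section Path

variable {β₁ β₂ : ℝ} {X Y : WInf} {m : ℤ}

/-- The state of a path before the site with the number `k`: the path starts without a line, and it
has a line on the east edge of the site with the number `k` if `k` is not in `Z`. -/
def pathState (Z : Finset ℕ) : ℕ → Bool
  | 0 => false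
  | k + 1 => decide (k ∉ Z)

open Classical in
/-- The site with the number `k` (counted from `m + 1`) is occupied. -/
noncomputable def occupied (X : WInf) (m : ℤ) (k : ℕ) : Bool :=
  decide (m + 1 + k ∈ Set.range X.1)

theorem occupied_eq_true {k : ℕ} : occupied X m k = true ↔ m + 1 + k ∈ Set.range X.1 := by
  simp only [occupied, decide_eq_true_iff]

/-- A row from `X` to `Y` has no line on the east edges up to `m`, and the lines of the path given
by `Z` afterwards. -/
def Follows (X : WInf) (m : ℤ) (Z : Finset ℕ) (Y : WInf) : Prop :=
  ∃ ℓ, Sends X Y ℓ ∧ ∀ k : ℕ, (ℓ (m + 1 + k)).east = pathState Z (k + 1)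

theorem Follows.west {Z : Finset ℕ} {ℓ : ℤ → Vertex} (hm : ∀ x ≤ m, x ∉ Set.range X.1)
    (h : Sends X Y ℓ) (hZ : ∀ k : ℕ, (ℓ (m + 1 + k)).east = pathState Z (k + 1)) (k : ℕ) :
    (ℓ (m + 1 + k)).west = pathState Z k := by
  cases k with
  | zero => exact h.west_eq_false hm (by simp)
  | succ k =>
    rw [← hZ k, h.flow]
    congr 2
    push_cast
    ring

theorem Sends.south_eq {ℓ : ℤ → Vertex} (h : Sends X Y ℓ) (m : ℤ) (k : ℕ) :
    (ℓ (m + 1 + k)).south = occupied X m k := by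
  rw [Bool.eq_iff_iff, h.south, occupied_eq_true]

theorem Follows.unique_path {Z Z' : Finset ℕ} (h : Follows X m Z Y) (h' : Follows X m Z' Y) :
    Z = Z' := by
  obtain ⟨ℓ, h1, h2⟩ := h
  obtain ⟨ℓ', h1', h2'⟩ := h'
  obtain rfl := h1.unique h1'
  ext k
  have := (h2 k).symm.trans (h2' k)
  simpa [pathState, not_iff_not] using this

theorem Follows.unique {Z : Finset ℕ} {Y' : WInf} (hm : ∀ x ≤ m, x ∉ Set.range X.1)
    (h : Follows X m Z Y) (h' : Follows X m Z Y') : Y = Y' := by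
  obtain ⟨ℓ, h1, h2⟩ := h
  obtain ⟨ℓ', h1', h2'⟩ := h'
  refine WInf.ext_range (Set.ext fun x => ?_)
  rcases le_or_gt x m with hx | hx
  · exact iff_of_false (h1.notMem hm x hx) (h1'.notMem hm x hx)
  · obtain ⟨k, rfl⟩ : ∃ k : ℕ, x = m + 1 + k := ⟨(x - m - 1).toNat, by omega⟩
    rw [← h1.north, ← h1'.north]
    have e1 := (ℓ (m + 1 + k)).conservation
    have e2 := (ℓ' (m + 1 + k)).conservation
    rw [h1.south_eq, Follows.west hm h1 h2, h2] at e1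
    rw [h1'.south_eq, Follows.west hm h1' h2', h2'] at e2
    have e3 : (ℓ (m + 1 + k)).north.toNat = (ℓ' (m + 1 + k)).north.toNat := by omega
    generalize (ℓ (m + 1 + k)).north = a at e3 ⊢
    generalize (ℓ' (m + 1 + k)).north = b at e3 ⊢
    cases a <;> cases b <;> simp_all

/-- Paths of nonzero weight come from rows. -/
theorem exists_follows (hm : ∀ x ≤ m, x ∉ Set.range X.1) {Z : Finset ℕ}
    (hZ : ∀ k, edgeWeight β₁ β₂ (occupied X m k) (pathState Z k) (pathState Z (k + 1)) ≠ 0) :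
    ∃ Y, Follows X m Z Y := by
  set ℓ : ℤ → Vertex := fun x => if x ≤ m then Vertex.a1 else
    Vertex.ofEdges (occupied X m (x - m - 1).toNat) (pathState Z (x - m - 1).toNat)
      (pathState Z ((x - m - 1).toNat + 1)) with hℓ
  have hlow : ∀ x ≤ m, ℓ x = Vertex.a1 := fun x hx => if_pos hx
  have hhigh : ∀ k : ℕ, ℓ (m + 1 + k) = Vertex.ofEdges (occupied X m k) (pathState Z k)
      (pathState Z (k + 1)) := by
    intro k
    have e : (m + 1 + k - m - 1 : ℤ).toNat = k := by omega
    simp only [hℓ]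
    rw [if_neg (by omega), e]
  have hsites : ∀ x, m < x → ∃ k : ℕ, x = m + 1 + k := fun x hx =>
    ⟨(x - m - 1).toNat, by omega⟩
  have hspec := fun k => Vertex.ofEdges_spec (hZ k)
  obtain ⟨M, hM⟩ := X.exists_forall_mem
  obtain ⟨Y, hY⟩ := WInf.exists_range_eq (B := {x | (ℓ x).north = true}) (m := m)
    (M := max M (m + 2 + Z.sup id)) (fun x hx => by
      by_contra! hle
      simp [hlow x hle, Vertex.north] at hx) (fun x hx => by
      obtain ⟨hx1, hx2⟩ := max_lt_iff.1 hx
      obtain ⟨k, rfl⟩ := hsites x (by omega)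
      have hk : ∀ i, Z.sup id < i → i ∉ Z := fun i hi hiZ =>
        (Finset.le_sup (f := id) hiZ).not_gt hi
      have e1 : occupied X m k = true := by
        exact occupied_eq_true.2 (hM _ hx1)
      have e2 : pathState Z k = true := by
        obtain ⟨i, rfl⟩ : ∃ i, k = i + 1 := ⟨k - 1, by omega⟩
        rw [pathState, decide_eq_true_iff]
        exact hk i (by push_cast at hx2; omega)
      rw [Set.mem_ofPred_eq, hhigh, e1, e2]
      rfl)
  refine ⟨Y, ℓ, ⟨fun x => ?_, ?_, fun x => ?_, fun x => by rw [hY]; rfl⟩, fun k => ?_⟩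
  · rcases lt_trichotomy x m with hx | rfl | hx
    · rw [hlow x hx.le, hlow (x + 1) hx]; rfl
    · have := hhigh 0
      rw [Nat.cast_zero, add_zero] at this
      rw [hlow x le_rfl, this, (hspec 0).2.1]
      rfl
    · obtain ⟨k, rfl⟩ := hsites x hx
      have := hhigh (k + 1)
      have e : m + 1 + ((k + 1 : ℕ) : ℤ) = m + 1 + k + 1 := by push_cast; ring
      rw [e] at this
      rw [this, hhigh, (hspec k).2.2, (hspec (k + 1)).2.1]
  · filter_upwards [eventually_le_atBot m] with x hx
    rw [hlow x hx]
    rfl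
  · rcases le_or_gt x m with hx | hx
    · rw [hlow x hx]
      exact iff_of_false (by simp [Vertex.south]) (hm x hx)
    · obtain ⟨k, rfl⟩ := hsites x hx
      rw [hhigh, (hspec k).1, occupied_eq_true]
  · rw [hhigh, (hspec k).2.2]

/-- A product of numbers in `[0, 1]` of which infinitely many are at most `β < 1` converges to `0`
(for `HasProd`, a limit `0` is not excluded). -/
theorem hasProd_zero_of_infinite {ι : Type*} {f : ι → ℝ} {β : ℝ} (hβ1 : β < 1)
    (h0 : ∀ i, 0 ≤ f i) (h1 : ∀ i, f i ≤ 1) (hinf : {i | f i ≤ β}.Infinite) : HasProd f 0 := by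
  classical
  rw [HasProd, SummationFilter.unconditional_filter]
  rw [Metric.tendsto_atTop]
  intro ε hε
  obtain ⟨k, hk⟩ := exists_pow_lt_of_lt_one hε hβ1
  obtain ⟨s, hs, hcard⟩ := hinf.exists_subset_card_eq k
  refine ⟨s, fun t ht => ?_⟩
  rw [Real.dist_eq, sub_zero, abs_of_nonneg (Finset.prod_nonneg fun i _ => h0 i)]
  refine lt_of_le_of_lt ?_ hk
  rw [← Finset.prod_sdiff ht, ← hcard, ← Finset.prod_const, ← one_mul (∏ _ ∈ s, β)]
  exact mul_le_mul (Finset.prod_le_one (fun i _ => h0 i) fun i _ => h1 i)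
    (Finset.prod_le_prod (fun i _ => h0 i) fun i hi => hs hi)
    (Finset.prod_nonneg fun i _ => h0 i) zero_le_one

/-- The product over all sites reduces to the sites after `m`, as all vertices before are empty. -/
theorem Follows.transfer_eq (hm : ∀ x ≤ m, x ∉ Set.range X.1) {Z : Finset ℕ}
    (h : Follows X m Z Y) : transfer β₁ β₂ X Y =
      ∏' k, edgeWeight β₁ β₂ (occupied X m k) (pathState Z k) (pathState Z (k + 1)) := by
  obtain ⟨ℓ, h1, h2⟩ := h
  rw [SixVertex.transfer_eq h1]
  have hinj : Function.Injective fun k : ℕ => m + 1 + (k : ℤ) := fun i j hij => by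
    simpa using hij
  rw [← hinj.tprod_eq (f := fun x => (ℓ x).weight β₁ β₂)]
  · refine tprod_congr fun k => ?_
    rw [Vertex.weight_eq, h1.south_eq, Follows.west hm h1 h2, h2]
  · intro x hx
    by_contra hx'
    have hxm : x ≤ m := by
      by_contra! hlt
      exact hx' ⟨(x - m - 1).toNat, by dsimp only; omega⟩
    refine hx ?_
    have e1 := h1.west_eq_false hm (x := x) (by omega)
    have e2 : (ℓ x).south = false := by
      rw [Bool.eq_false_iff, Ne, h1.south]
      exact hm x hxm
    beta_reduce
    rw [Vertex.weight_eq, Vertex.east_eq_false e2 e1, e1, e2]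
    rfl

/-- In a row of nonzero weight the horizontal line eventually continues forever, as an infinite
product of the weights `b₁` vanishes. -/
theorem exists_follows_of_transfer_ne_zero (h₁ : 0 < β₁) (h₁' : β₁ < 1) (h₂ : 0 < β₂)
    (h₂' : β₂ < 1) (m : ℤ) (h : transfer β₁ β₂ X Y ≠ 0) :
    ∃ Z, Follows X m Z Y := by
  have hex : ∃ ℓ, Sends X Y ℓ := by
    by_contra h'
    rw [transfer, dif_neg h'] at h
    exact h rfl
  obtain ⟨ℓ, hℓ⟩ := hex
  rw [SixVertex.transfer_eq hℓ] at h
  obtain ⟨M, hM⟩ := X.exists_forall_mem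
  have hw : ∀ x, (ℓ x).weight β₁ β₂ = edgeWeight β₁ β₂ (ℓ x).south (ℓ x).west (ℓ x).east :=
    fun x => Vertex.weight_eq _ _ _
  have hlater : ∃ x₀, M < x₀ ∧ (ℓ x₀).west = true := by
    by_contra! hno
    refine h (HasProd.tprod_eq (hasProd_zero_of_infinite h₁' (fun x => ?_) (fun x => ?_) ?_))
    · rw [hw]; exact edgeWeight_nonneg h₁ h₁' h₂ h₂' _ _ _
    · rw [hw]; exact edgeWeight_le_one h₁ h₁' h₂ h₂' _ _ _
    · refine (Set.Ioi_infinite M).mono fun x hx => ?_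
      have e1 : (ℓ x).west = false := Bool.eq_false_iff.2 (hno x hx)
      have e2 : (ℓ x).east = false := by
        rw [hℓ.flow]
        exact Bool.eq_false_iff.2 (hno (x + 1) (by rw [Set.mem_Ioi] at hx; omega))
      have e3 : (ℓ x).south = true := (hℓ.south x).2 (hM x hx)
      rw [Set.mem_ofPred_eq, hw, e1, e2, e3]
      exact le_rfl
  obtain ⟨x₀, hx₀, hw₀⟩ := hlater
  have hever : ∀ x, x₀ ≤ x → (ℓ x).west = true := by
    intro x hx
    induction x, hx using Int.leInduction with
    | base => exact hw₀
    | succ k hk ih =>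
      rw [← hℓ.flow]
      exact Vertex.east_eq_true ((hℓ.south k).2 (hM k (by omega))) ih
  refine ⟨(Finset.range (x₀ - m).toNat).filter fun k : ℕ => (ℓ (m + 1 + k)).east = false, ℓ, hℓ,
    fun k => ?_⟩
  rw [pathState, Bool.eq_iff_iff, decide_eq_true_iff, Finset.mem_filter, Finset.mem_range, not_and,
    Bool.not_eq_false]
  constructor
  · exact fun h _ => h
  · intro h
    by_cases hk : k < (x₀ - m).toNat
    · exact h hk
    · rw [hℓ.flow]
      exact hever _ (by omega)

theorem transfer_nonneg (h₁ : 0 < β₁) (h₁' : β₁ < 1) (h₂ : 0 < β₂) (h₂' : β₂ < 1) (X Y : WInf) :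
    0 ≤ transfer β₁ β₂ X Y := by
  by_cases h : ∃ ℓ, Sends X Y ℓ
  · obtain ⟨ℓ, hℓ⟩ := h
    rw [transfer_eq hℓ]
    refine tprod_nonneg ?_
    intro x
    rw [Vertex.weight_eq]
    exact edgeWeight_nonneg h₁ h₁' h₂ h₂' _ _ _
  · rw [transfer, dif_neg h]

theorem count_le_of_transfer_ne_zero (h : transfer β₁ β₂ X Y ≠ 0) (x : ℤ) :
    count x Y ≤ count x X := by
  have hex : ∃ ℓ, Sends X Y ℓ := by
    by_contra h'
    rw [transfer, dif_neg h'] at h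
    exact h rfl
  obtain ⟨ℓ, hℓ⟩ := hex
  have := hℓ.count_add x
  omega

end Path

end SixVertex

namespace SixVertex

open Filter Topology

/-! ### Sums over paths -/

section PathSum

theorem pathState_insert {n k : ℕ} (hk : k ≤ n) (Z : Finset ℕ) :
    pathState (insert n Z) k = pathState Z k := by
  cases k with
  | zero => rfl
  | succ k =>
    simp only [pathState, Finset.mem_insert]
    rw [decide_eq_decide]
    have : k ≠ n := by omega
    tauto

theorem pathState_of_subset {n k : ℕ} (hk : n < k) {Z : Finset ℕ} (hZ : Z ⊆ Finset.range n) :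
    pathState Z k = true := by
  obtain ⟨i, rfl⟩ : ∃ i, k = i + 1 := ⟨k - 1, by omega⟩
  rw [pathState, decide_eq_true_iff]
  exact fun h => by
    have := Finset.mem_range.1 (hZ h)
    omega

/-- The sum over the paths through the first `n` sites of the products of the weights `G` of the
steps and of a function of the final state. -/
def pathSum (G : ℕ → Bool → Bool → ℝ) (n : ℕ) (φ : Bool → ℝ) : ℝ :=
  ∑ Z ∈ (Finset.range n).powerset,
    (∏ k ∈ Finset.range n, G k (pathState Z k) (pathState Z (k + 1))) * φ (pathState Z n)

/-- A path through `n + 1` sites is a path through `n` sites followed by one step. -/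
theorem pathSum_succ (G : ℕ → Bool → Bool → ℝ) (n : ℕ) (φ : Bool → ℝ) :
    pathSum G (n + 1) φ =
      pathSum G n fun a => G n a false * φ false + G n a true * φ true := by
  rw [pathSum, Finset.range_add_one, Finset.sum_powerset_insert Finset.notMem_range_self, pathSum,
    ← Finset.sum_add_distrib]
  refine Finset.sum_congr rfl fun Z hZ => ?_
  have hZ' := Finset.mem_powerset.1 hZ
  have e1 : pathState (insert n Z) (n + 1) = false := by simp [pathState]
  have e2 : ∏ k ∈ Finset.range n, G k (pathState (insert n Z) k) (pathState (insert n Z) (k + 1)) =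
      ∏ k ∈ Finset.range n, G k (pathState Z k) (pathState Z (k + 1)) :=
    Finset.prod_congr rfl fun k hk => by
      have := Finset.mem_range.1 hk
      rw [pathState_insert (by omega), pathState_insert (by omega)]
  rw [Finset.prod_insert Finset.notMem_range_self, Finset.prod_insert Finset.notMem_range_self,
    e1, e2, pathState_insert le_rfl, pathState_of_subset (Nat.lt_succ_self n) hZ']
  ring

theorem pathSum_add_mul (G : ℕ → Bool → Bool → ℝ) (n : ℕ) (φ χ : Bool → ℝ) (c d : ℝ) :
    pathSum G n (fun a => c * φ a + d * χ a) = c * pathSum G n φ + d * pathSum G n χ := by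
  simp only [pathSum, Finset.mul_sum, ← Finset.sum_add_distrib]
  exact Finset.sum_congr rfl fun Z _ => by ring

theorem pathSum_one {G : ℕ → Bool → Bool → ℝ} {d : ℕ → ℝ}
    (hG : ∀ k a, G k a false + G k a true = d k) (n : ℕ) :
    pathSum G n (fun _ => 1) = ∏ k ∈ Finset.range n, d k := by
  induction n with
  | zero => simp [pathSum]
  | succ n ih =>
    rw [pathSum_succ, Finset.prod_range_succ, ← ih]
    simp only [mul_one, hG]
    have := pathSum_add_mul G n (fun _ => 1) (fun _ => 0) (d n) 0
    simp only [mul_one, mul_zero, add_zero, zero_mul] at this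
    rw [this, mul_comm]

/-- The indicator function of the state without a line. -/
def noLine (a : Bool) : ℝ := if a then 0 else 1

/-- From `n₀` on, a line cannot end and a path without a line keeps only the fraction `β` of its
weight in each step. -/
theorem tendsto_pathSum_noLine {G : ℕ → Bool → Bool → ℝ} {β : ℝ} (hβ : 0 ≤ β) (hβ1 : β < 1)
    {n₀ : ℕ} (hG : ∀ k, n₀ ≤ k → G k true false = 0 ∧ G k false false = β) :
    Tendsto (fun n => pathSum G n noLine) atTop (𝓝 0) := by
  have key : ∀ n, pathSum G (n + n₀) noLine = β ^ n * pathSum G n₀ noLine := by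
    intro n
    induction n with
    | zero => simp
    | succ n ih =>
      rw [Nat.succ_add, Nat.succ_eq_add_one, pathSum_succ, pow_succ', mul_assoc, ← ih]
      have := pathSum_add_mul G (n + n₀) noLine (fun _ => 0) β 0
      simp only [mul_zero, add_zero, zero_mul] at this
      rw [← this]
      congr 1
      funext a
      obtain ⟨h1, h2⟩ := hG (n + n₀) (by omega)
      cases a <;> simp [noLine, h1, h2]
  rw [← tendsto_add_atTop_iff_nat n₀]
  simp only [key]
  simpa using (tendsto_pow_atTop_nhds_zero_of_lt_one hβ hβ1).mul_const (pathSum G n₀ noLine)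

theorem tendsto_powerset_range : Tendsto (fun n => (Finset.range n).powerset) atTop atTop :=
  tendsto_atTop_finset_of_monotone
    (fun _ _ h => Finset.powerset_mono.2 (Finset.range_mono h)) fun Z =>
    ⟨Z.sup id + 1, Finset.mem_powerset.2 fun _ hi => Finset.mem_range.2
      (Nat.lt_succ_of_le (Finset.le_sup (f := id) hi))⟩

theorem hasSum_of_tendsto_windows {g : Finset ℕ → ℝ} {D : ℝ} (hg : Summable g)
    (h : Tendsto (fun n => ∑ Z ∈ (Finset.range n).powerset, g Z) atTop (𝓝 D)) : HasSum g D := by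
  have := hg.hasSum.comp tendsto_powerset_range
  rw [tendsto_nhds_unique h this]
  exact hg.hasSum

theorem summable_of_tendsto_windows {g : Finset ℕ → ℝ} {D : ℝ} (h0 : ∀ Z, 0 ≤ g Z)
    (h : Tendsto (fun n => ∑ Z ∈ (Finset.range n).powerset, g Z) atTop (𝓝 D)) : Summable g := by
  obtain ⟨c, hc⟩ := h.bddAbove_range
  refine summable_of_sum_le (c := c) h0 fun S => ?_
  obtain ⟨n, hn⟩ := (tendsto_powerset_range.eventually (eventually_ge_atTop S)).exists
  exact (Finset.sum_le_sum_of_subset_of_nonneg hn fun Z _ _ => h0 Z).trans (hc ⟨n, rfl⟩)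

end PathSum

section PathWeight

variable {β₁ β₂ : ℝ} {X : WInf} {m : ℤ}

/-- The weight of a path, the probability of the row of this path given `X`. -/
noncomputable def pathWeight (β₁ β₂ : ℝ) (X : WInf) (m : ℤ) (Z : Finset ℕ) : ℝ :=
  ∏' k, edgeWeight β₁ β₂ (occupied X m k) (pathState Z k) (pathState Z (k + 1))

theorem pathWeight_eq {n₀ n : ℕ} (hX : ∀ k, n₀ ≤ k → occupied X m k = true) (hn : n₀ ≤ n)
    {Z : Finset ℕ} (hZ : Z ⊆ Finset.range n) : pathWeight β₁ β₂ X m Z =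
      (∏ k ∈ Finset.range n, edgeWeight β₁ β₂ (occupied X m k) (pathState Z k)
        (pathState Z (k + 1))) * edgeWeight β₁ β₂ true (pathState Z n) true := by
  rw [pathWeight, tprod_eq_prod (s := Finset.range (n + 1)), Finset.prod_range_succ,
    hX n hn, pathState_of_subset (Nat.lt_succ_self n) hZ]
  intro k hk
  have hk' : n < k := by
    rw [Finset.mem_range] at hk
    omega
  rw [hX k (by omega), pathState_of_subset hk' hZ, pathState_of_subset (by omega) hZ]
  rfl

theorem edgeWeight_ne_zero_of_pathWeight {n₀ : ℕ} (hX : ∀ k, n₀ ≤ k → occupied X m k = true)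
    {Z : Finset ℕ} (h : pathWeight β₁ β₂ X m Z ≠ 0) (k : ℕ) :
    edgeWeight β₁ β₂ (occupied X m k) (pathState Z k) (pathState Z (k + 1)) ≠ 0 := by
  have hZ : Z ⊆ Finset.range (max n₀ (max (k + 1) (Z.sup id + 1))) := fun i hi => by
    have := Finset.le_sup (f := id) hi
    simp only [id] at this
    rw [Finset.mem_range]
    omega
  rw [pathWeight_eq hX (le_max_left _ _) hZ] at h
  exact Finset.prod_ne_zero_iff.1 (left_ne_zero_of_mul h) k (Finset.mem_range.2 (by omega))

/-- A path observable whose conditional expectation in each step does not depend on the state has an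
explicit expectation. -/
theorem tendsto_sum_pathWeight_mul (h₁ : 0 < β₁) (h₁' : β₁ < 1)
    {n₀ : ℕ} (hX : ∀ k, n₀ ≤ k → occupied X m k = true) {ψ : ℕ → Bool → Bool → ℝ}
    (hψ : ∀ k, n₀ ≤ k → ∀ a b, ψ k a b = 1) {d : ℕ → ℝ}
    (hd : ∀ k a, edgeWeight β₁ β₂ (occupied X m k) a false * ψ k a false +
      edgeWeight β₁ β₂ (occupied X m k) a true * ψ k a true = d k) :
    Tendsto (fun n => ∑ Z ∈ (Finset.range n).powerset, pathWeight β₁ β₂ X m Z *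
      ∏ k ∈ Finset.range n₀, ψ k (pathState Z k) (pathState Z (k + 1))) atTop
      (𝓝 (∏ k ∈ Finset.range n₀, d k)) := by
  set G : ℕ → Bool → Bool → ℝ := fun k a b => edgeWeight β₁ β₂ (occupied X m k) a b * ψ k a b
    with hG
  have hd1 : ∀ k, n₀ ≤ k → d k = 1 := by
    intro k hk
    rw [← hd k false, hX k hk, hψ k hk, hψ k hk]
    simp [edgeWeight]
  have hsum : ∀ n, n₀ ≤ n → ∏ k ∈ Finset.range n₀, d k - β₁ * pathSum G n noLine =
      ∑ Z ∈ (Finset.range n).powerset, pathWeight β₁ β₂ X m Z *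
        ∏ k ∈ Finset.range n₀, ψ k (pathState Z k) (pathState Z (k + 1)) := by
    intro n hn
    have hsub : Finset.range n₀ ⊆ Finset.range n := Finset.range_mono hn
    have hnot : ∀ k, k ∉ Finset.range n₀ → n₀ ≤ k := fun k hk => by
      rwa [Finset.mem_range, not_lt] at hk
    rw [Finset.prod_subset hsub fun k _ hk => hd1 k (hnot k hk), ← pathSum_one (G := G) hd]
    have := pathSum_add_mul G n (fun _ => 1) noLine 1 (-β₁)
    rw [one_mul (pathSum G n _), neg_mul, ← sub_eq_add_neg] at this
    rw [← this]
    refine Finset.sum_congr rfl fun Z hZ => ?_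
    rw [pathWeight_eq hX hn (Finset.mem_powerset.1 hZ),
      Finset.prod_subset hsub fun k _ hk => hψ k (hnot k hk) _ _, Finset.prod_mul_distrib]
    have e : ∀ a, 1 * 1 + -β₁ * noLine a = edgeWeight β₁ β₂ true a true := by
      intro a
      cases a <;> simp [noLine, edgeWeight, sub_eq_add_neg]
    beta_reduce
    rw [e]
    ring
  have hlim := (tendsto_pathSum_noLine (G := G) h₁.le h₁' (n₀ := n₀) fun k hk => by
    simp only [hG]
    rw [hX k hk, hψ k hk, hψ k hk]
    simp [edgeWeight]).const_mul β₁
  rw [mul_zero] at hlim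
  have := hlim.const_sub (∏ k ∈ Finset.range n₀, d k)
  rw [sub_zero] at this
  refine this.congr' ?_
  filter_upwards [eventually_ge_atTop n₀] with n hn using hsum n hn

theorem pathWeight_nonneg (h₁ : 0 < β₁) (h₁' : β₁ < 1) (h₂ : 0 < β₂) (h₂' : β₂ < 1)
    (X : WInf) (m : ℤ) (Z : Finset ℕ) : 0 ≤ pathWeight β₁ β₂ X m Z :=
  tprod_nonneg fun _ => edgeWeight_nonneg h₁ h₁' h₂ h₂' _ _ _

theorem summable_pathWeight (h₁ : 0 < β₁) (h₁' : β₁ < 1) (h₂ : 0 < β₂) (h₂' : β₂ < 1)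
    {n₀ : ℕ} (hX : ∀ k, n₀ ≤ k → occupied X m k = true) : Summable (pathWeight β₁ β₂ X m) := by
  have := tendsto_sum_pathWeight_mul (β₂ := β₂) h₁ h₁' hX (ψ := fun _ _ _ => 1)
    (fun _ _ _ _ => rfl) (d := fun _ => 1) fun k a => by
      cases occupied X m k <;> cases a <;> simp [edgeWeight]
  simp only [Finset.prod_const_one, mul_one] at this
  exact summable_of_tendsto_windows (pathWeight_nonneg h₁ h₁' h₂ h₂' X m) this

/-- Summation over configurations is summation over paths. -/
theorem hasSum_transfer_iff (h₁ : 0 < β₁) (h₁' : β₁ < 1) (h₂ : 0 < β₂) (h₂' : β₂ < 1)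
    (hm : ∀ x ≤ m, x ∉ Set.range X.1) {n₀ : ℕ} (hX : ∀ k, n₀ ≤ k → occupied X m k = true)
    {F : WInf → ℝ} {Ψ : Finset ℕ → ℝ} (hF : ∀ Z Y, Follows X m Z Y → F Y = Ψ Z) {D : ℝ} :
    HasSum (fun Y => transfer β₁ β₂ X Y * F Y) D ↔
      HasSum (fun Z => pathWeight β₁ β₂ X m Z * Ψ Z) D := by
  have hex : ∀ Z : Function.support fun Z => pathWeight β₁ β₂ X m Z * Ψ Z, ∃ Y,
      Follows X m Z Y := fun Z => exists_follows hm
    (edgeWeight_ne_zero_of_pathWeight hX (left_ne_zero_of_mul Z.2))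
  choose i hi using hex
  refine hasSum_iff_hasSum_of_ne_zero_bij i (fun Z Z' h => ?_) (fun Y hY => ?_) fun Z => ?_
  · exact Subtype.ext ((hi Z).unique_path (h ▸ hi Z'))
  · obtain ⟨Z, hZ⟩ := exists_follows_of_transfer_ne_zero h₁ h₁' h₂ h₂' m (left_ne_zero_of_mul hY)
    have hY' : pathWeight β₁ β₂ X m Z * Ψ Z ≠ 0 := by
      rw [pathWeight, ← hZ.transfer_eq hm, ← hF Z Y hZ]
      exact hY
    exact ⟨⟨Z, hY'⟩, (hi ⟨Z, hY'⟩).unique hm hZ⟩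
  · rw [hF _ _ (hi Z), (hi Z).transfer_eq hm, pathWeight]

end PathWeight

/-! ### One time step -/

section OneStep

variable {b₁ b₂ τ : ℝ}

theorem Follows.count_add {X Y : WInf} {m : ℤ} {Z : Finset ℕ} (hm : ∀ x ≤ m, x ∉ Set.range X.1)
    (h : Follows X m Z Y) (k : ℕ) : count (m + k) Y + (pathState Z k).toNat = count (m + k) X := by
  obtain ⟨ℓ, h1, h2⟩ := h
  rw [← h1.count_add, h1.flow, ← Follows.west hm h1 h2]
  congr 4
  ring

/-- The duality relation of one time step: the observables
`∏ (τ^{N_y} - b₂ τ^{N_{y-1}})` over distinct `y` have explicit conditional expectations. -/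
theorem hasSum_transfer_mul_prod (h₁ : 0 < b₁) (h₁' : b₁ < 1) (h₂ : 0 < b₂) (h₂' : b₂ < 1)
    (hτ : τ * b₁ = b₂) (X : WInf) (s : Finset ℤ) :
    HasSum (fun Y => transfer b₁ b₂ X Y * ∏ y ∈ s, (τ ^ count y Y - b₂ * τ ^ count (y - 1) Y))
      (∏ y ∈ s, ((1 - b₁ - b₂) * τ ^ count (y - 1) X + b₁ * τ ^ count y X)) := by
  classical
  have hτ0 : τ ≠ 0 := by
    rintro rfl
    linarith
  obtain ⟨m₀, hm₀⟩ := X.exists_forall_lt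
  obtain ⟨M, hM⟩ := X.exists_forall_mem
  obtain ⟨m₁, hm₁⟩ := s.bddBelow
  obtain ⟨M₁, hM₁⟩ := s.bddAbove
  set m := min m₀ (m₁ - 1) with hmdef
  have hm : ∀ x ≤ m, x ∉ Set.range X.1 := fun x hx => hm₀ x (by omega)
  set n₀ := (max M M₁ - m).toNat with hn₀
  have hX : ∀ k, n₀ ≤ k → occupied X m k = true := fun k hk =>
    occupied_eq_true.2 (hM _ (by omega))
  have hs : ∀ f : ℤ → ℝ, ∏ y ∈ s, f y =
      ∏ k ∈ Finset.range n₀, if m + 1 + k ∈ s then f (m + 1 + k) else 1 := by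
    intro f
    rw [← Finset.prod_filter]
    symm
    refine Finset.prod_nbij (fun k : ℕ => m + 1 + (k : ℤ)) (fun k hk => (Finset.mem_filter.1 hk).2)
      (fun i _ j _ hij => by simpa using hij) (fun y hy => ?_) fun _ _ => rfl
    have h1 := hm₁ hy
    have h2 := hM₁ hy
    refine ⟨(y - m - 1).toNat, ?_, by dsimp only; omega⟩
    have e : m + 1 + ((y - m - 1).toNat : ℤ) = y := by omega
    rw [Finset.mem_coe, Finset.mem_filter, Finset.mem_range, e]
    exact ⟨by omega, hy⟩
  -- the observable of a path, site by site
  set ψ : ℕ → Bool → Bool → ℝ := fun k a b => if m + 1 + k ∈ s then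
    τ ^ count (m + 1 + k) X * τ⁻¹ ^ b.toNat - b₂ * (τ ^ count (m + k) X * τ⁻¹ ^ a.toNat) else 1
    with hψ
  set d : ℕ → ℝ := fun k => if m + 1 + k ∈ s then
    (1 - b₁ - b₂) * τ ^ count (m + k) X + b₁ * τ ^ count (m + 1 + k) X else 1 with hd
  have hψ1 : ∀ k, n₀ ≤ k → ∀ a b, ψ k a b = 1 := fun k hk a b => if_neg fun h => by
    have := hM₁ h
    omega
  have hdψ : ∀ k a, edgeWeight b₁ b₂ (occupied X m k) a false * ψ k a false +
      edgeWeight b₁ b₂ (occupied X m k) a true * ψ k a true = d k := by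
    intro k a
    simp only [hψ, hd]
    split_ifs with hk
    · have e : m + 1 + (k : ℤ) = m + k + 1 := by ring
      have hc := count_add_one X (m + k)
      rw [← e] at hc
      have hb₂ : b₂ * τ⁻¹ = b₁ := by rw [← hτ]; field_simp
      set q := τ ^ count (m + k) X with hq
      cases hocc : occupied X m k
      · rw [if_neg fun h => by rw [occupied_eq_true.2 h] at hocc; exact absurd hocc (by simp),
          add_zero] at hc
        rw [hc, ← hq]
        cases a <;> simp only [edgeWeight, Bool.toNat_true, Bool.toNat_false, pow_zero, pow_one]
        all_goals ring
      · rw [if_pos (occupied_eq_true.1 hocc)] at hc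
        rw [hc, pow_succ, ← hq]
        have : q * τ * τ⁻¹ = q := by field_simp
        cases a <;> simp only [edgeWeight, Bool.toNat_true, Bool.toNat_false, pow_zero, pow_one]
        · linear_combination (1 - b₁) * this
        · linear_combination this - q * hb₂ - q * hτ
    · cases occupied X m k <;> cases a <;> simp [edgeWeight]
  have hprodY : ∀ Z Y, Follows X m Z Y →
      ∏ y ∈ s, (τ ^ count y Y - b₂ * τ ^ count (y - 1) Y) =
        ∏ k ∈ Finset.range n₀, ψ k (pathState Z k) (pathState Z (k + 1)) := by
    intro Z Y hY
    rw [hs]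
    refine Finset.prod_congr rfl fun k _ => ?_
    simp only [hψ]
    refine if_congr Iff.rfl ?_ rfl
    have e1 := hY.count_add hm k
    have e2 := hY.count_add hm (k + 1)
    have e : m + 1 + (k : ℤ) = m + ((k + 1 : ℕ) : ℤ) := by push_cast; ring
    have e' : m + 1 + (k : ℤ) - 1 = m + k := by ring
    have hpow : ∀ i j : ℕ, τ ^ (i + j) * τ⁻¹ ^ j = τ ^ i := fun i j => by
      rw [pow_add, inv_pow, mul_assoc, mul_inv_cancel₀ (pow_ne_zero j hτ0), mul_one]
    rw [e', e, ← e1, ← e2, hpow, hpow]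
  have hD : ∏ y ∈ s, ((1 - b₁ - b₂) * τ ^ count (y - 1) X + b₁ * τ ^ count y X) =
      ∏ k ∈ Finset.range n₀, d k := by
    rw [hs]
    refine Finset.prod_congr rfl fun k _ => ?_
    have e' : m + 1 + (k : ℤ) - 1 = m + k := by ring
    simp only [hd, e']
  rw [hasSum_transfer_iff h₁ h₁' h₂ h₂' hm hX hprodY, hD]
  refine hasSum_of_tendsto_windows ?_ (tendsto_sum_pathWeight_mul h₁ h₁' hX hψ1 hdψ)
  obtain ⟨C, hC⟩ : ∃ C : ℕ → ℝ, ∀ k a b, |ψ k a b| ≤ C k := by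
    refine ⟨fun k => |ψ k false false| + |ψ k false true| + |ψ k true false| + |ψ k true true|,
      fun k a b => ?_⟩
    have := abs_nonneg (ψ k false false)
    have := abs_nonneg (ψ k false true)
    have := abs_nonneg (ψ k true false)
    have := abs_nonneg (ψ k true true)
    cases a <;> cases b <;> linarith
  refine Summable.of_norm_bounded ((summable_pathWeight h₁ h₁' h₂ h₂' hX).mul_right
    (∏ k ∈ Finset.range n₀, C k)) fun Z => ?_
  rw [norm_mul, Real.norm_of_nonneg (pathWeight_nonneg h₁ h₁' h₂ h₂' X m Z), norm_prod]
  refine mul_le_mul_of_nonneg_left (Finset.prod_le_prod (fun _ _ => norm_nonneg _)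
    fun k _ => hC k _ _) (pathWeight_nonneg h₁ h₁' h₂ h₂' X m Z)

theorem hasSum_transfer (h₁ : 0 < b₁) (h₁' : b₁ < 1) (h₂ : 0 < b₂) (h₂' : b₂ < 1) (X : WInf) :
    HasSum (transfer b₁ b₂ X) 1 := by
  simpa using hasSum_transfer_mul_prod h₁ h₁' h₂ h₂' (div_mul_cancel₀ b₂ h₁.ne') X ∅

end OneStep

end SixVertex

namespace SixVertex

/-! ### The Markov chain -/

section Chain

variable {b₁ b₂ τ : ℝ} {n L : ℕ}

theorem transferPow_nonneg (h₁ : 0 < b₁) (h₁' : b₁ < 1) (h₂ : 0 < b₂) (h₂' : b₂ < 1) (t : ℕ)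
    (Y X : WInf) : 0 ≤ transferPow b₁ b₂ t Y X := by
  induction t generalizing X with
  | zero =>
    rw [transferPow]
    split_ifs <;> norm_num
  | succ t ih =>
    rw [transferPow]
    exact tsum_nonneg fun Z => mul_nonneg (ih Z) (transfer_nonneg h₁ h₁' h₂ h₂' Z X)

theorem summable_mul_of_hasSum_one {ι ι' : Type*} {p : ι → ℝ} {q : ι → ι' → ℝ} (hp : ∀ i, 0 ≤ p i)
    (hq : ∀ i j, 0 ≤ q i j) (h : Summable p) (h1 : ∀ i, HasSum (q i) 1) :
    Summable fun x : ι × ι' => p x.1 * q x.1 x.2 := by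
  have h0 : 0 ≤ fun x : ι × ι' => p x.1 * q x.1 x.2 :=
    Pi.le_def.2 fun x => mul_nonneg (hp x.1) (hq x.1 x.2)
  rw [summable_prod_of_nonneg h0]
  have e : (fun i => ∑' j, p i * q i j) = p := by
    funext i
    rw [tsum_mul_left, (h1 i).tsum_eq, mul_one]
  constructor
  · intro i
    exact (h1 i).summable.mul_left (p i)
  · dsimp only
    rw [e]
    exact h

/-- The joint law of two consecutive configurations is summable. -/
theorem summable_joint (h₁ : 0 < b₁) (h₁' : b₁ < 1) (h₂ : 0 < b₂) (h₂' : b₂ < 1) {t : ℕ}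
    {Y : WInf} (h : Summable (transferPow b₁ b₂ t Y)) :
    Summable fun p : WInf × WInf => transferPow b₁ b₂ t Y p.1 * transfer b₁ b₂ p.1 p.2 :=
  summable_mul_of_hasSum_one (transferPow_nonneg h₁ h₁' h₂ h₂' t Y)
    (transfer_nonneg h₁ h₁' h₂ h₂') h (hasSum_transfer h₁ h₁' h₂ h₂')

theorem summable_transferPow (h₁ : 0 < b₁) (h₁' : b₁ < 1) (h₂ : 0 < b₂) (h₂' : b₂ < 1) (t : ℕ)
    (Y : WInf) : Summable (transferPow b₁ b₂ t Y) := by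
  induction t with
  | zero =>
    refine summable_of_ne_finset_zero (s := {Y}) fun X hX => ?_
    rw [transferPow, if_neg (by simpa [eq_comm] using hX)]
  | succ t ih =>
    exact (summable_joint h₁ h₁' h₂ h₂' ih).prod_symm.prod

theorem summable_transferPow_mul (h₁ : 0 < b₁) (h₁' : b₁ < 1) (h₂ : 0 < b₂) (h₂' : b₂ < 1) (t : ℕ)
    (Y : WInf) {F : WInf → ℝ} {C : ℝ} (hF : ∀ X, |F X| ≤ C) :
    Summable fun X => transferPow b₁ b₂ t Y X * F X := by
  refine Summable.of_norm_bounded ((summable_transferPow h₁ h₁' h₂ h₂' t Y).mul_right C) fun X => ?_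
  rw [norm_mul, Real.norm_of_nonneg (transferPow_nonneg h₁ h₁' h₂ h₂' t Y X)]
  exact mul_le_mul_of_nonneg_left (hF X) (transferPow_nonneg h₁ h₁' h₂ h₂' t Y X)

/-- The last time step can be taken first. For a bounded observable the double series converges
absolutely. -/
theorem expectation_succ (h₁ : 0 < b₁) (h₁' : b₁ < 1) (h₂ : 0 < b₂) (h₂' : b₂ < 1) (t : ℕ)
    (Y : WInf) {F : WInf → ℝ} {C : ℝ} (hF : ∀ X, |F X| ≤ C) :
    expectation b₁ b₂ Y F (t + 1) =
      expectation b₁ b₂ Y (fun Z => ∑' X, transfer b₁ b₂ Z X * F X) t := by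
  have hj : Summable fun p : WInf × WInf =>
      transferPow b₁ b₂ t Y p.1 * transfer b₁ b₂ p.1 p.2 * F p.2 := by
    refine Summable.of_norm_bounded ((summable_joint h₁ h₁' h₂ h₂'
      (summable_transferPow h₁ h₁' h₂ h₂' t Y)).mul_right C) fun p => ?_
    have := mul_nonneg (transferPow_nonneg h₁ h₁' h₂ h₂' t Y p.1)
      (transfer_nonneg h₁ h₁' h₂ h₂' p.1 p.2)
    rw [norm_mul, Real.norm_of_nonneg this]
    exact mul_le_mul_of_nonneg_left (hF p.2) this
  have hcomm := Summable.tsum_comm (f := fun Z X =>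
    transferPow b₁ b₂ t Y Z * transfer b₁ b₂ Z X * F X) hj
  simp only [expectation, transferPow, ← tsum_mul_right, ← tsum_mul_left]
  rw [hcomm]
  exact tsum_congr fun Z => tsum_congr fun X => mul_assoc _ _ _

open Classical in
theorem expectation_zero (Y : WInf) (F : WInf → ℝ) : expectation b₁ b₂ Y F 0 = F Y := by
  rw [expectation, tsum_eq_single Y fun X hX => by simp [transferPow, hX.symm]]
  simp [transferPow]

theorem expectation_one (h₁ : 0 < b₁) (h₁' : b₁ < 1) (h₂ : 0 < b₂) (h₂' : b₂ < 1) (t : ℕ)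
    (Y : WInf) : expectation b₁ b₂ Y (fun _ => 1) t = 1 := by
  induction t with
  | zero => exact expectation_zero Y _
  | succ t ih =>
    refine (expectation_succ h₁ h₁' h₂ h₂' t Y (C := 1) (by simp)).trans (Eq.trans ?_ ih)
    congr 1
    funext Z
    simp only [mul_one]
    exact (hasSum_transfer h₁ h₁' h₂ h₂' Z).tsum_eq

/-- The height function of the chain does not increase in time. -/
theorem count_le_of_transferPow_ne_zero {t : ℕ} {Y X : WInf} (h : transferPow b₁ b₂ t Y X ≠ 0)
    (x : ℤ) : count x X ≤ count x Y := by
  induction t generalizing X with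
  | zero =>
    by_cases hYX : Y = X
    · rw [hYX]
    · exact absurd (by simp [transferPow, hYX]) h
  | succ t ih =>
    rw [transferPow] at h
    obtain ⟨Z, hZ⟩ : ∃ Z, transferPow b₁ b₂ t Y Z * transfer b₁ b₂ Z X ≠ 0 := by
      by_contra! h0
      exact h (by simp [h0])
    exact (count_le_of_transfer_ne_zero (right_ne_zero_of_mul hZ) x).trans
      (ih (left_ne_zero_of_mul hZ))

theorem expectation_congr {t : ℕ} {Y : WInf} {F G : WInf → ℝ}
    (h : ∀ X, transferPow b₁ b₂ t Y X ≠ 0 → F X = G X) :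
    expectation b₁ b₂ Y F t = expectation b₁ b₂ Y G t := by
  refine tsum_congr fun X => ?_
  by_cases h0 : transferPow b₁ b₂ t Y X = 0
  · rw [h0, zero_mul, zero_mul]
  · rw [h X h0]

theorem expectation_sum (h₁ : 0 < b₁) (h₁' : b₁ < 1) (h₂ : 0 < b₂) (h₂' : b₂ < 1) (t : ℕ)
    (Y : WInf) {ι : Type*} (I : Finset ι) (c : ι → ℝ) {F : ι → WInf → ℝ} {C : ℝ}
    (hF : ∀ i X, |F i X| ≤ C) :
    expectation b₁ b₂ Y (fun X => ∑ i ∈ I, c i * F i X) t =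
      ∑ i ∈ I, c i * expectation b₁ b₂ Y (F i) t := by
  simp only [expectation, Finset.mul_sum, mul_left_comm _ (c _), ← tsum_mul_left]
  rw [Summable.tsum_finsetSum fun i _ =>
    (summable_transferPow_mul h₁ h₁' h₂ h₂' t Y (hF i)).mul_left (c i)]

/-- The joint moments `𝔼 ∏ τ^{N_{y_i}}` for the step initial condition. -/
noncomputable def moment (b₁ b₂ τ : ℝ) (t : ℕ) (y : Fin L → ℕ) : ℝ :=
  expectation b₁ b₂ step (fun X => ∏ i, τ ^ count (y i) X) t

theorem abs_prod_le_one (h0 : 0 < τ) (h1 : τ < 1) (y : Fin L → ℕ) (X : WInf) :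
    |∏ i, τ ^ count (y i) X| ≤ 1 := by
  rw [abs_of_nonneg (Finset.prod_nonneg fun i _ => pow_nonneg h0.le _)]
  exact Finset.prod_le_one (fun i _ => pow_nonneg h0.le _) fun i _ => pow_le_one₀ h0.le h1.le

theorem prod_mul_add_mul (c d : ℝ) (y : Fin L → ℕ) (X : WInf) :
    ∏ i, (c * τ ^ count ((y i - 1 : ℕ) : ℤ) X + d * τ ^ count (y i) X) =
      ∑ S : Finset (Fin L), c ^ S.card * d ^ (L - S.card) * ∏ i, τ ^ count (lower S y i) X := by
  rw [Finset.prod_add, Finset.powerset_univ]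
  refine Finset.sum_congr rfl fun S _ => ?_
  have h1 : ∏ i, τ ^ count (lower S y i) X = (∏ i ∈ S, τ ^ count ((y i - 1 : ℕ) : ℤ) X) *
      ∏ i ∈ Finset.univ \ S, τ ^ count (y i) X := by
    rw [← Finset.prod_mul_prod_compl S, Finset.compl_eq_univ_sdiff]
    congr 1
    · exact Finset.prod_congr rfl fun A hA => by rw [lower, if_pos hA]
    · exact Finset.prod_congr rfl fun A hA => by rw [lower, if_neg (Finset.mem_sdiff.1 hA).2]
  rw [h1, Finset.prod_mul_distrib, Finset.prod_mul_distrib, Finset.prod_const, Finset.prod_const,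
    ← Finset.compl_eq_univ_sdiff, Finset.card_compl, Fintype.card_fin]
  ring

/-- The evolution equation of the moments. -/
theorem sum_moment_succ (h₁ : 0 < b₁) (h₁' : b₁ < 1) (h₂ : 0 < b₂) (h₂' : b₂ < 1)
    (hτ : τ * b₁ = b₂) (h0 : 0 < τ) (h1 : τ < 1) (t : ℕ) {y : Fin L → ℕ}
    (hinj : Function.Injective y) (hy : ∀ A, 1 ≤ y A) :
    ∑ S : Finset (Fin L), (-b₂) ^ S.card * moment b₁ b₂ τ (t + 1) (lower S y) =
      ∑ S : Finset (Fin L), (1 - b₁ - b₂) ^ S.card * b₁ ^ (L - S.card) *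
        moment b₁ b₂ τ t (lower S y) := by
  have hb : ∀ (S : Finset (Fin L)) X, |∏ i, τ ^ count (lower S y i) X| ≤ 1 := fun S X =>
    abs_prod_le_one h0 h1 _ X
  have e0 : ∑ S : Finset (Fin L), (-b₂) ^ S.card * moment b₁ b₂ τ (t + 1) (lower S y) =
      ∑ S : Finset (Fin L), (-b₂) ^ S.card * 1 ^ (L - S.card) *
        moment b₁ b₂ τ (t + 1) (lower S y) := by simp
  have hcast : Function.Injective fun A => (y A : ℤ) := fun A B h => hinj (Nat.cast_injective h)
  have e1 : ∀ A, ((y A : ℤ) - 1) = ((y A - 1 : ℕ) : ℤ) := fun A => by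
    have := hy A
    omega
  have hprod : ∀ f : ℤ → ℝ, ∏ x ∈ Finset.univ.image fun A => (y A : ℤ), f x = ∏ A, f (y A) :=
    fun f => Finset.prod_image fun A _ B _ h => hcast h
  simp only [moment] at e0 ⊢
  rw [e0, ← expectation_sum h₁ h₁' h₂ h₂' (t + 1) step _ _ hb,
    ← expectation_sum h₁ h₁' h₂ h₂' t step _ _ hb]
  simp only [← prod_mul_add_mul]
  have hbound : ∀ X, |∏ i, (-b₂ * τ ^ count ((y i - 1 : ℕ) : ℤ) X + 1 * τ ^ count (y i) X)| ≤
      2 ^ L := by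
    intro X
    rw [Finset.abs_prod]
    refine (Finset.prod_le_prod (g := fun _ => 2) (fun _ _ => abs_nonneg _) fun i _ => ?_).trans_eq
      (by simp)
    have a1 := pow_nonneg h0.le (count ((y i - 1 : ℕ) : ℤ) X)
    have a2 := pow_nonneg h0.le (count (y i) X)
    have a3 : τ ^ count ((y i - 1 : ℕ) : ℤ) X ≤ 1 := pow_le_one₀ h0.le h1.le
    have a4 : τ ^ count (y i) X ≤ 1 := pow_le_one₀ h0.le h1.le
    rw [abs_le]
    constructor <;> nlinarith
  rw [expectation_succ h₁ h₁' h₂ h₂' t step hbound]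
  congr 1
  funext Z
  have := (hasSum_transfer_mul_prod h₁ h₁' h₂ h₂' hτ Z
    (Finset.univ.image fun A => (y A : ℤ))).tsum_eq
  simp only [hprod, e1] at this
  rw [← this]
  refine tsum_congr fun X => ?_
  congr 1
  exact Finset.prod_congr rfl fun A _ => by ring

theorem count_sub_one_cases (X : WInf) (k : ℕ) :
    count ((k + 1 : ℕ) : ℤ) X = count k X ∨ count ((k + 1 : ℕ) : ℤ) X = count k X + 1 := by
  classical
  have := count_add_one X k
  push_cast
  split_ifs at this with h
  · exact Or.inr this
  · exact Or.inl this

/-- For equal neighbours, the moments satisfy a linear relation since the height function increases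
by `0` or `1` in each step. -/
theorem moment_boundary (h₁ : 0 < b₁) (h₁' : b₁ < 1) (h₂ : 0 < b₂) (h₂' : b₂ < 1) (h0 : 0 < τ)
    (h1 : τ < 1) (t : ℕ) {i j : Fin L} (hij : i ≠ j) {y : Fin L → ℕ} {k : ℕ} (hyi : y i = k + 1)
    (hyj : y j = k + 1) :
    moment b₁ b₂ τ t y = (1 + τ) * moment b₁ b₂ τ t (Function.update y i k) -
      τ * moment b₁ b₂ τ t (Function.update (Function.update y i k) j k) := by
  have := expectation_sum h₁ h₁' h₂ h₂' t step Finset.univ ![1 + τ, -τ]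
    (F := ![fun X => ∏ A, τ ^ count (Function.update y i k A) X,
      fun X => ∏ A, τ ^ count (Function.update (Function.update y i k) j k A) X]) (C := 1)
    (by
      intro l X
      fin_cases l
      exacts [abs_prod_le_one h0 h1 _ X, abs_prod_le_one h0 h1 _ X])
  simp only [Fin.sum_univ_two, Matrix.cons_val_zero, Matrix.cons_val_one] at this
  simp only [moment]
  rw [sub_eq_add_neg, ← neg_mul, ← this]
  congr 1
  funext X
  have hj : j ∈ Finset.univ.erase i := Finset.mem_erase.2 ⟨hij.symm, Finset.mem_univ j⟩
  have hsplit : ∀ z : Fin L → ℕ, ∏ A, τ ^ count (z A) X = τ ^ count (z i) X * (τ ^ count (z j) X *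
      ∏ A ∈ (Finset.univ.erase i).erase j, τ ^ count (z A) X) := fun z => by
    rw [Finset.mul_prod_erase _ (fun A => τ ^ count (z A) X) hj,
      Finset.mul_prod_erase _ (fun A => τ ^ count (z A) X) (Finset.mem_univ i)]
  rw [hsplit, hsplit (Function.update y i k),
    hsplit (Function.update (Function.update y i k) j k)]
  have e : ∀ A ∈ (Finset.univ.erase i).erase j, A ≠ i ∧ A ≠ j := fun A hA =>
    ⟨Finset.ne_of_mem_erase (Finset.mem_of_mem_erase hA), Finset.ne_of_mem_erase hA⟩
  rw [Finset.prod_congr (f := fun A => τ ^ count (Function.update y i k A) X)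
      (g := fun A => τ ^ count (y A) X) rfl fun A hA => by
      rw [Function.update_of_ne (e A hA).1],
    Finset.prod_congr (f := fun A => τ ^ count (Function.update (Function.update y i k) j k A) X)
      (g := fun A => τ ^ count (y A) X) rfl fun A hA => by
      rw [Function.update_of_ne (e A hA).2, Function.update_of_ne (e A hA).1]]
  simp only [Function.update_self, Function.update_of_ne hij, Function.update_of_ne hij.symm, hyi,
    hyj]
  rcases count_sub_one_cases X k with hc | hc <;> rw [hc]
  · ring
  · rw [pow_succ]
    ring

theorem count_step_zero_of_transferPow {t : ℕ} {X : WInf} (h : transferPow b₁ b₂ t step X ≠ 0)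
    {x : ℤ} (hx : x ≤ 0) : count x X = 0 := by
  have h1 := (count_mono step hx).trans_eq (count_step 0)
  have h2 := count_le_of_transferPow_ne_zero h x
  omega

theorem moment_of_zero (t : ℕ) {y : Fin (n + 1) → ℕ} (hy : y 0 = 0) :
    moment b₁ b₂ τ t y = moment b₁ b₂ τ t fun i => y i.succ := by
  refine expectation_congr fun X hX => ?_
  rw [Fin.prod_univ_succ, hy, count_step_zero_of_transferPow hX (by simp), pow_zero, one_mul]

theorem moment_zero_time (j : Fin L) {y : Fin L → ℕ} {k : ℕ} (hk : y j = k + 1) :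
    moment b₁ b₂ τ 0 y = τ * moment b₁ b₂ τ 0 (Function.update y j k) := by
  simp only [moment, expectation_zero, count_step]
  rw [← Finset.mul_prod_erase _ _ (Finset.mem_univ j),
    ← Finset.mul_prod_erase _ (fun A => τ ^ Function.update y j k A) (Finset.mem_univ j),
    Finset.prod_congr (f := fun A => τ ^ Function.update y j k A) rfl fun A hA => by
      rw [Function.update_of_ne (Finset.ne_of_mem_erase hA)], Function.update_self, hk, pow_succ]
  ring

end Chain

end SixVertex

namespace SixVertex

/-! ### Uniqueness -/

section Uniqueness

variable {n : ℕ}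

theorem sum_lower_lt {L : ℕ} {S : Finset (Fin L)} (hS : S.Nonempty) {y : Fin L → ℕ}
    (hy : ∀ A, 1 ≤ y A) : ∑ A, lower S y A < ∑ A, y A := by
  obtain ⟨A, hA⟩ := hS
  refine Finset.sum_lt_sum (fun B _ => ?_) ⟨A, Finset.mem_univ A, ?_⟩
  · unfold lower
    split_ifs <;> omega
  · have := hy A
    rw [lower, if_pos hA]
    omega

theorem lower_empty {L : ℕ} (y : Fin L → ℕ) : lower ∅ y = y := funext fun _ => if_neg (by simp)

theorem monotone_lower {L : ℕ} {y : Fin L → ℕ} (hy : StrictMono y) (S : Finset (Fin L)) :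
    Monotone (lower S y) := by
  intro A B hAB
  rcases hAB.eq_or_lt with rfl | hlt
  · exact le_rfl
  · have := hy hlt
    unfold lower
    split_ifs <;> omega

theorem sum_update_lt {L : ℕ} {y : Fin L → ℕ} {j : Fin L} {k : ℕ} (hk : y j = k + 1) :
    ∑ A, Function.update y j k A < ∑ A, y A := by
  refine Finset.sum_lt_sum (fun B _ => ?_) ⟨j, Finset.mem_univ j, ?_⟩
  · by_cases hB : B = j
    · rw [hB, Function.update_self]
      omega
    · rw [Function.update_of_ne hB]
  · rw [Function.update_self]
    omega

theorem monotone_update {L : ℕ} {y : Fin L → ℕ} (hy : Monotone y) {j : Fin L} {k : ℕ}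
    (hk : y j = k + 1) (hj : ∀ A < j, y A ≤ k) : Monotone (Function.update y j k) := by
  intro A B hAB
  by_cases hA : A = j
  · subst hA
    rw [Function.update_self]
    by_cases hB : B = A
    · rw [hB, Function.update_self]
    · rw [Function.update_of_ne hB]
      have := hy hAB
      omega
  · rw [Function.update_of_ne hA]
    by_cases hB : B = j
    · rw [hB, Function.update_self]
      exact hj A (lt_of_le_of_ne (hB ▸ hAB) hA)
    · rw [Function.update_of_ne hB]
      exact hy hAB

/-- If a weakly increasing family is not strictly increasing, then it has a first pair of equal
neighbours. -/
theorem exists_first_eq_succ {y : Fin (n + 1) → ℕ} (hy : Monotone y) (hy' : ¬ StrictMono y) :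
    ∃ i j : Fin (n + 1), (j : ℕ) = i + 1 ∧ y i = y j ∧ ∀ A < i, y A < y i := by
  classical
  have hex : ∃ m : ℕ, ∃ h : m < n, y (Fin.castSucc ⟨m, h⟩) = y (Fin.succ ⟨m, h⟩) := by
    by_contra! hno
    exact hy' (Fin.strictMono_iff_lt_succ.2 fun i =>
      lt_of_le_of_ne (hy (Fin.castSucc_lt_succ).le) (hno i i.2))
  obtain ⟨hm, heq⟩ := Nat.find_spec hex
  refine ⟨_, _, by simp, heq, fun A hA => ?_⟩
  have hA' : (A : ℕ) < Nat.find hex := by simpa [Fin.lt_def] using hA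
  have hAn : (A : ℕ) < n := hA'.trans hm
  have h1 : y (Fin.castSucc ⟨A, hAn⟩) < y (Fin.succ ⟨A, hAn⟩) :=
    lt_of_le_of_ne (hy (Fin.castSucc_lt_succ).le) fun h => Nat.find_min hex hA' ⟨hAn, h⟩
  have h2 : y (Fin.succ ⟨A, hAn⟩) ≤ y (Fin.castSucc ⟨Nat.find hex, hm⟩) := hy (by
    rw [Fin.le_def]
    simpa using hA')
  exact lt_of_lt_of_le h1 h2

/-- The boundary relation reduces weakly increasing families to strictly increasing ones: lowering
the first pair of equal neighbours keeps the family weakly increasing. -/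
theorem eq_zero_of_boundary {τ : ℂ} {D : (Fin (n + 1) → ℕ) → ℂ}
    (hzero : ∀ y, Monotone y → y 0 = 0 → D y = 0)
    (hboundary : ∀ y, ∀ i j : Fin (n + 1), (j : ℕ) = i + 1 → ∀ k, y i = k + 1 → y j = k + 1 →
      D y = (1 + τ) * D (Function.update y i k) -
        τ * D (Function.update (Function.update y i k) j k))
    (hstrict : ∀ y, StrictMono y → (∀ A, 1 ≤ y A) →
      (∀ z, Monotone z → ∑ A, z A < ∑ A, y A → D z = 0) → D y = 0)
    (y : Fin (n + 1) → ℕ) (hy : Monotone y) : D y = 0 := by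
  induction hs : ∑ A, y A using Nat.strong_induction_on generalizing y with
  | _ s ih =>
  subst hs
  have ih' : ∀ z, Monotone z → ∑ A, z A < ∑ A, y A → D z = 0 := fun z hz hlt => ih _ hlt z hz rfl
  by_cases h0 : y 0 = 0
  · exact hzero y hy h0
  have hpos : ∀ A, 1 ≤ y A := fun A => (Nat.one_le_iff_ne_zero.2 h0).trans (hy (Fin.zero_le A))
  by_cases hstr : StrictMono y
  · exact hstrict y hstr hpos ih'
  · obtain ⟨i, j, hij, heq, hlt⟩ := exists_first_eq_succ hy hstr
    obtain ⟨k, hk⟩ := Nat.exists_eq_add_of_le' (hpos i)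
    have hkj : Function.update y i k j = k + 1 := by
      rw [Function.update_of_ne (Fin.ne_of_val_ne (by omega)), ← heq, hk]
    have hle : ∀ A < i, y A ≤ k := fun A hA => by
      have := hlt A hA
      omega
    have hm := monotone_update hy hk hle
    have hle' : ∀ A < j, Function.update y i k A ≤ k := fun A hA => by
      by_cases hA' : A = i
      · rw [hA', Function.update_self]
      · rw [Function.update_of_ne hA']
        refine hle A (lt_of_le_of_ne ?_ hA')
        rw [Fin.lt_def] at hA
        rw [Fin.le_def]
        omega
    rw [hboundary y i j hij k hk (heq ▸ hk), ih' _ hm (sum_update_lt hk),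
      ih' _ (monotone_update hm hkj hle') ((sum_update_lt hkj).trans (sum_update_lt hk))]
    ring

/-- A function of the time and of weakly increasing families of exponents vanishes if it satisfies
the evolution equation, the boundary condition at equal neighbours, vanishes if the first exponent
is `0`, and satisfies a recursion at time `0`. -/
theorem eq_zero_of_relations {b c d τ : ℂ} {D : ℕ → (Fin (n + 1) → ℕ) → ℂ}
    (hzero : ∀ t y, Monotone y → y 0 = 0 → D t y = 0)
    (hsucc : ∀ t (y : Fin (n + 1) → ℕ), StrictMono y → (∀ A, 1 ≤ y A) →
      ∑ S : Finset (Fin (n + 1)), b ^ S.card * D (t + 1) (lower S y) =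
        ∑ S : Finset (Fin (n + 1)), c ^ S.card * d ^ (n + 1 - S.card) * D t (lower S y))
    (hboundary : ∀ t y, ∀ i j : Fin (n + 1), (j : ℕ) = i + 1 → ∀ k, y i = k + 1 → y j = k + 1 →
      D t y = (1 + τ) * D t (Function.update y i k) -
        τ * D t (Function.update (Function.update y i k) j k))
    (htime : ∀ y k, y (Fin.last n) = k + 1 → (∀ A < Fin.last n, y A ≤ k) →
      D 0 y = τ * D 0 (Function.update y (Fin.last n) k))
    (t : ℕ) (y : Fin (n + 1) → ℕ) (hy : Monotone y) : D t y = 0 := by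
  induction t generalizing y with
  | zero =>
    refine eq_zero_of_boundary (hzero 0) (hboundary 0) (fun y hstr hpos ih => ?_) y hy
    obtain ⟨k, hk⟩ := Nat.exists_eq_add_of_le' (hpos (Fin.last n))
    have hle : ∀ A < Fin.last n, y A ≤ k := fun A hA => by
      have := hstr hA
      omega
    rw [htime y k hk hle, ih _ (monotone_update hstr.monotone hk hle) (sum_update_lt hk), mul_zero]
  | succ t iht =>
    refine eq_zero_of_boundary (hzero _) (hboundary _) (fun y hstr hpos ih => ?_) y hy
    -- all terms of the evolution equation vanish but the one that lowers no exponent at `t + 1`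
    have h := hsucc t y hstr hpos
    rw [Finset.sum_eq_zero (s := Finset.univ) (f := fun S : Finset (Fin (n + 1)) =>
        c ^ S.card * d ^ (n + 1 - S.card) * D t (lower S y)) fun S _ => by
          rw [iht _ (monotone_lower hstr S), mul_zero],
      Finset.sum_eq_single ∅ (fun S _ hS => by
        rw [ih _ (monotone_lower hstr S) (sum_lower_lt (Finset.nonempty_iff_ne_empty.2 hS) hpos),
          mul_zero]) (by simp)] at h
    simpa [lower_empty] using h

end Uniqueness

/-! ### The moment formula -/

section Formula

variable {τ κ δ b₁ b₂ : ℝ}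

/-- The moment formula for different exponents and small contours. -/
theorem moment_eq_dumbbellIntegral (hs : Scale τ κ δ) {ρ : ℝ} (hρ : 0 < ρ) (hρδ : ρ < τ * δ)
    (h₁ : 0 < b₁) (h₁' : b₁ < 1) (h₂ : 0 < b₂) (h₂' : b₂ < 1) (hτ : τ * b₁ = b₂)
    (hκ : κ * (1 - b₂) = 1 - b₁) {L : ℕ} {r : Fin L → ℝ} (hr : Radii τ δ r) (t : ℕ)
    {y : Fin L → ℕ} (hy : Monotone y) : (moment b₁ b₂ τ t y : ℂ) =
      (τ : ℂ) ^ (L * (L - 1) / 2) / (2 * Real.pi * Complex.I) ^ L *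
        dumbbellIntegral τ κ r ρ t y := by
  induction L generalizing t with
  | zero =>
    have : moment b₁ b₂ τ t y = 1 := by
      simpa [moment] using expectation_one h₁ h₁' h₂ h₂' t step
    rw [this, dumbbellIntegral, multiIntegral_fin_zero]
    simp [nested]
  | succ n ih =>
    have hpi : (2 * Real.pi * Complex.I : ℂ) ≠ 0 := Complex.two_pi_I_ne_zero
    set c : ℂ := (τ : ℂ) ^ ((n + 1) * (n + 1 - 1) / 2) / (2 * Real.pi * Complex.I) ^ (n + 1) with hc
    rw [← sub_eq_zero]
    refine eq_zero_of_relations (b := -(b₂ : ℂ)) (c := 1 - b₁ - b₂) (d := b₁) (τ := τ)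
      (D := fun t y => (moment b₁ b₂ τ t y : ℂ) - c * dumbbellIntegral τ κ r ρ t y)
      (fun t y hy h0 => ?_) (fun t y hstr hpos => ?_) (fun t y i j hij k hi hj => ?_)
      (fun y k hk hle => ?_) t y hy
    · have hexp : (n + 1) * (n + 1 - 1) / 2 = n * (n - 1) / 2 + n := by rw [← Nat.triangle_succ]
      rw [moment_of_zero t h0, ih hr.succ t fun A B h => hy (Fin.succ_le_succ_iff.2 h),
        dumbbellIntegral_of_zero hs hr hρ hρδ t h0, hc, hexp, pow_add, pow_succ _ n, inv_pow]
      have := hs.tau_ne_zero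
      field_simp
      ring
    · have e1 := sum_moment_succ h₁ h₁' h₂ h₂' hτ hs.tau_pos hs.tau_lt t hstr.injective hpos
      have e2 := sum_dumbbellIntegral_succ hs hr hρ hρδ hτ hκ t hpos
      have e3 := congrArg (fun x : ℝ => (x : ℂ)) e1
      push_cast at e3
      simp only [mul_sub, Finset.sum_sub_distrib, mul_left_comm _ c, ← Finset.mul_sum]
      rw [e2, e3]
    · have e1 := moment_boundary h₁ h₁' h₂ h₂' hs.tau_pos hs.tau_lt t
        (Fin.ne_of_val_ne (by omega) : i ≠ j) hi hj
      have e2 := multiIntegral_boundary (κ := κ) hs hr hρ hρδ t hij y hi hj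
      have e3 : (moment b₁ b₂ τ t y : ℂ) =
          (1 + τ) * (moment b₁ b₂ τ t (Function.update y i k) : ℂ) -
          τ * (moment b₁ b₂ τ t (Function.update (Function.update y i k) j k) : ℂ) := by
        exact_mod_cast e1
      simp only [dumbbellIntegral]
      linear_combination e3 - c * e2
    · have e1 := moment_zero_time (b₁ := b₁) (b₂ := b₂) (τ := τ) (Fin.last n) hk
      have e2 := dumbbellIntegral_zero_time hs hr hρ hρδ hk hle
      have e3 : (moment b₁ b₂ τ 0 y : ℂ) =
          τ * (moment b₁ b₂ τ 0 (Function.update y (Fin.last n) k) : ℂ) := by exact_mod_cast e1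
      linear_combination e3 - c * e2

theorem moment_const (t : ℕ) (L x : ℕ) : moment b₁ b₂ τ t (fun _ : Fin L => x) =
    expectation b₁ b₂ step (fun X => τ ^ (L * count x X)) t := by
  simp [moment, ← pow_mul, mul_comm]

end Formula

end SixVertex

theorem mainTheorem5 (b₁ b₂ : ℝ) (hb₁ : 0 < b₁) (hb₁' : b₁ < 1) (hb₂ : 0 < b₂) (hb₂' : b₂ < 1)
    (τ : ℝ) (hτ : τ = b₂ / b₁) (hτ1 : τ < 1) (t : ℕ) (ht : 0 < t) (L : ℕ) (x : ℤ)
    (Γ : Fin L → SixVertex.Contour)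
    (h_zero : ∀ A, (Γ A).Includes 0)
    (h_tau : ∀ A, (Γ A).Includes (-(τ : ℂ)))
    (h_kappa : ∀ A, (Γ A).Excludes (-((1 - b₂) / (1 - b₁) : ℂ)))
    (h_cross : ∀ A B, A < B → ∀ u ∈ (Γ B).support, (Γ A).Excludes (τ * u))
    (h_one : x < 0 → ∀ A, (Γ A).Excludes (-1)) :
    Summable (fun X : SixVertex.WInf =>
      SixVertex.transferPow b₁ b₂ t SixVertex.step X * τ ^ (L * SixVertex.count x X)) ∧
    (SixVertex.expectation b₁ b₂ SixVertex.step (fun X => τ ^ (L * SixVertex.count x X)) t : ℂ) =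
      (τ : ℂ) ^ (L * (L - 1) / 2) / (2 * Real.pi * Complex.I) ^ L *
        SixVertex.multiIntegral Γ (SixVertex.integrand b₁ b₂ t x) := by
  have h0 : 0 < τ := hτ ▸ div_pos hb₂ hb₁
  have hτb : τ * b₁ = b₂ := by rw [hτ, div_mul_cancel₀ _ hb₁.ne']
  refine ⟨SixVertex.summable_transferPow_mul hb₁ hb₁' hb₂ hb₂' t _ (C := 1) fun X => ?_, ?_⟩
  · rw [abs_of_nonneg (pow_nonneg h0.le _)]
    exact pow_le_one₀ h0.le hτ1.le
  set κ : ℝ := (1 - b₁) / (1 - b₂) with hκdef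
  have hκ : κ * (1 - b₂) = 1 - b₁ := div_mul_cancel₀ _ (sub_pos.2 hb₂').ne'
  have hκ0 : 0 < κ := div_pos (sub_pos.2 hb₁') (sub_pos.2 hb₂')
  have hκ1 : κ < 1 := by
    rw [hκdef, div_lt_one (sub_pos.2 hb₂')]
    nlinarith
  have hκinv : ((1 - b₂) / (1 - b₁) : ℂ) = (κ : ℂ)⁻¹ := by
    rw [hκdef]
    push_cast
    rw [inv_div]
  have hτc : (b₂ : ℂ) / b₁ = τ := by rw [hτ]; push_cast; rfl
  have hκc : ((1 - b₁) / (1 - b₂) : ℂ) = κ := by rw [hκdef]; push_cast; rfl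
  rw [hκinv] at h_kappa
  rw [SixVertex.integrand_eq_nested, hτc, hκc]
  have hτ0 : (τ : ℂ) ≠ 0 := by exact_mod_cast h0.ne'
  have hκ0' : (κ : ℂ) ≠ 0 := by exact_mod_cast hκ0.ne'
  rcases le_or_gt x 0 with hx | hx
  · -- no particle has reached a nonpositive position
    have hone : SixVertex.expectation b₁ b₂ SixVertex.step
        (fun X => τ ^ (L * SixVertex.count x X)) t = 1 := by
      rw [← SixVertex.expectation_one hb₁ hb₁' hb₂ hb₂' t SixVertex.step]
      refine SixVertex.expectation_congr fun X hX => ?_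
      rw [SixVertex.count_step_zero_of_transferPow hX hx, mul_zero, pow_zero]
    have hint := SixVertex.multiIntegral_oneBody_of_nonpos hτ0 hκ0' t hx Γ h_zero h_kappa h_cross
      h_one
    rw [hone, div_mul_eq_mul_div, hint, div_self (pow_ne_zero _ Complex.two_pi_I_ne_zero)]
    norm_num
  · obtain ⟨x, rfl⟩ := Int.eq_ofNat_of_zero_le hx.le
    obtain ⟨δ, hs, hsmall⟩ := SixVertex.exists_scale_small h0 hτ1 hκ0 hκ1 h_zero h_tau h_cross
    obtain ⟨r, hr⟩ := SixVertex.exists_radii hs L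
    obtain ⟨ρ, hρ, hρδ⟩ := exists_between hs.tau_mul_pos
    rw [SixVertex.multiIntegral_eq_dumbbellIntegral hs hr hρ hρδ t x hsmall h_zero h_tau h_kappa
      h_cross, ← SixVertex.moment_const, SixVertex.moment_eq_dumbbellIntegral hs hρ hρδ hb₁ hb₁'
      hb₂ hb₂' hτb hκ hr t fun _ _ _ => le_rfl]
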